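/- \textbf{Theorem (Uniqueness).} Let $T_-,T_+$ be orthogonal projectors in $\mathbb{C}^N$ and put $T_\pm^\perp=I-T_\pm$. For $V=V^*\in L^1([0,1];\mathbb{C}^{N\times N})$ and self-adjoint operators $a=T_-^\perp aT_-^\perp$, $b=T_+^\perp bT_+^\perp$ on $\mathbb{C}^N$, let $L$ be the self-adjoint operator $L\psi=-\psi''+V\psi$ in $L^2([0,1];\mathbb{C}^N)$ with the separated boundary conditions $\Gamma_-\psi=\Gamma_+\psi=0$, where \[ \Gamma_-\psi=T_-^\perp(\psi'(0)-a\psi(0))-T_-\psi(0),\qquad \Gamma_+\psi=T_+^\perp(\psi'(1)+b\psi(1))-T_+\psi(1). \] Let $\lambda_0<\lambda_1<\dots$ be the eigenvalues of $L$, counted without multiplicity, and let $F_-(x,\lambda)$ be the $N\times N$ matrix solution of $-F''+VF=\lambda F$ on $[0,1]$ with $\Gamma_-F_-=0$ and $T_-^\perp F_-(0,\lambda)+T_-F_-'(0,\lambda)=I$. For each $\alpha\ge 0$ let $P_\alpha$ be the orthogonal projector of $\mathbb{C}^N$ onto $\mathcal{E}_\alpha=\operatorname{Ker}(\Gamma_+F_-)(\lambda_\alpha)$,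 and let \[ g_\alpha=\bigl(P_\alpha S_\alpha P_\alpha\bigr)\big|_{\mathcal{E}_\alpha}\colon\mathcal{E}_\alpha\to\mathcal{E}_\alpha,\qquad S_\alpha=\int_0^1 F_-(x,\lambda_\alpha)^*F_-(x,\lambda_\alpha)\,dx . \] The set of triples $\{(\lambda_\alpha,P_\alpha,g_\alpha)\}_{\alpha\ge0}$ is called the spectral data of $L$. For fixed $T_\pm$, the spectral data determine $V$, $a$ and $b$ uniquely: if the spectral data corresponding to $(V;a,b)$ and to $(\tilde V;\tilde a,\tilde b)$, both of the above kind and with the same $T_\pm$, coincide, then $V=\tilde V$ almost everywhere on $[0,1]$, $a=\tilde a$ and $b=\tilde b$. -/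

import Mathlib

open MeasureTheory

/-- Lebesgue measure on `[0,1]`. -/
noncomputable abbrev unitMeasure : Measure ℝ := volume.restrict (Set.Icc (0 : ℝ) 1)

/-- `ψ` is differentiable on `[0,1]` (one-sidedly at the end points) with derivative `ψ₁`, and `ψ₁`
is absolutely continuous with almost everywhere derivative `ψ₂ ∈ L¹`, i.e. it is the indefinite
integral of `ψ₂`. -/
structure HasACDerivs {M : Type*} [NormedAddCommGroup M] [NormedSpace ℝ M]
    (ψ ψ₁ ψ₂ : ℝ → M) : Prop where
  hasDeriv : ∀ x ∈ Set.Icc (0 : ℝ) 1, HasDerivWithinAt ψ (ψ₁ x) (Set.Icc (0 : ℝ) 1) x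
  integrable : Integrable ψ₂ unitMeasure
  eq_integral : ∀ x ∈ Set.Icc (0 : ℝ) 1, ψ₁ x = ψ₁ 0 + ∫ t in (0 : ℝ)..x, ψ₂ t

section SturmLiouville

/-! Throughout, `E` stands for `ℂ^N` with its Hermitian inner product, and the `N × N` complex
matrices are the operators `E →L[ℂ] E`: the product is composition, `star` is the adjoint (the
conjugate transpose), and the norm is the operator norm. -/

variable {E : Type*} [NormedAddCommGroup E] [InnerProductSpace ℂ E] [FiniteDimensional ℂ E]
  [CompleteSpace E]

/-! The boundary operators. They act on vector-valued functions (`M = E`, where `A • v` is `A v`)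
and on matrix-valued functions (`M = E →L[ℂ] E`, where `A • B` is the product `A * B`). -/

/-- `Γ₋ψ = T₋^⊥ (ψ'(0) - a ψ(0)) - T₋ ψ(0)`, for the values `ψ0 = ψ(0)` and `dψ0 = ψ'(0)`. -/
noncomputable def bdryMinus {M : Type*} [AddCommGroup M] [Module (E →L[ℂ] E) M]
    (Tm a : E →L[ℂ] E) (ψ0 dψ0 : M) : M :=
  (1 - Tm) • (dψ0 - a • ψ0) - Tm • ψ0

/-- `Γ₋^⊥ψ = T₋^⊥ ψ(0) + T₋ ψ'(0)`, for the values `ψ0 = ψ(0)` and `dψ0 = ψ'(0)`. -/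
noncomputable def bdryMinusPerp {M : Type*} [AddCommGroup M] [Module (E →L[ℂ] E) M]
    (Tm : E →L[ℂ] E) (ψ0 dψ0 : M) : M :=
  (1 - Tm) • ψ0 + Tm • dψ0

/-- `Γ₊ψ = T₊^⊥ (ψ'(1) + b ψ(1)) - T₊ ψ(1)`, for the values `ψ1 = ψ(1)` and `dψ1 = ψ'(1)`. -/
noncomputable def bdryPlus {M : Type*} [AddCommGroup M] [Module (E →L[ℂ] E) M]
    (Tp b : E →L[ℂ] E) (ψ1 dψ1 : M) : M :=
  (1 - Tp) • (dψ1 + b • ψ1) - Tp • ψ1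

/-- The admissible parameters `(V; a, b)`: `V = V* ∈ L¹([0,1])`, `a = a* = T₋^⊥ a T₋^⊥` and
`b = b* = T₊^⊥ b T₊^⊥`. -/
structure IsSLParam (Tm Tp : E →L[ℂ] E) (V : ℝ → E →L[ℂ] E) (a b : E →L[ℂ] E) : Prop where
  integrable : Integrable V unitMeasure
  selfAdjoint : ∀ᵐ x ∂unitMeasure, IsSelfAdjoint (V x)
  a_selfAdjoint : IsSelfAdjoint a
  a_compress : (1 - Tm) * a * (1 - Tm) = a
  b_selfAdjoint : IsSelfAdjoint b
  b_compress : (1 - Tp) * b * (1 - Tp) = b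

/-- The graph of the Sturm-Liouville operator `L` in `L²([0,1]; ℂ^N)`: the function `ψ` lies in the
domain of `L` and `Lψ = f`. The domain consists of all `ψ` such that `ψ, ψ'` are absolutely
continuous, `-ψ'' + Vψ ∈ L²` and `Γ₋ψ = Γ₊ψ = 0`, and `Lψ = -ψ'' + Vψ`. -/
def SLMaps (Tm Tp : E →L[ℂ] E) (V : ℝ → E →L[ℂ] E) (a b : E →L[ℂ] E) (ψ f : ℝ → E) : Prop :=
  ∃ ψ₁ ψ₂ : ℝ → E, HasACDerivs ψ ψ₁ ψ₂ ∧
    bdryMinus Tm a (ψ 0) (ψ₁ 0) = 0 ∧ bdryPlus Tp b (ψ 1) (ψ₁ 1) = 0 ∧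
    MemLp f 2 unitMeasure ∧ ∀ᵐ x ∂unitMeasure, f x = -ψ₂ x + V x (ψ x)

/-- `lam` is an eigenvalue of `L` (which is self-adjoint, so its eigenvalues are real). -/
def IsSLEigenvalue (Tm Tp : E →L[ℂ] E) (V : ℝ → E →L[ℂ] E) (a b : E →L[ℂ] E) (lam : ℝ) : Prop :=
  ∃ ψ : ℝ → E, ¬ (ψ =ᵐ[unitMeasure] 0) ∧ SLMaps Tm Tp V a b ψ (fun x => (lam : ℂ) • ψ x)

/-- `F = F₋(·, lam)` on `[0,1]`, with derivative `F₁`: the matrix-valued solution of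
`-F'' + V F = lam F` with `Γ₋F = 0` and `Γ₋^⊥F = I`. -/
def IsFundMinus (Tm : E →L[ℂ] E) (V : ℝ → E →L[ℂ] E) (a : E →L[ℂ] E) (lam : ℂ)
    (F F₁ : ℝ → E →L[ℂ] E) : Prop :=
  ∃ F₂ : ℝ → E →L[ℂ] E, HasACDerivs F F₁ F₂ ∧
    (∀ᵐ x ∂unitMeasure, -F₂ x + V x * F x = lam • F x) ∧
    bdryMinus Tm a (F 0) (F₁ 0) = 0 ∧ bdryMinusPerp Tm (F 0) (F₁ 0) = 1

variable (E) in
/-- The type of the triples `(λ, P, g)`, where `g` is an operator acting in the range of `P`. -/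
structure SpectralTriple where
  eigenvalue : ℝ
  P : E →L[ℂ] E
  g : LinearMap.range P.toLinearMap →ₗ[ℂ] LinearMap.range P.toLinearMap

/-- The orthogonal projector of `ℂ^N` onto the kernel of `W`. -/
noncomputable def kerProj (W : E →L[ℂ] E) : E →L[ℂ] E :=
  (LinearMap.ker W.toLinearMap).starProjection

/-- The restriction of `P S P` to an operator acting in the range of `P`. -/
noncomputable def compressTo (P S : E →L[ℂ] E) :
    LinearMap.range P.toLinearMap →ₗ[ℂ] LinearMap.range P.toLinearMap :=
  (P * S * P).toLinearMap.restrict (fun x _ => ⟨S (P x), rfl⟩)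

/-- The triple `(lam, P, g)` built from `F = F₋(·, lam)` and its derivative `F₁`: `P` is the
orthogonal projector onto `Ker (Γ₊F₋)(lam)` and `g` is the restriction of `P S P` to this kernel,
where `S = ∫₀¹ F(x)* F(x) dx`. -/
noncomputable def spectralTriple (Tp b : E →L[ℂ] E) (lam : ℝ) (F F₁ : ℝ → E →L[ℂ] E) :
    SpectralTriple E where
  eigenvalue := lam
  P := kerProj (bdryPlus Tp b (F 1) (F₁ 1))
  g := compressTo (kerProj (bdryPlus Tp b (F 1) (F₁ 1))) (∫ x in (0 : ℝ)..1, star (F x) * F x)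

/-- The spectral data of `L`: the set of all triples `(λ, P, g)`, one for each eigenvalue `λ`. -/
def spectralData (Tm Tp : E →L[ℂ] E) (V : ℝ → E →L[ℂ] E) (a b : E →L[ℂ] E) :
    Set (SpectralTriple E) :=
  {t | ∃ lam : ℝ, IsSLEigenvalue Tm Tp V a b lam ∧
    ∃ F F₁ : ℝ → E →L[ℂ] E, IsFundMinus Tm V a (lam : ℂ) F F₁ ∧ t = spectralTriple Tp b lam F F₁}

end SturmLiouville

open MeasureTheory Set Filter Topology

/-! ### Integrals over the unit interval and Grönwall's inequality with integrable coefficients -/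

section IntervalTools

/-! The two operators are linked by a unitary operator in `L²` that carries eigenfunctions to
eigenfunctions, and this operator is shown to be the identity because it and its adjoint are both
causal.

Eigenfunctions of `L` are the columns `F₋(·, λ) c` with `c` in the kernel of `Γ₊F₋(λ)`. The
projectors `P` prescribe these kernels and the operators `g` prescribe the inner products of columns
with the same `λ`; columns with different `λ` are orthogonal by Green's formula. Hence equal
spectral data make the Gram matrices of the two families of eigenfunctions equal
(`inner_columnL2_eq_of_spectralData_eq`). Both families are complete, by the spectral theorem for
the compact symmetric resolvent, so there is a unitary `W` with `W(F c) = F' c`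
(`exists_unitary_of_gram_eq`).

The analytic core is `exists_comparison_bound`: for any finite combination of solutions of the two
equations with the same left normalisation, `‖∑ u'(x) - ∑ u(x)‖ ≤ K ∫₀ˣ ‖∑ u‖`, with `K` independent
of the frequencies and of the number of terms. It stands in for the Gelfand–Levitan transformation
operator without constructing a kernel: multiplying by `cos(kτ)` turns solutions into waves, and
finite propagation speed gives the estimate on a characteristic triangle (`exists_transform_bound`).

By density `W - I` is therefore of Volterra type, and so is `W* - I`. Causality of `W*` makes `W`
anticausal; a map that is causal and anticausal, and whose distance to the identity is a vanishing
integral over short intervals, is the identity (`eq_self_of_causal_unitary`). So eigenfunctions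
coincide. The comparison bound, applied to an arbitrary column minus approximating eigenfunctions,
extends this to every `F₋(·, λ)`. The initial derivative then gives `a`, the differential equation
gives `V`, and a Green's formula argument at a regular point gives `b`. -/

theorem MeasureTheory.Integrable.intervalIntegrable_of_unit {M : Type*} [NormedAddCommGroup M]
    {f : ℝ → M} (hf : Integrable f unitMeasure) {a b : ℝ} (ha : a ∈ Icc (0 : ℝ) 1)
    (hb : b ∈ Icc (0 : ℝ) 1) : IntervalIntegrable f volume a b := by
  have h : IntegrableOn f (Icc 0 1) volume := hf
  rw [intervalIntegrable_iff]
  exact h.mono_set (uIoc_subset_uIcc.trans (uIcc_subset_Icc ha hb))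

theorem zero_mem_unit : (0 : ℝ) ∈ Icc (0 : ℝ) 1 := ⟨le_refl 0, zero_le_one⟩

theorem one_mem_unit : (1 : ℝ) ∈ Icc (0 : ℝ) 1 := ⟨zero_le_one, le_refl 1⟩

theorem ContinuousOn.integrable_unit {M : Type*} [NormedAddCommGroup M] {f : ℝ → M}
    (hf : ContinuousOn f (Icc 0 1)) : Integrable f unitMeasure :=
  hf.integrableOn_compact isCompact_Icc

/-- `∫₀ˣ k(t) e^{κt} dt` is a small fraction of `e^{κx}` when `κ` is large. -/
theorem exists_exp_weight {k : ℝ → ℝ} (hk : Integrable k unitMeasure) {ε : ℝ} (hε : 0 < ε) :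
    ∃ κ : ℝ, 0 ≤ κ ∧ ∀ x ∈ Icc (0 : ℝ) 1,
      ∫ t in (0 : ℝ)..x, k t * Real.exp (κ * t) ≤ ε * Real.exp (κ * x) := by
  -- Truncation: `k` is at most a constant plus the excess `(k - n)⁺`, whose integral is small for
  -- large `n`; against the constant, a large `κ` gains the factor `1 / κ`.
  have h1 : Tendsto (fun n : ℕ => ∫ t, max (k t - n) 0 ∂unitMeasure) atTop
      (𝓝 (∫ _t : ℝ, (0 : ℝ) ∂unitMeasure)) := by
    refine tendsto_integral_of_dominated_convergence (fun t => ‖k t‖) ?_ hk.norm ?_ ?_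
    · intro n
      exact ((hk.aestronglyMeasurable.sub aestronglyMeasurable_const).sup
        aestronglyMeasurable_const)
    · intro n
      refine Eventually.of_forall fun t => ?_
      rw [Real.norm_of_nonneg (le_max_right _ _)]
      refine max_le ?_ (norm_nonneg _)
      have := Real.le_norm_self (k t)
      have h0 : (0 : ℝ) ≤ n := n.cast_nonneg
      linarith
    · refine Eventually.of_forall fun t => ?_
      refine tendsto_const_nhds.congr' ?_
      obtain ⟨N, hN⟩ := exists_nat_ge (k t)
      filter_upwards [eventually_ge_atTop N] with n hn
      have : (N : ℝ) ≤ n := by exact_mod_cast hn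
      rw [max_eq_right]
      linarith
  rw [integral_zero] at h1
  obtain ⟨n, hn⟩ := (h1.eventually (gt_mem_nhds (half_pos hε))).exists
  -- The `+ 1` only secures positivity. The choice `κ = 2C/ε` makes the bounded part contribute `C/κ
  -- = ε/2`.
  set C : ℝ := n + 1
  have hC : 0 < C := by positivity
  refine ⟨2 * C / ε, by positivity, fun x hx => ?_⟩
  set κ := 2 * C / ε
  have hκ : 0 < κ := by positivity
  have hkn : Integrable (fun t => max (k t - n) 0) unitMeasure :=
    (hk.sub (integrable_const (n : ℝ))).pos_part
  have i1 : IntervalIntegrable (fun t => C * Real.exp (κ * t)) volume 0 x :=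
    (by fun_prop : Continuous fun t => C * Real.exp (κ * t)).intervalIntegrable _ _
  have i2 : IntervalIntegrable (fun t => max (k t - n) 0 * Real.exp (κ * x)) volume 0 x :=
    (hkn.intervalIntegrable_of_unit zero_mem_unit hx).mul_const _
  have i3 : IntervalIntegrable (fun t => k t * Real.exp (κ * t)) volume 0 x :=
    (hk.intervalIntegrable_of_unit zero_mem_unit hx).mul_continuousOn (by fun_prop)
  have e1 : ∫ t in (0 : ℝ)..x, C * Real.exp (κ * t) = C / κ * (Real.exp (κ * x) - 1) := by
    have : ∀ t ∈ uIcc 0 x, HasDerivAt (fun t => C / κ * Real.exp (κ * t))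
        (C * Real.exp (κ * t)) t := by
      intro t _
      have h2 := (((hasDerivAt_id t).const_mul κ).exp).const_mul (C / κ)
      refine h2.congr_deriv ?_
      simp only [id]
      field_simp
    rw [intervalIntegral.integral_eq_sub_of_hasDerivAt this i1]
    simp
    ring
  have e2 : ∫ t in (0 : ℝ)..x, max (k t - n) 0 * Real.exp (κ * x) ≤
      ε / 2 * Real.exp (κ * x) := by
    rw [intervalIntegral.integral_mul_const]
    refine mul_le_mul_of_nonneg_right (le_trans ?_ hn.le) (Real.exp_pos _).le
    rw [intervalIntegral.integral_of_le hx.1]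
    exact setIntegral_mono_set hkn (Eventually.of_forall fun t => le_max_right _ _)
      ((Ioc_subset_Icc_self.trans (Icc_subset_Icc_right hx.2)).eventuallyLE)
  calc ∫ t in (0 : ℝ)..x, k t * Real.exp (κ * t)
      ≤ ∫ t in (0 : ℝ)..x, (C * Real.exp (κ * t) + max (k t - n) 0 * Real.exp (κ * x)) := by
        refine intervalIntegral.integral_mono_on hx.1 i3 (i1.add i2) fun t ht => ?_
        have h3 : Real.exp (κ * t) ≤ Real.exp (κ * x) := by
          gcongr
          exact ht.2
        have h4 : k t ≤ C + max (k t - n) 0 := by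
          have := le_max_left (k t - n) 0
          simp only [C]
          linarith
        calc k t * Real.exp (κ * t) ≤ (C + max (k t - n) 0) * Real.exp (κ * t) := by gcongr
          _ = C * Real.exp (κ * t) + max (k t - n) 0 * Real.exp (κ * t) := by ring
          _ ≤ _ := by gcongr
    _ ≤ C / κ * (Real.exp (κ * x) - 1) + ε / 2 * Real.exp (κ * x) := by
        rw [intervalIntegral.integral_add i1 i2, e1]
        gcongr
    _ ≤ ε * Real.exp (κ * x) := by
        have : C / κ = ε / 2 := by
          simp only [κ]
          field_simp
        rw [this]
        nlinarith

/-- Grönwall's inequality with an integrable coefficient. -/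
theorem exists_gronwall_const {k : ℝ → ℝ} (hk : Integrable k unitMeasure) (hk0 : ∀ x, 0 ≤ k x) :
    ∃ C : ℝ, 0 ≤ C ∧ ∀ (v : ℝ → ℝ) (c : ℝ), ContinuousOn v (Icc 0 1) → 0 ≤ c →
      (∀ x ∈ Icc (0 : ℝ) 1, v x ≤ c + ∫ t in (0 : ℝ)..x, k t * v t) →
      ∀ x ∈ Icc (0 : ℝ) 1, v x ≤ C * c := by
  obtain ⟨κ, hκ, hw⟩ := exists_exp_weight hk (half_pos one_pos)
  refine ⟨2 * Real.exp κ, by positivity, fun v c hv hc hb x hx => ?_⟩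
  -- At a maximum point of `v(x) e^{-κx}` the integral term is at most half of the maximum, so it
  -- can be absorbed.
  obtain ⟨y, hy, hmax⟩ := isCompact_Icc.exists_isMaxOn (nonempty_Icc.2 zero_le_one)
    (f := fun x => v x * Real.exp (-(κ * x))) (hv.mul (by fun_prop))
  set Q := v y * Real.exp (-(κ * y)) with hQ
  have hvQ : ∀ t ∈ Icc (0 : ℝ) 1, v t ≤ Q * Real.exp (κ * t) := by
    intro t ht
    have h1 : v t * Real.exp (-(κ * t)) ≤ Q := hmax ht
    calc v t = v t * Real.exp (-(κ * t)) * Real.exp (κ * t) := by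
          rw [mul_assoc, ← Real.exp_add]; simp
      _ ≤ _ := by gcongr
  by_cases hQ0 : Q ≤ 0
  · calc v x ≤ Q * Real.exp (κ * x) := hvQ x hx
      _ ≤ 0 := mul_nonpos_of_nonpos_of_nonneg hQ0 (Real.exp_pos _).le
      _ ≤ _ := by positivity
  push Not at hQ0
  have hyQ : v y = Q * Real.exp (κ * y) := by
    rw [hQ, mul_assoc, ← Real.exp_add]; simp
  have hQc : Q ≤ 2 * c := by
    have h1 : Q * Real.exp (κ * y) ≤ c + Q * (1 / 2 * Real.exp (κ * y)) := by
      rw [← hyQ]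
      refine (hb y hy).trans ?_
      gcongr
      refine le_trans ?_ (mul_le_mul_of_nonneg_left (hw y hy) hQ0.le)
      rw [← intervalIntegral.integral_const_mul]
      refine intervalIntegral.integral_mono_on hy.1 ?_ ?_ ?_
      · refine (hk.intervalIntegrable_of_unit zero_mem_unit hy).mul_continuousOn (hv.mono ?_)
        rw [uIcc_of_le hy.1]
        exact Icc_subset_Icc_right hy.2
      · exact ((hk.intervalIntegrable_of_unit zero_mem_unit hy).mul_continuousOn
          (by fun_prop)).const_mul _
      · intro t ht
        calc k t * v t ≤ k t * (Q * Real.exp (κ * t)) :=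
              mul_le_mul_of_nonneg_left (hvQ t ⟨ht.1, ht.2.trans hy.2⟩) (hk0 t)
          _ = _ := by ring
    have h2 : 1 ≤ Real.exp (κ * y) := Real.one_le_exp (mul_nonneg hκ hy.1)
    nlinarith
  calc v x ≤ Q * Real.exp (κ * x) := hvQ x hx
    _ ≤ 2 * c * Real.exp κ := by
        gcongr
        nlinarith [hx.2]
    _ = _ := by ring

end IntervalTools

/-! ### Linear equations with integrable coefficients -/

section LinearODE

variable {M M' : Type*} [NormedAddCommGroup M] [NormedSpace ℝ M]
  [NormedAddCommGroup M'] [NormedSpace ℝ M']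

/-- Linear Volterra integral equations with an integrable coefficient are solvable. -/
theorem exists_volterra [CompleteSpace M] {A : ℝ → M →L[ℝ] M} (hA : Integrable A unitMeasure)
    {h : ℝ → M} (hh : ContinuousOn h (Icc 0 1)) :
    ∃ y : ℝ → M, ContinuousOn y (Icc 0 1) ∧
      ∀ x ∈ Icc (0 : ℝ) 1, y x = h x + ∫ t in (0 : ℝ)..x, A t (y t) := by
  obtain ⟨κ, hκ, hw⟩ := exists_exp_weight hA.norm (half_pos one_pos)
  let ext (w : C(Icc (0 : ℝ) 1, M)) (t : ℝ) : M := IccExtend zero_le_one w t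
  have ext_cont (w : C(Icc (0 : ℝ) 1, M)) : Continuous (ext w) := w.continuous.Icc_extend'
  let g (w : C(Icc (0 : ℝ) 1, M)) (t : ℝ) : M := A t (Real.exp (κ * t) • ext w t)
  have hg (w) : Integrable (g w) unitMeasure := by
    have hc : ContinuousOn (fun t => Real.exp (κ * t) • ext w t) (Icc 0 1) :=
      ((by fun_prop : Continuous fun t : ℝ => Real.exp (κ * t)).smul (ext_cont w)).continuousOn
    obtain ⟨B, hB⟩ := isCompact_Icc.exists_bound_of_continuousOn hc
    refine (hA.norm.mul_const B).mono' ?_ ?_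
    · exact (ContinuousLinearMap.apply ℝ M).flip.aestronglyMeasurable_comp₂
        hA.aestronglyMeasurable hc.integrable_unit.aestronglyMeasurable
    · filter_upwards [ae_restrict_mem measurableSet_Icc] with t ht
      exact ((A t).le_opNorm _).trans (by gcongr; exact hB t ht)
  -- The unknown is `w = e^{-κx} y`: in this weighted form the Volterra map is a contraction of the
  -- sup norm with factor `1/2`, so no iteration of the map is needed.
  let Φ (w : C(Icc (0 : ℝ) 1, M)) : C(Icc (0 : ℝ) 1, M) :=
    { toFun := fun x => Real.exp (-(κ * x)) • (h x + ∫ t in (0 : ℝ)..x, g w t)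
      continuous_toFun := by
        have h1 : ContinuousOn (fun x : ℝ => ∫ t in (0 : ℝ)..x, g w t) (Icc 0 1) := by
          have := intervalIntegral.continuousOn_primitive_interval' (μ := volume) (f := g w)
            (a := 0) (b₁ := 0) (b₂ := 1)
            ((hg w).intervalIntegrable_of_unit zero_mem_unit one_mem_unit) (by simp)
          rwa [uIcc_of_le zero_le_one] at this
        exact ((by fun_prop : Continuous fun x : ℝ => Real.exp (-(κ * x))).comp
          continuous_subtype_val).smul (hh.add h1).domRestrict }
  have hΦ : ContractingWith (1 / 2) Φ := by
    refine ⟨by norm_num, LipschitzWith.of_dist_le_mul fun w w' => ?_⟩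
    rw [ContinuousMap.dist_le (by positivity)]
    intro x
    have e1 : Φ w x - Φ w' x =
        Real.exp (-(κ * x)) • ∫ t in (0 : ℝ)..x, A t (Real.exp (κ * t) • ext (w - w') t) := by
      change Real.exp (-(κ * x)) • (h x + ∫ t in (0 : ℝ)..x, g w t) -
        Real.exp (-(κ * x)) • (h x + ∫ t in (0 : ℝ)..x, g w' t) = _
      rw [← smul_sub, add_sub_add_left_eq_sub, ← intervalIntegral.integral_sub
        ((hg w).intervalIntegrable_of_unit zero_mem_unit x.2)
        ((hg w').intervalIntegrable_of_unit zero_mem_unit x.2)]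
      congr 1
      refine intervalIntegral.integral_congr fun t _ => ?_
      simp [g, ext, IccExtend, smul_sub]
    rw [dist_eq_norm, e1, norm_smul, Real.norm_of_nonneg (Real.exp_pos _).le]
    have e2 : ‖∫ t in (0 : ℝ)..x, A t (Real.exp (κ * t) • ext (w - w') t)‖ ≤
        1 / 2 * Real.exp (κ * x) * dist w w' := by
      calc ‖∫ t in (0 : ℝ)..x, A t (Real.exp (κ * t) • ext (w - w') t)‖
          ≤ ∫ t in (0 : ℝ)..x, ‖A t‖ * Real.exp (κ * t) * dist w w' := by
            refine intervalIntegral.norm_integral_le_of_norm_le x.2.1 ?_ ?_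
            · refine Eventually.of_forall fun t _ => ((A t).le_opNorm _).trans ?_
              rw [norm_smul, Real.norm_of_nonneg (Real.exp_pos _).le, mul_assoc]
              gcongr
              rw [dist_eq_norm]
              exact ContinuousMap.norm_coe_le_norm (w - w') _
            · exact ((hA.norm.intervalIntegrable_of_unit zero_mem_unit x.2).mul_continuousOn
                (by fun_prop)).mul_const _
        _ ≤ _ := by
            rw [intervalIntegral.integral_mul_const]
            exact mul_le_mul_of_nonneg_right (hw x x.2) dist_nonneg
    calc Real.exp (-(κ * x)) * ‖∫ t in (0 : ℝ)..x, A t (Real.exp (κ * t) • ext (w - w') t)‖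
        ≤ Real.exp (-(κ * x)) * (1 / 2 * Real.exp (κ * x) * dist w w') := by gcongr
      _ = 1 / 2 * dist w w' * (Real.exp (-(κ * x)) * Real.exp (κ * x)) := by ring
      _ = 1 / 2 * dist w w' := by rw [← Real.exp_add]; simp
      _ ≤ _ := by simp
  obtain ⟨w, hw', -⟩ := hΦ.exists_fixedPoint 0 (edist_ne_top _ _)
  refine ⟨fun t => Real.exp (κ * t) • ext w t,
    ((by fun_prop : Continuous fun t : ℝ => Real.exp (κ * t)).smul (ext_cont w)).continuousOn,
    fun x hx => ?_⟩
  have h2 : ext w x = Real.exp (-(κ * x)) • (h x + ∫ t in (0 : ℝ)..x, g w t) := by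
    have h3 : w ⟨x, hx⟩ = Φ w ⟨x, hx⟩ := by rw [hw']
    have h4 : ext w x = w ⟨x, hx⟩ := IccExtend_of_mem _ _ hx
    rw [h4, h3]
    rfl
  change Real.exp (κ * x) • ext w x = _
  rw [h2, smul_smul, ← Real.exp_add]
  simp [g]

namespace HasACDerivs

variable {ψ ψ₁ ψ₂ φ φ₁ φ₂ : ℝ → M}

theorem continuousOn (h : HasACDerivs ψ ψ₁ ψ₂) : ContinuousOn ψ (Icc 0 1) :=
  fun x hx => (h.hasDeriv x hx).continuousWithinAt

theorem continuousOn_deriv (h : HasACDerivs ψ ψ₁ ψ₂) : ContinuousOn ψ₁ (Icc 0 1) := by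
  have := intervalIntegral.continuousOn_primitive_interval' (μ := volume) (f := ψ₂)
    (a := 0) (b₁ := 0) (b₂ := 1)
    (h.integrable.intervalIntegrable_of_unit zero_mem_unit one_mem_unit) (by simp)
  rw [uIcc_of_le zero_le_one] at this
  exact (continuousOn_const.add this).congr h.eq_integral

theorem eq_integral_deriv [CompleteSpace M] (h : HasACDerivs ψ ψ₁ ψ₂) {x : ℝ}
    (hx : x ∈ Icc (0 : ℝ) 1) : ψ x = ψ 0 + ∫ t in (0 : ℝ)..x, ψ₁ t := by
  rw [intervalIntegral.integral_eq_sub_of_hasDeriv_right_of_le hx.1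
    (h.continuousOn.mono (Icc_subset_Icc_right hx.2)) (f' := ψ₁) ?_
    (h.continuousOn_deriv.integrable_unit.intervalIntegrable_of_unit zero_mem_unit hx)]
  · simp
  · intro t ht
    exact ((h.hasDeriv t ⟨ht.1.le, ht.2.le.trans hx.2⟩).hasDerivAt
      (Icc_mem_nhds ht.1 (ht.2.trans_le hx.2))).hasDerivWithinAt

theorem of_eq_integral [CompleteSpace M] (h₁ : ContinuousOn ψ₁ (Icc 0 1))
    (h : ∀ x ∈ Icc (0 : ℝ) 1, ψ x = ψ 0 + ∫ t in (0 : ℝ)..x, ψ₁ t)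
    (h₂ : Integrable ψ₂ unitMeasure)
    (h₂' : ∀ x ∈ Icc (0 : ℝ) 1, ψ₁ x = ψ₁ 0 + ∫ t in (0 : ℝ)..x, ψ₂ t) :
    HasACDerivs ψ ψ₁ ψ₂ := by
  refine ⟨fun x hx => ?_, h₂, h₂'⟩
  -- Feeds the filter instance that gives the one-sided derivative at the end points.
  have : Fact (x ∈ Icc (0 : ℝ) 1) := ⟨hx⟩
  have h3 : HasDerivWithinAt (fun x => ∫ t in (0 : ℝ)..x, ψ₁ t) (ψ₁ x) (Icc 0 1) x :=
    intervalIntegral.integral_hasDerivWithinAt_right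
      (h₁.integrable_unit.intervalIntegrable_of_unit zero_mem_unit hx)
      (h₁.stronglyMeasurableAtFilter_nhdsWithin measurableSet_Icc x) (h₁ x hx)
  exact (h3.const_add (ψ 0)).congr h (h x hx)

theorem congr_ae (h : HasACDerivs ψ ψ₁ ψ₂) (h2 : ψ₂ =ᵐ[unitMeasure] φ₂) :
    HasACDerivs ψ ψ₁ φ₂ := by
  refine ⟨h.hasDeriv, h.integrable.congr h2, fun x hx => ?_⟩
  rw [h.eq_integral x hx, intervalIntegral.integral_of_le hx.1,
    intervalIntegral.integral_of_le hx.1]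
  congr 1
  refine integral_congr_ae ?_
  exact ae_restrict_of_ae_restrict_of_subset
    (Ioc_subset_Icc_self.trans (Icc_subset_Icc_right hx.2)) h2

theorem clm_comp [CompleteSpace M] [CompleteSpace M'] (h : HasACDerivs ψ ψ₁ ψ₂) (B : M →L[ℝ] M') :
    HasACDerivs (fun x => B (ψ x)) (fun x => B (ψ₁ x)) (fun x => B (ψ₂ x)) := by
  refine ⟨fun x hx => B.hasFDerivAt.comp_hasDerivWithinAt x (h.hasDeriv x hx),
    B.integrable_comp h.integrable, fun x hx => ?_⟩
  rw [h.eq_integral x hx, map_add, B.intervalIntegral_comp_comm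
    (h.integrable.intervalIntegrable_of_unit zero_mem_unit hx)]

theorem add (h : HasACDerivs ψ ψ₁ ψ₂) (h' : HasACDerivs φ φ₁ φ₂) :
    HasACDerivs (fun x => ψ x + φ x) (fun x => ψ₁ x + φ₁ x) (fun x => ψ₂ x + φ₂ x) := by
  refine ⟨fun x hx => (h.hasDeriv x hx).add (h'.hasDeriv x hx), h.integrable.add h'.integrable,
    fun x hx => ?_⟩
  rw [h.eq_integral x hx, h'.eq_integral x hx, intervalIntegral.integral_add
    (h.integrable.intervalIntegrable_of_unit zero_mem_unit hx)
    (h'.integrable.intervalIntegrable_of_unit zero_mem_unit hx)]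
  abel

theorem sub (h : HasACDerivs ψ ψ₁ ψ₂) (h' : HasACDerivs φ φ₁ φ₂) :
    HasACDerivs (fun x => ψ x - φ x) (fun x => ψ₁ x - φ₁ x) (fun x => ψ₂ x - φ₂ x) := by
  refine ⟨fun x hx => (h.hasDeriv x hx).sub (h'.hasDeriv x hx), h.integrable.sub h'.integrable,
    fun x hx => ?_⟩
  rw [h.eq_integral x hx, h'.eq_integral x hx, intervalIntegral.integral_sub
    (h.integrable.intervalIntegrable_of_unit zero_mem_unit hx)
    (h'.integrable.intervalIntegrable_of_unit zero_mem_unit hx)]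
  abel

theorem const_smul {𝕜 : Type*} [RCLike 𝕜] [NormedSpace 𝕜 M] [SMulCommClass ℝ 𝕜 M]
    (h : HasACDerivs ψ ψ₁ ψ₂) (c : 𝕜) :
    HasACDerivs (fun x => c • ψ x) (fun x => c • ψ₁ x) (fun x => c • ψ₂ x) := by
  refine ⟨fun x hx => (h.hasDeriv x hx).const_smul c, h.integrable.smul c, fun x hx => ?_⟩
  rw [h.eq_integral x hx, smul_add, intervalIntegral.integral_smul]

end HasACDerivs

theorem MeasureTheory.Integrable.clm_apply_continuousOn {Q : ℝ → M →L[ℝ] M'}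
    (hQ : Integrable Q unitMeasure) {u : ℝ → M} (hu : ContinuousOn u (Icc 0 1)) :
    Integrable (fun t => Q t (u t)) unitMeasure := by
  obtain ⟨B, hB⟩ := isCompact_Icc.exists_bound_of_continuousOn hu
  refine (hQ.norm.mul_const B).mono' ?_ ?_
  · exact (ContinuousLinearMap.apply ℝ M').flip.aestronglyMeasurable_comp₂
      hQ.aestronglyMeasurable hu.integrable_unit.aestronglyMeasurable
  · filter_upwards [ae_restrict_mem measurableSet_Icc] with t ht
    exact ((Q t).le_opNorm _).trans (by gcongr; exact hB t ht)

/-- The Cauchy problem `u'' = Q u + g` with integrable `Q` and `g` is solvable. -/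
theorem exists_hasACDerivs [CompleteSpace M] {Q : ℝ → M →L[ℝ] M} (hQ : Integrable Q unitMeasure)
    {g : ℝ → M} (hg : Integrable g unitMeasure) (p q : M) :
    ∃ u u₁ : ℝ → M, HasACDerivs u u₁ (fun x => Q x (u x) + g x) ∧ u 0 = p ∧ u₁ 0 = q := by
  -- Reduction to a first-order system for `(u, u')`: `B Q` sends `(p, q)` to `(0, Q p)`, and `g`
  -- enters through its primitive in the free term. Linearity and continuity of `B` give
  -- integrability of the coefficient.
  let B : (M →L[ℝ] M) →L[ℝ] (M × M →L[ℝ] M × M) :=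
    (ContinuousLinearMap.compL ℝ (M × M) M (M × M) (.inr ℝ M M)).comp
      ((ContinuousLinearMap.compL ℝ (M × M) M M).flip (.fst ℝ M M))
  let A (x : ℝ) : M × M →L[ℝ] M × M := (ContinuousLinearMap.inl ℝ M M).comp (.snd ℝ M M) + B (Q x)
  have hA : Integrable A unitMeasure := (integrable_const _).add (B.integrable_comp hQ)
  have hA' (x : ℝ) (y : M × M) : A x y = (y.2, Q x y.1) := by simp [A, B]
  have hgc : ContinuousOn (fun x : ℝ => ∫ t in (0 : ℝ)..x, g t) (Icc 0 1) := by
    have := intervalIntegral.continuousOn_primitive_interval' (μ := volume) (f := g)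
      (a := 0) (b₁ := 0) (b₂ := 1)
      (hg.intervalIntegrable_of_unit zero_mem_unit one_mem_unit) (by simp)
    rwa [uIcc_of_le zero_le_one] at this
  obtain ⟨y, hy, hyx⟩ := exists_volterra hA
    (h := fun x => (p, q + ∫ t in (0 : ℝ)..x, g t))
    (continuousOn_const.prodMk (continuousOn_const.add hgc))
  have hAy : Integrable (fun t => A t (y t)) unitMeasure := hA.clm_apply_continuousOn hy
  have h1 : ∀ x ∈ Icc (0 : ℝ) 1, (y x).1 = p + ∫ t in (0 : ℝ)..x, (y t).2 := by
    intro x hx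
    have := congrArg (ContinuousLinearMap.fst ℝ M M) (hyx x hx)
    rw [map_add, ← ContinuousLinearMap.intervalIntegral_comp_comm _
      (hAy.intervalIntegrable_of_unit zero_mem_unit hx)] at this
    simpa [hA'] using this
  have hQy : Integrable (fun t => Q t (y t).1) unitMeasure :=
    hQ.clm_apply_continuousOn (continuous_fst.comp_continuousOn hy)
  have h2 : ∀ x ∈ Icc (0 : ℝ) 1, (y x).2 = q + ∫ t in (0 : ℝ)..x, (Q t (y t).1 + g t) := by
    intro x hx
    have := congrArg (ContinuousLinearMap.snd ℝ M M) (hyx x hx)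
    rw [map_add, ← ContinuousLinearMap.intervalIntegral_comp_comm _
      (hAy.intervalIntegrable_of_unit zero_mem_unit hx)] at this
    rw [intervalIntegral.integral_add (hQy.intervalIntegrable_of_unit zero_mem_unit hx)
      (hg.intervalIntegrable_of_unit zero_mem_unit hx)]
    simp only [hA', ContinuousLinearMap.coe_snd'] at this
    rw [this]
    abel
  have p0 : (y 0).1 = p := by simpa using h1 0 zero_mem_unit
  have q0 : (y 0).2 = q := by simpa using h2 0 zero_mem_unit
  refine ⟨fun x => (y x).1, fun x => (y x).2, ?_, p0, q0⟩
  refine HasACDerivs.of_eq_integral (continuous_snd.comp_continuousOn hy) ?_ (hQy.add hg) ?_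
  · simpa only [p0] using h1
  · simpa only [q0] using h2

/-- A priori bound for solutions of `u'' = Q u + g`. -/
theorem exists_bound_hasACDerivs [CompleteSpace M] {Q : ℝ → M →L[ℝ] M}
    (hQ : Integrable Q unitMeasure) :
    ∃ C : ℝ, 0 ≤ C ∧ ∀ u u₁ g : ℝ → M, Integrable g unitMeasure →
      HasACDerivs u u₁ (fun x => Q x (u x) + g x) → ∀ x ∈ Icc (0 : ℝ) 1,
        ‖u x‖ + ‖u₁ x‖ ≤ C * (‖u 0‖ + ‖u₁ 0‖ + ∫ t, ‖g t‖ ∂unitMeasure) := by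
  have hk : Integrable (fun t => 1 + ‖Q t‖) unitMeasure := (integrable_const 1).add hQ.norm
  obtain ⟨C, hC, h⟩ := exists_gronwall_const hk (fun t => by positivity)
  refine ⟨C, hC, fun u u₁ g hg hu x hx => h (fun x => ‖u x‖ + ‖u₁ x‖) _
    (hu.continuousOn.norm.add hu.continuousOn_deriv.norm) (by positivity) (fun x hx => ?_) x hx⟩
  have iu₁ := (hu.continuousOn_deriv.integrable_unit.norm).intervalIntegrable_of_unit
    zero_mem_unit hx
  have iu := (hu.continuousOn.integrable_unit.norm).intervalIntegrable_of_unit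
    zero_mem_unit hx
  have iQ : IntervalIntegrable (fun t => ‖Q t‖ * ‖u t‖) volume 0 x := by
    refine (hQ.norm.intervalIntegrable_of_unit zero_mem_unit hx).mul_continuousOn ?_
    rw [uIcc_of_le hx.1]
    exact hu.continuousOn.norm.mono (Icc_subset_Icc_right hx.2)
  have iQ₁ : IntervalIntegrable (fun t => ‖Q t‖ * ‖u₁ t‖) volume 0 x := by
    refine (hQ.norm.intervalIntegrable_of_unit zero_mem_unit hx).mul_continuousOn ?_
    rw [uIcc_of_le hx.1]
    exact hu.continuousOn_deriv.norm.mono (Icc_subset_Icc_right hx.2)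
  have ig := hg.norm.intervalIntegrable_of_unit zero_mem_unit hx
  have b1 : ‖u x‖ ≤ ‖u 0‖ + ∫ t in (0 : ℝ)..x, ‖u₁ t‖ := by
    rw [hu.eq_integral_deriv hx]
    exact (norm_add_le _ _).trans (by
      gcongr
      exact intervalIntegral.norm_integral_le_integral_norm hx.1)
  have b2 : ‖u₁ x‖ ≤ ‖u₁ 0‖ + (∫ t in (0 : ℝ)..x, ‖Q t‖ * ‖u t‖) +
      ∫ t in (0 : ℝ)..x, ‖g t‖ := by
    rw [hu.eq_integral x hx, add_assoc, ← intervalIntegral.integral_add iQ ig]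
    refine (norm_add_le _ _).trans ?_
    gcongr
    refine intervalIntegral.norm_integral_le_of_norm_le hx.1
      (Eventually.of_forall fun t _ => ?_) (iQ.add ig)
    exact (norm_add_le _ _).trans (by gcongr; exact (Q t).le_opNorm _)
  have b3 : ∫ t in (0 : ℝ)..x, ‖g t‖ ≤ ∫ t, ‖g t‖ ∂unitMeasure := by
    rw [intervalIntegral.integral_of_le hx.1]
    exact setIntegral_mono_set hg.norm (Eventually.of_forall fun t => norm_nonneg _)
      ((Ioc_subset_Icc_self.trans (Icc_subset_Icc_right hx.2)).eventuallyLE)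
  have e : ∫ t in (0 : ℝ)..x, (1 + ‖Q t‖) * (‖u t‖ + ‖u₁ t‖) =
      (∫ t in (0 : ℝ)..x, ‖u t‖) + (∫ t in (0 : ℝ)..x, ‖u₁ t‖) +
      (∫ t in (0 : ℝ)..x, ‖Q t‖ * ‖u t‖) + ∫ t in (0 : ℝ)..x, ‖Q t‖ * ‖u₁ t‖ := by
    rw [← intervalIntegral.integral_add iu iu₁, ← intervalIntegral.integral_add (iu.add iu₁) iQ,
      ← intervalIntegral.integral_add ((iu.add iu₁).add iQ) iQ₁]
    congr 1
    ext t
    ring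
  have n1 : 0 ≤ ∫ t in (0 : ℝ)..x, ‖u t‖ :=
    intervalIntegral.integral_nonneg hx.1 fun t _ => norm_nonneg _
  have n2 : 0 ≤ ∫ t in (0 : ℝ)..x, ‖Q t‖ * ‖u₁ t‖ :=
    intervalIntegral.integral_nonneg hx.1 fun t _ => by positivity
  rw [e]
  linarith

/-- A solution of `u'' = Q u` with vanishing Cauchy data at `0` vanishes. -/
theorem HasACDerivs.eq_zero_of_initial [CompleteSpace M] {Q : ℝ → M →L[ℝ] M}
    (hQ : Integrable Q unitMeasure) {u u₁ u₂ : ℝ → M} (hu : HasACDerivs u u₁ u₂)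
    (h : ∀ᵐ x ∂unitMeasure, u₂ x = Q x (u x)) (h0 : u 0 = 0) (h1 : u₁ 0 = 0) :
    ∀ x ∈ Icc (0 : ℝ) 1, u x = 0 ∧ u₁ x = 0 := by
  obtain ⟨C, -, hb⟩ := exists_bound_hasACDerivs hQ
  intro x hx
  have h3 := hb u u₁ 0 (integrable_zero _ _ _)
    (hu.congr_ae (by filter_upwards [h] with t ht; simp [ht])) x hx
  simp only [h0, h1, norm_zero, Pi.zero_apply, integral_zero, add_zero, mul_zero] at h3
  have a := norm_nonneg (u x)
  have b := norm_nonneg (u₁ x)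
  exact ⟨norm_le_zero_iff.1 (by linarith), norm_le_zero_iff.1 (by linarith)⟩

end LinearODE

/-! ### Integration by parts for absolutely continuous vector functions -/

section IntegrationByParts

variable {M M' M'' : Type*} [NormedAddCommGroup M] [NormedSpace ℝ M]
  [NormedAddCommGroup M'] [NormedSpace ℝ M'] [NormedAddCommGroup M''] [NormedSpace ℝ M'']

theorem AbsolutelyContinuousOnInterval.of_dist_le {X Y : Type*} [PseudoMetricSpace X]
    [PseudoMetricSpace Y] {f : ℝ → X} {N : ℝ → Y} {a b : ℝ}
    (hN : AbsolutelyContinuousOnInterval N a b)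
    (h : ∀ x ∈ uIcc a b, ∀ y ∈ uIcc a b, dist (f x) (f y) ≤ dist (N x) (N y)) :
    AbsolutelyContinuousOnInterval f a b := by
  rw [absolutelyContinuousOnInterval_iff] at hN ⊢
  intro ε hε
  obtain ⟨δ, hδ, H⟩ := hN ε hε
  refine ⟨δ, hδ, fun E hE hs => lt_of_le_of_lt ?_ (H E hE hs)⟩
  exact Finset.sum_le_sum fun i hi => h _ (hE.1 i hi).1 _ (hE.1 i hi).2

theorem IsBoundedBilinearMap.integrable_left {B : M × M' → M''} (hB : IsBoundedBilinearMap ℝ B)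
    {p : ℝ → M} {Q : ℝ → M'} (hp : Integrable p unitMeasure) (hQ : ContinuousOn Q (Icc 0 1)) :
    Integrable (fun t => B (p t, Q t)) unitMeasure :=
  (hB.toContinuousLinearMap.integrable_comp hp).clm_apply_continuousOn hQ

theorem IsBoundedBilinearMap.integrable_right {B : M × M' → M''} (hB : IsBoundedBilinearMap ℝ B)
    {P : ℝ → M} {q : ℝ → M'} (hP : ContinuousOn P (Icc 0 1)) (hq : Integrable q unitMeasure) :
    Integrable (fun t => B (P t, q t)) unitMeasure :=
  hB.symm.integrable_left hq hP

theorem continuousOn_primitive_unit {p : ℝ → M} (hp : Integrable p unitMeasure) :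
    ContinuousOn (fun x : ℝ => ∫ t in (0 : ℝ)..x, p t) (Icc 0 1) := by
  have := intervalIntegral.continuousOn_primitive_interval' (μ := volume) (f := p)
    (a := 0) (b₁ := 0) (b₂ := 1)
    (hp.intervalIntegrable_of_unit zero_mem_unit one_mem_unit) (by simp)
  rwa [uIcc_of_le zero_le_one] at this

theorem sub_eq_integral_of_primitive {F f : ℝ → M} (hf : Integrable f unitMeasure)
    (hF : ∀ x ∈ Icc (0 : ℝ) 1, F x = F 0 + ∫ t in (0 : ℝ)..x, f t) {x y : ℝ}
    (hx : x ∈ Icc (0 : ℝ) 1) (hy : y ∈ Icc (0 : ℝ) 1) : F y - F x = ∫ t in x..y, f t := by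
  rw [hF y hy, hF x hx, add_sub_add_left_eq_sub]
  exact intervalIntegral.integral_interval_sub_left
    (hf.intervalIntegrable_of_unit zero_mem_unit hy)
    (hf.intervalIntegrable_of_unit zero_mem_unit hx)

theorem norm_sub_le_of_primitive {F f : ℝ → M} (hf : Integrable f unitMeasure)
    (hF : ∀ x ∈ Icc (0 : ℝ) 1, F x = F 0 + ∫ t in (0 : ℝ)..x, f t) {x y : ℝ}
    (hx : x ∈ Icc (0 : ℝ) 1) (hy : y ∈ Icc (0 : ℝ) 1) (hxy : x ≤ y) :
    ‖F y - F x‖ ≤ ∫ t in x..y, ‖f t‖ := by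
  rw [sub_eq_integral_of_primitive hf hF hx hy]
  exact intervalIntegral.norm_integral_le_integral_norm hxy

theorem ae_hasDerivAt_of_primitive [CompleteSpace M] {F f : ℝ → M} (hf : Integrable f unitMeasure)
    (hF : ∀ x ∈ Icc (0 : ℝ) 1, F x = F 0 + ∫ t in (0 : ℝ)..x, f t) :
    ∀ᵐ x, x ∈ Ioo (0 : ℝ) 1 → HasDerivAt F (f x) x := by
  have := (hf.intervalIntegrable_of_unit zero_mem_unit one_mem_unit).ae_hasDerivAt_integral
  filter_upwards [this] with x hx hx'
  have h1 := (hx (by rw [uIcc_of_le zero_le_one]; exact Ioo_subset_Icc_self hx') 0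
    (by simp)).const_add (F 0)
  refine h1.congr_of_eventuallyEq ?_
  filter_upwards [Icc_mem_nhds hx'.1 hx'.2] with y hy using hF y hy

/-- Integration by parts for indefinite integrals of `L¹` functions and a bounded bilinear map. -/
theorem IsBoundedBilinearMap.integral_by_parts [CompleteSpace M] [CompleteSpace M']
    [CompleteSpace M''] {B : M × M' → M''} (hB : IsBoundedBilinearMap ℝ B)
    {P p : ℝ → M} {Q q : ℝ → M'} (hp : Integrable p unitMeasure) (hq : Integrable q unitMeasure)
    (hP : ∀ x ∈ Icc (0 : ℝ) 1, P x = P 0 + ∫ t in (0 : ℝ)..x, p t)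
    (hQ : ∀ x ∈ Icc (0 : ℝ) 1, Q x = Q 0 + ∫ t in (0 : ℝ)..x, q t) :
    ∀ x ∈ Icc (0 : ℝ) 1, ∫ t in (0 : ℝ)..x, (B (P t, q t) + B (p t, Q t)) =
      B (P x, Q x) - B (P 0, Q 0) := by
  have cP : ContinuousOn P (Icc 0 1) :=
    (continuousOn_const.add (continuousOn_primitive_unit hp)).congr hP
  have cQ : ContinuousOn Q (Icc 0 1) :=
    (continuousOn_const.add (continuousOn_primitive_unit hq)).congr hQ
  set r : ℝ → M'' := fun t => B (P t, q t) + B (p t, Q t)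
  have hr : Integrable r unitMeasure := (hB.integrable_right cP hq).add (hB.integrable_left hp cQ)
  obtain ⟨KP, hKP⟩ := isCompact_Icc.exists_bound_of_continuousOn cP
  obtain ⟨KQ, hKQ⟩ := isCompact_Icc.exists_bound_of_continuousOn cQ
  obtain ⟨C, hC, hCB⟩ := hB.bound
  -- Scalar majorant: increments of `G` are bounded by integrals of `n`, so `G` inherits absolute
  -- continuity from the primitive of `n`. As its derivative vanishes almost everywhere, `G` is
  -- constant, which is the claim.
  let n : ℝ → ℝ := fun t => C * KQ * ‖p t‖ + C * KP * ‖q t‖ + ‖r t‖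
  have hn : Integrable n unitMeasure :=
    ((hp.norm.const_mul _).add (hq.norm.const_mul _)).add hr.norm
  let G : ℝ → M'' := fun x => B (P x, Q x) - ∫ t in (0 : ℝ)..x, r t
  let N : ℝ → ℝ := fun x => ∫ t in (0 : ℝ)..x, n t
  have hN : AbsolutelyContinuousOnInterval N 0 1 :=
    (hn.intervalIntegrable_of_unit zero_mem_unit one_mem_unit
      ).absolutelyContinuousOnInterval_intervalIntegral (by simp)
  have key : ∀ x ∈ Icc (0 : ℝ) 1, ∀ y ∈ Icc (0 : ℝ) 1, x ≤ y → dist (G x) (G y) ≤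
      dist (N x) (N y) := by
    intro x hx y hy hxy
    have ip := (hp.norm.const_mul (C * KQ)).intervalIntegrable_of_unit hx hy
    have iq := (hq.norm.const_mul (C * KP)).intervalIntegrable_of_unit hx hy
    have ir := hr.norm.intervalIntegrable_of_unit hx hy
    have eN : N y - N x = C * KQ * (∫ t in x..y, ‖p t‖) + C * KP * (∫ t in x..y, ‖q t‖) +
        ∫ t in x..y, ‖r t‖ := by
      rw [sub_eq_integral_of_primitive (F := N) hn (by simp [N]) hx hy]
      simp only [n]
      rw [intervalIntegral.integral_add (ip.add iq) ir, intervalIntegral.integral_add ip iq]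
      simp only [intervalIntegral.integral_const_mul]
    rw [dist_comm, dist_comm (N x), dist_eq_norm, Real.dist_eq, eN]
    refine le_trans ?_ (le_abs_self _)
    have eG : G y - G x = B (P y - P x, Q y) + B (P x, Q y - Q x) -
        ((∫ t in (0 : ℝ)..y, r t) - ∫ t in (0 : ℝ)..x, r t) := by
      simp only [G, hB.map_sub_left, hB.map_sub_right]
      abel
    rw [eG]
    refine (norm_sub_le _ _).trans (add_le_add ((norm_add_le _ _).trans (add_le_add ?_ ?_)) ?_)
    · calc ‖B (P y - P x, Q y)‖ ≤ C * ‖P y - P x‖ * ‖Q y‖ := hCB _ _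
        _ ≤ C * (∫ t in x..y, ‖p t‖) * KQ := by
          gcongr
          · exact mul_nonneg hC.le ((norm_nonneg _).trans (norm_sub_le_of_primitive hp hP hx hy hxy))
          · exact norm_sub_le_of_primitive hp hP hx hy hxy
          · exact hKQ y hy
        _ = _ := by ring
    · calc ‖B (P x, Q y - Q x)‖ ≤ C * ‖P x‖ * ‖Q y - Q x‖ := hCB _ _
        _ ≤ C * KP * (∫ t in x..y, ‖q t‖) := by
          gcongr
          · exact mul_nonneg hC.le ((norm_nonneg _).trans (hKP x hx))
          · exact hKP x hx
          · exact norm_sub_le_of_primitive hq hQ hx hy hxy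
    · exact norm_sub_le_of_primitive (F := fun y => ∫ t in (0 : ℝ)..y, r t) hr (by simp) hx hy hxy
  have hG : AbsolutelyContinuousOnInterval G 0 1 := by
    refine hN.of_dist_le ?_
    rw [uIcc_of_le zero_le_one]
    intro x hx y hy
    rcases le_total x y with h | h
    · exact key x hx y hy h
    · rw [dist_comm, dist_comm (N x)]
      exact key y hy x hx h
  have hG' : ∀ᵐ x, x ∈ uIcc (0 : ℝ) 1 → HasDerivAt G 0 x := by
    have h01 : ∀ᵐ x : ℝ, x ≠ 0 ∧ x ≠ 1 := by
      exact (Measure.ae_ne volume 0).and (Measure.ae_ne volume 1)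
    filter_upwards [ae_hasDerivAt_of_primitive hp hP, ae_hasDerivAt_of_primitive hq hQ,
      ae_hasDerivAt_of_primitive (F := fun x => ∫ t in (0 : ℝ)..x, r t) hr (by simp), h01] with x h1 h2 h3 h4 hx
    rw [uIcc_of_le zero_le_one] at hx
    have hx' : x ∈ Ioo (0 : ℝ) 1 := ⟨lt_of_le_of_ne hx.1 h4.1.symm, lt_of_le_of_ne hx.2 h4.2⟩
    have h5 := (hB.hasFDerivAt (P x, Q x)).comp_hasDerivAt x ((h1 hx').prodMk (h2 hx'))
    have h6 := h5.sub (h3 hx')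
    refine h6.congr_deriv ?_
    simp [r]
  obtain ⟨c, hc⟩ := hG.const_of_ae_hasDerivAt_zero hG'
  rw [uIcc_of_le zero_le_one] at hc
  intro x hx
  have h1 := (hc x hx).trans (hc 0 zero_mem_unit).symm
  simp only [G, intervalIntegral.integral_same, sub_zero] at h1
  rw [← h1]
  abel

end IntegrationByParts

/-! ### Trigonometric functions with complex frequency and variation of constants -/

section Transformation

/-- `cos (k x)` for a complex frequency `k`. -/
noncomputable def cosFn (k : ℂ) (x : ℝ) : ℂ := Complex.cos (k * x)

/-- `sin (k x) / k`, with value `x` for `k = 0`. -/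
noncomputable def sinFn (k : ℂ) (x : ℝ) : ℂ := ∫ t in (0 : ℝ)..x, cosFn k t

@[fun_prop]
theorem continuous_cosFn (k : ℂ) : Continuous (cosFn k) := by
  unfold cosFn
  fun_prop

theorem hasDerivAt_sinFn (k : ℂ) (x : ℝ) : HasDerivAt (sinFn k) (cosFn k x) x :=
  (continuous_cosFn k).integral_hasStrictDerivAt 0 x |>.hasDerivAt

@[fun_prop]
theorem continuous_sinFn (k : ℂ) : Continuous (sinFn k) :=
  continuous_iff_continuousAt.2 fun x => (hasDerivAt_sinFn k x).continuousAt

@[simp] theorem cosFn_zero (k : ℂ) : cosFn k 0 = 1 := by simp [cosFn]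

@[simp] theorem sinFn_zero (k : ℂ) : sinFn k 0 = 0 := by simp [sinFn]

theorem mul_sinFn (k : ℂ) (x : ℝ) : k * sinFn k x = Complex.sin (k * x) := by
  have h : ∀ t ∈ uIcc 0 x, HasDerivAt (fun t : ℝ => Complex.sin (k * t)) (k * cosFn k t) t := by
    intro t _
    have h1 : HasDerivAt (fun t : ℝ => k * (t : ℂ)) k t := by
      simpa using (Complex.ofRealCLM.hasDerivAt (x := t)).const_mul k
    refine ((Complex.hasDerivAt_sin (k * t)).comp t h1).congr_deriv ?_
    rw [cosFn, mul_comm]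
  rw [sinFn, ← intervalIntegral.integral_const_mul,
    intervalIntegral.integral_eq_sub_of_hasDerivAt h
      ((by fun_prop : Continuous fun t => k * cosFn k t).intervalIntegrable _ _)]
  simp

theorem hasDerivAt_cosFn (k : ℂ) (x : ℝ) : HasDerivAt (cosFn k) (-(k ^ 2 * sinFn k x)) x := by
  have h1 : HasDerivAt (fun t : ℝ => k * (t : ℂ)) k x := by
    simpa using (Complex.ofRealCLM.hasDerivAt (x := x)).const_mul k
  refine ((Complex.hasDerivAt_cos (k * x)).comp x h1).congr_deriv ?_
  rw [← mul_sinFn]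
  ring

@[simp] theorem cosFn_neg (k : ℂ) (x : ℝ) : cosFn k (-x) = cosFn k x := by
  simp [cosFn]

@[simp] theorem sinFn_neg (k : ℂ) (x : ℝ) : sinFn k (-x) = -sinFn k x := by
  have h := intervalIntegral.integral_comp_neg (a := 0) (b := x) (fun t => cosFn k t)
  simp only [cosFn_neg, neg_zero] at h
  rw [sinFn, sinFn, h, intervalIntegral.integral_symm]

theorem cosFn_mul_cosFn (k : ℂ) (t x : ℝ) :
    cosFn k t * cosFn k x = (cosFn k (x + t) + cosFn k (x - t)) / 2 := by
  simp only [cosFn]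
  push_cast
  rw [mul_add, mul_sub, Complex.cos_add, Complex.cos_sub]
  ring

/-- D'Alembert's formula: the solution kernel `sin(kr)/k` becomes an integral of cosines over the
domain of dependence `[t - r, t + r]`. The frequency survives only inside a cosine, so sums over
many frequencies can be estimated as a whole. -/
theorem cosFn_mul_sinFn_eq_integral (k : ℂ) (t r : ℝ) :
    cosFn k t * sinFn k r = (1 / 2 : ℂ) * ∫ s in (t - r)..(t + r), cosFn k s := by
  have h1 : ∫ s in (0 : ℝ)..r, cosFn k (t + s) = ∫ s in t..(t + r), cosFn k s := by
    simp
  have h2 : ∫ s in (0 : ℝ)..r, cosFn k (t - s) = ∫ s in (t - r)..t, cosFn k s := by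
    simp
  rw [sinFn, ← intervalIntegral.integral_const_mul, ← intervalIntegral.integral_add_adjacent_intervals
    ((continuous_cosFn k).intervalIntegrable (t - r) t)
    ((continuous_cosFn k).intervalIntegrable t (t + r)), ← h1, ← h2,
    ← intervalIntegral.integral_add
    ((by fun_prop : Continuous fun s => cosFn k (t - s)).intervalIntegrable _ _)
    ((by fun_prop : Continuous fun s => cosFn k (t + s)).intervalIntegrable _ _),
    ← intervalIntegral.integral_const_mul]
  refine intervalIntegral.integral_congr fun s _ => ?_
  rw [cosFn_mul_cosFn, add_comm t s]
  have : cosFn k (t - s) = cosFn k (s - t) := by rw [← cosFn_neg]; congr 1; ring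
  rw [add_comm s t, this, ← cosFn_neg k (s - t)]
  have e : -(s - t) = t - s := by ring
  rw [e]
  ring

theorem cosFn_mul_sinFn (k : ℂ) (t x : ℝ) :
    cosFn k t * sinFn k x = (sinFn k (x + t) + sinFn k (x - t)) / 2 := by
  have h : ∫ s in (t - x)..(t + x), cosFn k s = sinFn k (t + x) - sinFn k (t - x) :=
    intervalIntegral.integral_eq_sub_of_hasDerivAt (fun s _ => hasDerivAt_sinFn k s)
      ((continuous_cosFn k).intervalIntegrable _ _)
  have e : t - x = -(x - t) := by ring
  rw [cosFn_mul_sinFn_eq_integral, h, e, sinFn_neg, add_comm t x]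
  ring

variable {E : Type*} [NormedAddCommGroup E] [NormedSpace ℂ E]

/-- `u` solves `-u'' + V u = z u` on `[0,1]`, with derivative `u₁`. -/
def IsSLSolution (V : ℝ → E →L[ℂ] E) (z : ℂ) (u u₁ : ℝ → E) : Prop :=
  ∃ u₂ : ℝ → E, HasACDerivs u u₁ u₂ ∧ ∀ᵐ x ∂unitMeasure, -u₂ x + V x (u x) = z • u x

theorem MeasureTheory.Integrable.complexClm_apply_continuousOn {V : ℝ → E →L[ℂ] E}
    (hV : Integrable V unitMeasure) {u : ℝ → E} (hu : ContinuousOn u (Icc 0 1)) :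
    Integrable (fun t => V t (u t)) unitMeasure :=
  ((ContinuousLinearMap.restrictScalarsL ℂ E E ℝ ℝ).integrable_comp hV).clm_apply_continuousOn hu

/-- Variation of constants for `-u'' + V u = k² u`. -/
theorem IsSLSolution.variation_of_constants [CompleteSpace E] {V : ℝ → E →L[ℂ] E}
    {k : ℂ} {u u₁ : ℝ → E} (hu : IsSLSolution V (k ^ 2) u u₁) {x : ℝ} (hx : x ∈ Icc (0 : ℝ) 1) :
    u x = cosFn k x • u 0 + sinFn k x • u₁ 0 +
      ∫ t in (0 : ℝ)..x, sinFn k (x - t) • V t (u t) := by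
  obtain ⟨u₂, hac, heq⟩ := hu
  have hB : IsBoundedBilinearMap ℝ fun p : ℂ × E => p.1 • p.2 := isBoundedBilinearMap_smul
  have hs : ∀ t, HasDerivAt (fun t => sinFn k (x - t)) (-cosFn k (x - t)) t := by
    intro t
    exact (hasDerivAt_sinFn k (x - t)).comp_const_sub x t
  have hc : ∀ t, HasDerivAt (fun t => cosFn k (x - t)) (k ^ 2 * sinFn k (x - t)) t := by
    intro t
    simpa using (hasDerivAt_cosFn k (x - t)).comp_const_sub x t
  have ic : Continuous fun t => -cosFn k (x - t) := by fun_prop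
  have is : Continuous fun t => k ^ 2 * sinFn k (x - t) := by fun_prop
  have h1 := hB.integral_by_parts (P := fun t => sinFn k (x - t)) (Q := u₁)
    ic.continuousOn.integrable_unit hac.integrable
    (fun y _ => by
      rw [intervalIntegral.integral_eq_sub_of_hasDerivAt (fun t _ => hs t)
        (ic.intervalIntegrable _ _)]
      abel) hac.eq_integral x hx
  have h2 := hB.integral_by_parts (P := fun t => cosFn k (x - t)) (Q := u)
    is.continuousOn.integrable_unit hac.continuousOn_deriv.integrable_unit
    (fun y _ => by
      rw [intervalIntegral.integral_eq_sub_of_hasDerivAt (fun t _ => hc t)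
        (is.intervalIntegrable _ _)]
      abel) (fun y hy => hac.eq_integral_deriv hy) x hx
  have j1 : Integrable (fun t => sinFn k (x - t) • u₂ t + -cosFn k (x - t) • u₁ t)
      unitMeasure :=
    (hB.integrable_right (by fun_prop : Continuous fun t => sinFn k (x - t)).continuousOn
      hac.integrable).add
      (hB.integrable_right ic.continuousOn hac.continuousOn_deriv.integrable_unit)
  have j2 : Integrable (fun t => cosFn k (x - t) • u₁ t + (k ^ 2 * sinFn k (x - t)) • u t)
      unitMeasure :=
    (hB.integrable_right (by fun_prop : Continuous fun t => cosFn k (x - t)).continuousOn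
      hac.continuousOn_deriv.integrable_unit).add
      (hB.integrable_right is.continuousOn hac.continuousOn.integrable_unit)
  -- In the sum of the two integrations by parts the terms `cos · u₁` cancel, and `sin · (u₂ + k²
  -- u)` is `sin · V u` by the equation.
  have h3 := congrArg₂ (· + ·) h1 h2
  simp only at h3
  rw [← intervalIntegral.integral_add (j1.intervalIntegrable_of_unit zero_mem_unit hx)
    (j2.intervalIntegrable_of_unit zero_mem_unit hx)] at h3
  have h4 : ∫ t in (0 : ℝ)..x, sinFn k (x - t) • V t (u t) =
      ∫ t in (0 : ℝ)..x, (sinFn k (x - t) • u₂ t + -cosFn k (x - t) • u₁ t +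
        (cosFn k (x - t) • u₁ t + (k ^ 2 * sinFn k (x - t)) • u t)) := by
    rw [intervalIntegral.integral_of_le hx.1, intervalIntegral.integral_of_le hx.1]
    refine integral_congr_ae ?_
    filter_upwards [ae_restrict_of_ae_restrict_of_subset
      (Ioc_subset_Icc_self.trans (Icc_subset_Icc_right hx.2)) heq] with t ht
    have : V t (u t) = u₂ t + k ^ 2 • u t := by rw [← ht]; abel
    rw [this, smul_add, smul_smul, neg_smul, mul_comm (k ^ 2)]
    abel
  rw [h4, h3]
  simp

end Transformation

/-! ### Solutions against free solutions, uniformly in the frequencies -/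

section TransformationBound

variable {E : Type*} [NormedAddCommGroup E] [NormedSpace ℂ E] {ι : Type*}

/-- The solution of `-u'' = k² u` with Cauchy data `(1 - T) c` and `T c`. -/
noncomputable def freeSol (T : E →L[ℂ] E) (k : ℂ) (c : E) (t : ℝ) : E :=
  cosFn k t • (c - T c) + sinFn k t • T c

@[fun_prop]
theorem continuous_freeSol (T : E →L[ℂ] E) (k : ℂ) (c : E) : Continuous (freeSol T k c) := by
  unfold freeSol
  fun_prop

/-- Multiplication by `cos(ks)` becomes an average of two translates, an operation that no longer
depends on `k` and so commutes with sums over frequencies. -/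
theorem cosFn_smul_freeSol (T : E →L[ℂ] E) (k : ℂ) (c : E) (t s : ℝ) :
    cosFn k s • freeSol T k c t =
      (1 / 2 : ℂ) • (freeSol T k c (t + s) + freeSol T k c (t - s)) := by
  simp only [freeSol, smul_add, smul_smul, cosFn_mul_cosFn, cosFn_mul_sinFn]
  have e (p q : ℂ) (v : E) : ((p + q) / 2) • v = (1 / 2 * p) • v + (1 / 2 * q) • v := by
    rw [← add_smul]; congr 1; ring
  rw [e, e]
  abel

/-- The cosine part lies in the range of `1 - T` and is even, the sine part lies in the range of `T`
and is odd; `1 - 2T` is the corresponding reflection. It folds integrals over `[-x, x]` onto `[0,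
x]`. -/
theorem freeSol_neg {T : E →L[ℂ] E} (hT : T * T = T) (k : ℂ) (c : E) (t : ℝ) :
    freeSol T k c (-t) = (1 - (2 : ℂ) • T) (freeSol T k c t) := by
  have h (v : E) : T (T v) = T v := DFunLike.congr_fun hT v
  have e (v : E) : (1 - (2 : ℂ) • T) v = v - (2 : ℂ) • T v := rfl
  simp only [e, freeSol, cosFn_neg, sinFn_neg, map_add, map_smul, map_sub, h]
  module

/-- Only the cosine part is seen by `a`, so the Robin term `sin(kx)/k · a c` in the variation of
constants can be expressed through the free wave itself. -/
theorem clm_freeSol {a T : E →L[ℂ] E} (haT : a * T = 0) (k : ℂ) (c : E) (t : ℝ) :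
    a (freeSol T k c t) = cosFn k t • a c := by
  have h (v : E) : a (T v) = 0 := DFunLike.congr_fun haT v
  simp [freeSol, h]

theorem sum_cosFn_mul_sinFn_smul [CompleteSpace E] (s : Finset ι) (k : ι → ℂ) (w : ι → E)
    (t r : ℝ) :
    ∑ i ∈ s, (cosFn (k i) t * sinFn (k i) r) • w i =
      (1 / 2 : ℂ) • ∫ y in (t - r)..(t + r), ∑ i ∈ s, cosFn (k i) y • w i := by
  rw [intervalIntegral.integral_finsetSum fun i _ =>
    (by fun_prop : Continuous fun y => cosFn (k i) y • w i).intervalIntegrable _ _,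
    Finset.smul_sum]
  refine Finset.sum_congr rfl fun i _ => ?_
  rw [cosFn_mul_sinFn_eq_integral, intervalIntegral.integral_smul_const, smul_smul]

theorem intervalIntegral_norm_le_of_subset {M : Type*} [NormedAddCommGroup M] {f : ℝ → M} (hf : Continuous f) {a b c d : ℝ}
    (hab : a ≤ b) (hca : c ≤ a) (hbd : b ≤ d) :
    ∫ y in a..b, ‖f y‖ ≤ ∫ y in c..d, ‖f y‖ :=
  intervalIntegral.integral_mono_interval hca hab hbd
    (Eventually.of_forall fun _ => norm_nonneg _) (hf.norm.intervalIntegrable _ _)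

/-- Finite combinations of solutions stay close to the same combinations of free solutions,
uniformly in the frequencies. -/
theorem exists_transform_bound [CompleteSpace E] (ι : Type*) {V : ℝ → E →L[ℂ] E}
    (hV : Integrable V unitMeasure) {a T : E →L[ℂ] E} (hT : T * T = T) (haT : a * T = 0) :
    ∃ K : ℝ, 0 ≤ K ∧ ∀ (s : Finset ι) (k : ι → ℂ) (c : ι → E) (u u₁ : ι → ℝ → E),
      (∀ i ∈ s, IsSLSolution V (k i ^ 2) (u i) (u₁ i)) →
      (∀ i ∈ s, u i 0 = c i - T (c i)) → (∀ i ∈ s, u₁ i 0 = T (c i) + a (c i)) →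
      ∀ x ∈ Icc (0 : ℝ) 1, ‖∑ i ∈ s, u i x - ∑ i ∈ s, freeSol T (k i) (c i) x‖ ≤
        K * ∫ t in (0 : ℝ)..x, ‖∑ i ∈ s, freeSol T (k i) (c i) t‖ := by
  obtain ⟨κ, hκ, hw⟩ := exists_exp_weight hV.norm (half_pos one_pos)
  -- The first summand comes from the Robin term, the second from the potential acting on the free
  -- wave.
  set A : ℝ := ‖a‖ / 2 + (∫ t, ‖V t‖ ∂unitMeasure) / 2
  have hA : 0 ≤ A := by positivity
  refine ⟨2 * A * Real.exp κ * (1 + ‖(1 : E →L[ℂ] E) - (2 : ℂ) • T‖), by positivity,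
    fun s k c u u₁ hu hu0 hu1 x₀ hx₀ => ?_⟩
  set f : ℝ → E := fun t => ∑ i ∈ s, freeSol T (k i) (c i) t with hf
  have cf : Continuous f := by fun_prop
  have cu (i) (hi : i ∈ s) : ContinuousOn (u i) (Icc 0 1) := by
    obtain ⟨_, h, -⟩ := hu i hi
    exact h.continuousOn
  set J : ℝ := ∫ t in (-x₀)..x₀, ‖f t‖ with hJ
  have hJ0 : 0 ≤ J := intervalIntegral.integral_nonneg (by linarith [hx₀.1])
    fun _ _ => norm_nonneg _
  -- the difference of the two waves
  let D : ℝ × ℝ → E := fun p => ∑ i ∈ s, cosFn (k i) p.2 • (u i p.1 - freeSol T (k i) (c i) p.1)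
  -- The functions `cos(kτ) u(x)` solve the wave equation with potential, and this is Duhamel's
  -- formula with `x` as evolution variable: the value at `(x, τ)` involves, at level `t`, only the
  -- points at distance at most `x - t` from `τ`.
  have D_eq : ∀ x ∈ Icc (0 : ℝ) 1, ∀ τ : ℝ, D (x, τ) =
      (1 / 2 : ℂ) • (∫ y in (τ - x)..(τ + x), a (f y)) +
      ∫ t in (0 : ℝ)..x, V t ((1 / 2 : ℂ) • ∫ y in (τ - (x - t))..(τ + (x - t)),
        ∑ i ∈ s, cosFn (k i) y • u i t) := by
    intro x hx τ
    have e1 : ∫ y in (τ - x)..(τ + x), a (f y) =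
        ∫ y in (τ - x)..(τ + x), ∑ i ∈ s, cosFn (k i) y • a (c i) := by
      simp only [hf, map_sum, clm_freeSol haT]
    rw [e1, ← sum_cosFn_mul_sinFn_smul]
    have e2 : ∫ t in (0 : ℝ)..x, V t ((1 / 2 : ℂ) • ∫ y in (τ - (x - t))..(τ + (x - t)),
        ∑ i ∈ s, cosFn (k i) y • u i t) =
        ∑ i ∈ s, cosFn (k i) τ • ∫ t in (0 : ℝ)..x, sinFn (k i) (x - t) • V t (u i t) := by
      simp only [← sum_cosFn_mul_sinFn_smul, map_sum, map_smul]
      rw [intervalIntegral.integral_finsetSum]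
      · refine Finset.sum_congr rfl fun i _ => ?_
        rw [← intervalIntegral.integral_smul]
        simp only [smul_smul]
      · intro i hi
        refine IntervalIntegrable.continuousOn_smul
          ((hV.complexClm_apply_continuousOn (cu i hi)).intervalIntegrable_of_unit
            zero_mem_unit hx) ?_
        fun_prop
    rw [e2, ← Finset.sum_add_distrib]
    refine Finset.sum_congr rfl fun i hi => ?_
    rw [(hu i hi).variation_of_constants hx, hu0 i hi, hu1 i hi]
    simp only [freeSol, smul_add, smul_sub, smul_smul]
    abel
  have D_cont : ContinuousOn D (Icc 0 1 ×ˢ univ) := by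
    refine continuousOn_finsetSum _ fun i hi => ContinuousOn.smul ?_ (ContinuousOn.sub ?_ ?_)
    · fun_prop
    · exact (cu i hi).comp continuousOn_fst fun p hp => hp.1
    · fun_prop
  -- Characteristic triangle with vertex `(x₀, 0)` and base `[-x₀, x₀]`. It contains the domain of
  -- dependence of each of its points, so a weighted maximum of `D` over it can be estimated by
  -- itself; the base is what limits `f` to `[-x₀, x₀]`.
  let Δ : Set (ℝ × ℝ) := {p | 0 ≤ p.1 ∧ |p.2| + p.1 ≤ x₀}
  have hΔ1 : ∀ p ∈ Δ, p.1 ∈ Icc (0 : ℝ) x₀ := fun p hp =>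
    ⟨hp.1, by linarith [abs_nonneg p.2, hp.2]⟩
  have hΔ01 : ∀ p ∈ Δ, p.1 ∈ Icc (0 : ℝ) 1 := fun p hp =>
    ⟨hp.1, (hΔ1 p hp).2.trans hx₀.2⟩
  have hΔc : IsCompact Δ := by
    refine (isCompact_Icc.prod (isCompact_Icc (a := -x₀) (b := x₀))).of_isClosed_subset
      (s := Icc 0 x₀ ×ˢ Icc (-x₀) x₀) ?_ ?_
    · exact (isClosed_le continuous_const continuous_fst).inter
        (isClosed_le (f := fun p : ℝ × ℝ => |p.2| + p.1) (by fun_prop) continuous_const)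
    · intro p hp
      refine ⟨hΔ1 p hp, abs_le.1 ?_⟩
      linarith [hp.1, hp.2]
  have hx₀Δ : ((x₀, 0) : ℝ × ℝ) ∈ Δ := ⟨hx₀.1, by simp⟩
  obtain ⟨⟨x', τ'⟩, hp', hmax⟩ := hΔc.exists_isMaxOn ⟨_, hx₀Δ⟩
    (f := fun p => ‖D p‖ * Real.exp (-(κ * p.1)))
    ((D_cont.mono fun p hp => ⟨hΔ01 p hp, mem_univ _⟩).norm.mul (by fun_prop))
  set Q := ‖D (x', τ')‖ * Real.exp (-(κ * x')) with hQ
  have hQ0 : 0 ≤ Q := by positivity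
  have hDQ : ∀ p ∈ Δ, ‖D p‖ ≤ Q * Real.exp (κ * p.1) := by
    intro p hp
    have h1 : ‖D p‖ * Real.exp (-(κ * p.1)) ≤ Q := hmax hp
    calc ‖D p‖ = ‖D p‖ * Real.exp (-(κ * p.1)) * Real.exp (κ * p.1) := by
          rw [mul_assoc, ← Real.exp_add]; simp
      _ ≤ _ := by gcongr
  have key : ∀ x τ : ℝ, (x, τ) ∈ Δ → ‖D (x, τ)‖ ≤ A * J + Q * (1 / 2 * Real.exp (κ * x)) := by
    intro x τ hp
    have hx := hΔ01 _ hp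
    have hτ := abs_le.1 (show |τ| ≤ x₀ - x by have := hp.2; simp only at this; linarith)
    simp only at hx
    have b1 : ‖(1 / 2 : ℂ) • (∫ y in (τ - x)..(τ + x), a (f y))‖ ≤ ‖a‖ / 2 * J := by
      rw [norm_smul]
      have : ‖∫ y in (τ - x)..(τ + x), a (f y)‖ ≤ ‖a‖ * J := by
        calc ‖∫ y in (τ - x)..(τ + x), a (f y)‖ ≤ ∫ y in (τ - x)..(τ + x), ‖a‖ * ‖f y‖ :=
              intervalIntegral.norm_integral_le_of_norm_le (by linarith [hx.1])
                (Eventually.of_forall fun y _ => a.le_opNorm _)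
                ((cf.norm.const_mul _).intervalIntegrable _ _)
          _ ≤ ‖a‖ * J := by
              rw [intervalIntegral.integral_const_mul]
              gcongr
              exact intervalIntegral_norm_le_of_subset cf (by linarith [hx.1])
                (by linarith) (by linarith)
      norm_num
      linarith
    have b2 : ∀ t ∈ Ioc (0 : ℝ) x, ‖V t ((1 / 2 : ℂ) • ∫ y in (τ - (x - t))..(τ + (x - t)),
        ∑ i ∈ s, cosFn (k i) y • u i t)‖ ≤
        ‖V t‖ * (J / 2) + Q * (‖V t‖ * Real.exp (κ * t)) := by
      intro t ht
      have hr : τ - (x - t) ≤ τ + (x - t) := by linarith [ht.2]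
      -- The wave splits into its free part, whose integral over the domain of dependence is at most
      -- `J`, and `D`, bounded by the weighted maximum.
      have c1 : ∀ y, ∑ i ∈ s, cosFn (k i) y • u i t =
          (1 / 2 : ℂ) • (f (t + y) + f (t - y)) + D (t, y) := by
        intro y
        simp only [hf, D, ← Finset.sum_add_distrib, Finset.smul_sum]
        refine Finset.sum_congr rfl fun i _ => ?_
        rw [← cosFn_smul_freeSol, smul_sub]
        abel
      have c2 : ∫ y in (τ - (x - t))..(τ + (x - t)), ‖f (t + y)‖ ≤ J := by
        rw [intervalIntegral.integral_comp_add_left (fun y => ‖f y‖) t]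
        exact intervalIntegral_norm_le_of_subset cf (by linarith) (by linarith [ht.1])
          (by linarith)
      have c3 : ∫ y in (τ - (x - t))..(τ + (x - t)), ‖f (t - y)‖ ≤ J := by
        rw [intervalIntegral.integral_comp_sub_left (fun y => ‖f y‖) t]
        exact intervalIntegral_norm_le_of_subset cf (by linarith) (by linarith [ht.1])
          (by linarith)
      have i1 : IntervalIntegrable (fun y => ‖f (t + y)‖) volume (τ - (x - t)) (τ + (x - t)) :=
        (by fun_prop : Continuous fun y => ‖f (t + y)‖).intervalIntegrable _ _
      have i2 : IntervalIntegrable (fun y => ‖f (t - y)‖) volume (τ - (x - t)) (τ + (x - t)) :=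
        (by fun_prop : Continuous fun y => ‖f (t - y)‖).intervalIntegrable _ _
      have c4 : ‖∫ y in (τ - (x - t))..(τ + (x - t)), ∑ i ∈ s, cosFn (k i) y • u i t‖ ≤
          J + 2 * (Q * Real.exp (κ * t)) := by
        calc ‖∫ y in (τ - (x - t))..(τ + (x - t)), ∑ i ∈ s, cosFn (k i) y • u i t‖
            ≤ ∫ y in (τ - (x - t))..(τ + (x - t)),
                (1 / 2 * (‖f (t + y)‖ + ‖f (t - y)‖) + Q * Real.exp (κ * t)) := by
              refine intervalIntegral.norm_integral_le_of_norm_le hr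
                (Eventually.of_forall fun y hy => ?_)
                (((i1.add i2).const_mul _).add intervalIntegrable_const)
              rw [c1]
              refine (norm_add_le _ _).trans (add_le_add ?_ (hDQ (t, y) ⟨ht.1.le, ?_⟩))
              · rw [norm_smul]
                norm_num
                exact norm_add_le _ _
              · have : |y| ≤ x₀ - t := abs_le.2 ⟨by linarith [hy.1], by linarith [hy.2]⟩
                simp only
                linarith
          _ = 1 / 2 * ((∫ y in (τ - (x - t))..(τ + (x - t)), ‖f (t + y)‖) +
                ∫ y in (τ - (x - t))..(τ + (x - t)), ‖f (t - y)‖) +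
                2 * (x - t) * (Q * Real.exp (κ * t)) := by
              rw [intervalIntegral.integral_add ((i1.add i2).const_mul _)
                intervalIntegrable_const, intervalIntegral.integral_const_mul,
                intervalIntegral.integral_add i1 i2, intervalIntegral.integral_const, smul_eq_mul]
              ring
          _ ≤ _ := by
              have : (x - t) * (Q * Real.exp (κ * t)) ≤ 1 * (Q * Real.exp (κ * t)) := by
                gcongr
                linarith [ht.1, hx.2]
              linarith
      calc ‖V t ((1 / 2 : ℂ) • ∫ y in (τ - (x - t))..(τ + (x - t)),
            ∑ i ∈ s, cosFn (k i) y • u i t)‖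
          ≤ ‖V t‖ * ‖(1 / 2 : ℂ) • ∫ y in (τ - (x - t))..(τ + (x - t)),
            ∑ i ∈ s, cosFn (k i) y • u i t‖ := (V t).le_opNorm _
        _ ≤ ‖V t‖ * (1 / 2 * (J + 2 * (Q * Real.exp (κ * t)))) := by
            rw [norm_smul]
            gcongr
            norm_num
        _ = _ := by ring
    have iV := hV.norm.intervalIntegrable_of_unit zero_mem_unit hx
    have iVe : IntervalIntegrable (fun t => ‖V t‖ * Real.exp (κ * t)) volume 0 x :=
      iV.mul_continuousOn (by fun_prop)
    have b3 : ∫ t in (0 : ℝ)..x, ‖V t‖ ≤ ∫ t, ‖V t‖ ∂unitMeasure := by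
      rw [intervalIntegral.integral_of_le hx.1]
      exact setIntegral_mono_set hV.norm (Eventually.of_forall fun t => norm_nonneg _)
        ((Ioc_subset_Icc_self.trans (Icc_subset_Icc_right hx.2)).eventuallyLE)
    rw [D_eq x hx τ]
    refine (norm_add_le _ _).trans ((add_le_add b1
      (intervalIntegral.norm_integral_le_of_norm_le hx.1 (Eventually.of_forall b2)
        ((iV.mul_const _).add (iVe.const_mul _)))).trans ?_)
    rw [intervalIntegral.integral_add (iV.mul_const _) (iVe.const_mul _),
      intervalIntegral.integral_mul_const, intervalIntegral.integral_const_mul]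
    have b5 := mul_le_mul_of_nonneg_left (hw x hx) hQ0
    have b6 := mul_le_mul_of_nonneg_right b3 (by positivity : 0 ≤ J / 2)
    have e : A * J = ‖a‖ / 2 * J + (∫ t, ‖V t‖ ∂unitMeasure) * (J / 2) := by
      simp only [A]; ring
    rw [e]
    linarith
  -- Evaluating `key` at the maximum point absorbs half of `Q` into the left side.
  have hQA : Q ≤ 2 * (A * J) := by
    have h1 := key x' τ' hp'
    have h2 : ‖D (x', τ')‖ = Q * Real.exp (κ * x') := by
      rw [hQ, mul_assoc, ← Real.exp_add]; simp
    have h3 : 1 ≤ Real.exp (κ * x') := Real.one_le_exp (mul_nonneg hκ hp'.1)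
    rw [h2] at h1
    nlinarith
  have hJf : J ≤ (1 + ‖(1 : E →L[ℂ] E) - (2 : ℂ) • T‖) * ∫ t in (0 : ℝ)..x₀, ‖f t‖ := by
    have h1 : ∫ t in (-x₀)..0, ‖f t‖ = ∫ t in (0 : ℝ)..x₀, ‖f (-t)‖ := by
      rw [intervalIntegral.integral_comp_neg (fun t => ‖f t‖)]; simp
    have h2 : ∫ t in (0 : ℝ)..x₀, ‖f (-t)‖ ≤
        ∫ t in (0 : ℝ)..x₀, ‖(1 : E →L[ℂ] E) - (2 : ℂ) • T‖ * ‖f t‖ := by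
      refine intervalIntegral.integral_mono_on hx₀.1
        ((by fun_prop : Continuous fun t => ‖f (-t)‖).intervalIntegrable _ _)
        ((cf.norm.const_mul _).intervalIntegrable _ _) fun t _ => ?_
      have : f (-t) = (1 - (2 : ℂ) • T) (f t) := by
        simp only [hf, map_sum, freeSol_neg hT]
      rw [this]
      exact ContinuousLinearMap.le_opNorm _ _
    rw [hJ, ← intervalIntegral.integral_add_adjacent_intervals
      (cf.norm.intervalIntegrable (-x₀) 0) (cf.norm.intervalIntegrable 0 x₀), h1]
    rw [intervalIntegral.integral_const_mul] at h2
    linarith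
  have hD : ∑ i ∈ s, u i x₀ - ∑ i ∈ s, freeSol T (k i) (c i) x₀ = D (x₀, 0) := by
    simp [D]
  rw [hD]
  calc ‖D (x₀, 0)‖ ≤ Q * Real.exp (κ * x₀) := hDQ _ hx₀Δ
    _ ≤ 2 * (A * J) * Real.exp κ := by
        gcongr
        nlinarith [hx₀.2]
    _ ≤ 2 * (A * ((1 + ‖(1 : E →L[ℂ] E) - (2 : ℂ) • T‖) * ∫ t in (0 : ℝ)..x₀, ‖f t‖)) *
        Real.exp κ := by gcongr
    _ = _ := by ring

end TransformationBound

/-! ### Comparison of two potentials -/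

section Comparison

variable {E : Type*} [NormedAddCommGroup E]

/-- Inverting `f ↦ f + O(∫₀ˣ |f|)`: the primitive of `|f|` is controlled by that of `|g|`. -/
theorem integral_norm_le_of_norm_le {K : ℝ} (hK : 0 ≤ K) :
    ∃ C : ℝ, 0 ≤ C ∧ ∀ f g : ℝ → E, ContinuousOn f (Icc 0 1) → ContinuousOn g (Icc 0 1) →
      (∀ x ∈ Icc (0 : ℝ) 1, ‖f x‖ ≤ ‖g x‖ + K * ∫ t in (0 : ℝ)..x, ‖f t‖) →
      ∀ x ∈ Icc (0 : ℝ) 1, ∫ t in (0 : ℝ)..x, ‖f t‖ ≤ C * ∫ t in (0 : ℝ)..x, ‖g t‖ := by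
  obtain ⟨C, hC, hG⟩ := exists_gronwall_const (k := fun _ => K) (integrable_const K) (fun _ => hK)
  refine ⟨C, hC, fun f g hf hg h x₀ hx₀ => ?_⟩
  let v : ℝ → ℝ := fun x => ∫ t in (0 : ℝ)..x, ‖f t‖
  have hv : ContinuousOn v (Icc 0 1) := continuousOn_primitive_unit hf.integrable_unit.norm
  have hv0 : ∀ x, 0 ≤ x → 0 ≤ v x := fun x hx =>
    intervalIntegral.integral_nonneg hx fun _ _ => norm_nonneg _
  have hmin : ∀ x ∈ Icc (0 : ℝ) 1, min x x₀ ∈ Icc (0 : ℝ) 1 := fun x hx =>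
    ⟨le_min hx.1 hx₀.1, (min_le_left _ _).trans hx.2⟩
  have hvm : ContinuousOn (fun x => v (min x x₀)) (Icc 0 1) :=
    hv.comp (by fun_prop) hmin
  -- Freezing `v` beyond `x₀` bounds the free term by the integral of `‖g‖` up to `x₀` only;
  -- Grönwall's inequality on all of `[0,1]` then still gives a causal estimate.
  have h1 := hG (fun x => v (min x x₀)) (∫ t in (0 : ℝ)..x₀, ‖g t‖) hvm
    (intervalIntegral.integral_nonneg hx₀.1 fun _ _ => norm_nonneg _) (fun x hx => ?_) x₀ hx₀
  · simpa only [min_self] using h1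
  have hy := hmin x hx
  set y := min x x₀ with hy'
  have ig := hg.integrable_unit.norm.intervalIntegrable_of_unit zero_mem_unit hx₀
  have ig' := hg.integrable_unit.norm.intervalIntegrable_of_unit zero_mem_unit hy
  have iv := (hvm.integrable_unit.const_mul K).intervalIntegrable_of_unit zero_mem_unit hx
  have iv' := (hv.integrable_unit.const_mul K).intervalIntegrable_of_unit zero_mem_unit hy
  have iv'' := (hvm.integrable_unit.const_mul K).intervalIntegrable_of_unit zero_mem_unit hy
  calc v y ≤ ∫ t in (0 : ℝ)..y, (‖g t‖ + K * v t) :=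
        intervalIntegral.integral_mono_on hy.1
          (hf.integrable_unit.norm.intervalIntegrable_of_unit zero_mem_unit hy)
          (ig'.add iv') fun t ht => h t ⟨ht.1, ht.2.trans hy.2⟩
    _ = (∫ t in (0 : ℝ)..y, ‖g t‖) + ∫ t in (0 : ℝ)..y, K * v t :=
        intervalIntegral.integral_add ig' iv'
    _ ≤ (∫ t in (0 : ℝ)..x₀, ‖g t‖) + ∫ t in (0 : ℝ)..x, K * v (min t x₀) := by
        refine add_le_add ?_ ?_
        · exact intervalIntegral.integral_mono_interval le_rfl hy.1 (min_le_right _ _)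
            (Eventually.of_forall fun _ => norm_nonneg _) ig
        · have e : ∫ t in (0 : ℝ)..y, K * v t = ∫ t in (0 : ℝ)..y, K * v (min t x₀) := by
            refine intervalIntegral.integral_congr fun t ht => ?_
            rw [uIcc_of_le hy.1] at ht
            rw [min_eq_left (ht.2.trans (min_le_right _ _))]
          rw [e, ← intervalIntegral.integral_add_adjacent_intervals iv'' (iv''.symm.trans iv)]
          refine le_add_of_nonneg_right (intervalIntegral.integral_nonneg (min_le_left _ _)
            fun t ht => mul_nonneg hK (hv0 _ (le_min (hy.1.trans ht.1) hx₀.1)))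

/-- Finite combinations of solutions for two potentials with the same normalisation stay close,
uniformly in the frequencies. -/
theorem exists_comparison_bound [NormedSpace ℂ E] [CompleteSpace E] (ι : Type*) {V V' : ℝ → E →L[ℂ] E}
    (hV : Integrable V unitMeasure) (hV' : Integrable V' unitMeasure) {a a' T : E →L[ℂ] E}
    (hT : T * T = T) (haT : a * T = 0) (haT' : a' * T = 0) :
    ∃ K : ℝ, 0 ≤ K ∧ ∀ (s : Finset ι) (z : ι → ℂ) (c : ι → E) (u u₁ u' u₁' : ι → ℝ → E),
      (∀ i ∈ s, IsSLSolution V (z i) (u i) (u₁ i)) →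
      (∀ i ∈ s, u i 0 = c i - T (c i)) → (∀ i ∈ s, u₁ i 0 = T (c i) + a (c i)) →
      (∀ i ∈ s, IsSLSolution V' (z i) (u' i) (u₁' i)) →
      (∀ i ∈ s, u' i 0 = c i - T (c i)) → (∀ i ∈ s, u₁' i 0 = T (c i) + a' (c i)) →
      ∀ x ∈ Icc (0 : ℝ) 1, ‖∑ i ∈ s, u' i x - ∑ i ∈ s, u i x‖ ≤
        K * ∫ t in (0 : ℝ)..x, ‖∑ i ∈ s, u i t‖ := by
  obtain ⟨K, hK, h⟩ := exists_transform_bound ι hV hT haT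
  obtain ⟨K', hK', h'⟩ := exists_transform_bound ι hV' hT haT'
  obtain ⟨C, hC, hG⟩ := integral_norm_le_of_norm_le (E := E) hK
  refine ⟨(K + K') * C, by positivity,
    fun s z c u u₁ u' u₁' hu hu0 hu1 hu' hu0' hu1' x hx => ?_⟩
  -- Any complex square root serves as frequency.
  choose k hk using fun i => IsAlgClosed.exists_pow_nat_eq (z i) two_pos
  have B := h s k c u u₁ (fun i hi => by rw [hk i]; exact hu i hi) hu0 hu1
  have B' := h' s k c u' u₁' (fun i hi => by rw [hk i]; exact hu' i hi) hu0' hu1'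
  set f : ℝ → E := fun t => ∑ i ∈ s, freeSol T (k i) (c i) t
  have cf : Continuous f := by fun_prop
  have cu : ContinuousOn (fun t => ∑ i ∈ s, u i t) (Icc 0 1) :=
    continuousOn_finsetSum _ fun i hi => by
      obtain ⟨_, h, -⟩ := hu i hi
      exact h.continuousOn
  -- The free combination `f` is the intermediary: both solutions differ from it by a multiple of
  -- the integral of `‖f‖`, and that integral is controlled by inverting the estimate for `u`.
  have h1 : ∫ t in (0 : ℝ)..x, ‖f t‖ ≤ C * ∫ t in (0 : ℝ)..x, ‖∑ i ∈ s, u i t‖ := by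
    refine hG f (fun t => ∑ i ∈ s, u i t) cf.continuousOn cu (fun y hy => ?_) x hx
    have e : f y = ∑ i ∈ s, u i y - (∑ i ∈ s, u i y - f y) := by abel
    calc ‖f y‖ ≤ ‖∑ i ∈ s, u i y‖ + ‖∑ i ∈ s, u i y - f y‖ := by
          conv_lhs => rw [e]
          exact norm_sub_le _ _
      _ ≤ _ := by gcongr; exact B y hy
  have e : ∑ i ∈ s, u' i x - ∑ i ∈ s, u i x =
      (∑ i ∈ s, u' i x - f x) - (∑ i ∈ s, u i x - f x) := by abel
  rw [e]
  calc ‖(∑ i ∈ s, u' i x - f x) - (∑ i ∈ s, u i x - f x)‖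
      ≤ K' * (∫ t in (0 : ℝ)..x, ‖f t‖) + K * ∫ t in (0 : ℝ)..x, ‖f t‖ :=
        (norm_sub_le _ _).trans (add_le_add (B' x hx) (B x hx))
    _ = (K + K') * ∫ t in (0 : ℝ)..x, ‖f t‖ := by ring
    _ ≤ (K + K') * (C * ∫ t in (0 : ℝ)..x, ‖∑ i ∈ s, u i t‖) := by gcongr
    _ = _ := by ring

end Comparison

/-! ### Operators that are causal together with their adjoints -/

section CausalUnitary

variable {E : Type*} [NormedAddCommGroup E]

open scoped InnerProductSpace

theorem Lp.integrable_unit (f : Lp E 2 unitMeasure) : Integrable f unitMeasure :=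
  (Lp.memLp f).integrable one_le_two

theorem Lp.integral_norm_le (f : Lp E 2 unitMeasure) : ∫ t, ‖f t‖ ∂unitMeasure ≤ ‖f‖ := by
  rw [integral_norm_eq_lintegral_enorm (Lp.aestronglyMeasurable f),
    ← eLpNorm_one_eq_lintegral_enorm, Lp.norm_def]
  refine ENNReal.toReal_mono (Lp.eLpNorm_ne_top _) ?_
  refine (eLpNorm_le_eLpNorm_mul_rpow_measure_univ one_le_two
    (Lp.aestronglyMeasurable _)).trans ?_
  simp

theorem integral_norm_eq_zero_of_ae {f : ℝ → E} {x : ℝ} (hx : x ∈ Icc (0 : ℝ) 1)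
    (h : ∀ᵐ t ∂unitMeasure, t ≤ x → f t = 0) : ∫ t in (0 : ℝ)..x, ‖f t‖ = 0 := by
  rw [intervalIntegral.integral_of_le hx.1]
  refine integral_eq_zero_of_ae ?_
  have h1 : Ioc 0 x ⊆ Icc (0 : ℝ) 1 := Ioc_subset_Icc_self.trans (Icc_subset_Icc_right hx.2)
  filter_upwards [ae_restrict_of_ae_restrict_of_subset h1 h,
    ae_restrict_mem measurableSet_Ioc] with t ht ht'
  simp [ht ht'.2]

/-- A pointwise bound by the primitive of the norm passes to limits in `L²`. -/
theorem ae_norm_sub_le_of_dense {X : Type*} {A B : X → Lp E 2 unitMeasure}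
    (hA : DenseRange A) {W : Lp E 2 unitMeasure → Lp E 2 unitMeasure} (hW : Continuous W)
    (hWA : ∀ u, W (A u) = B u) {K : ℝ}
    (h : ∀ u, ∀ᵐ x ∂unitMeasure, ‖B u x - A u x‖ ≤ K * ∫ t in (0 : ℝ)..x, ‖A u t‖)
    (f : Lp E 2 unitMeasure) :
    ∀ᵐ x ∂unitMeasure, ‖W f x - f x‖ ≤ K * ∫ t in (0 : ℝ)..x, ‖f t‖ := by
  obtain ⟨g, hg, hgf⟩ := mem_closure_iff_seq_limit.1 (hA f)
  choose u hu using hg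
  have hf : Tendsto (fun n => A (u n)) atTop (𝓝 f) := by simpa only [hu] using hgf
  have hWf : Tendsto (fun n => B (u n)) atTop (𝓝 (W f)) := by
    simpa only [hWA, Function.comp_def] using (hW.tendsto f).comp hf
  -- Two successive subsequences give almost everywhere convergence of both `A (u n)` and `B (u n)`;
  -- the integrals on the right converge because `L²` convergence implies `L¹` convergence on
  -- `[0,1]`.
  obtain ⟨ns, hns, h1⟩ := (tendstoInMeasure_of_tendsto_Lp hf).exists_seq_tendsto_ae
  have hWf' := hWf.comp hns.tendsto_atTop
  obtain ⟨ms, hms, h2⟩ := (tendstoInMeasure_of_tendsto_Lp hWf').exists_seq_tendsto_ae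
  have h3 : Tendsto (fun n => ∫ t, ‖A (u n) t - f t‖ ∂unitMeasure) atTop (𝓝 0) := by
    have b : ∀ n, ∫ t, ‖A (u n) t - f t‖ ∂unitMeasure ≤ ‖A (u n) - f‖ := by
      intro n
      refine le_trans (le_of_eq (integral_congr_ae ?_)) (Lp.integral_norm_le (A (u n) - f))
      filter_upwards [Lp.coeFn_sub (A (u n)) f] with t ht
      rw [ht, Pi.sub_apply]
    refine squeeze_zero (fun n => by positivity) b ?_
    simpa using (tendsto_iff_norm_sub_tendsto_zero.1 hf)
  have h4 : ∀ᵐ x ∂unitMeasure, ∀ n, ‖B (u n) x - A (u n) x‖ ≤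
      K * ∫ t in (0 : ℝ)..x, ‖A (u n) t‖ := ae_all_iff.2 fun n => h (u n)
  filter_upwards [h1, h2, h4, ae_restrict_mem measurableSet_Icc] with x x1 x2 x4 hx
  have x1' := x1.comp hms.tendsto_atTop
  have x5 : Tendsto (fun n => ∫ t in (0 : ℝ)..x, ‖A (u n) t‖) atTop
      (𝓝 (∫ t in (0 : ℝ)..x, ‖f t‖)) := by
    rw [tendsto_iff_norm_sub_tendsto_zero]
    refine squeeze_zero (fun n => norm_nonneg _) (fun n => ?_) h3
    have i1 := (Lp.integrable_unit (A (u n))).norm.intervalIntegrable_of_unit zero_mem_unit hx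
    have i2 := (Lp.integrable_unit f).norm.intervalIntegrable_of_unit zero_mem_unit hx
    have i3 := ((Lp.integrable_unit (A (u n))).sub (Lp.integrable_unit f)).norm
    rw [← intervalIntegral.integral_sub i1 i2]
    refine (intervalIntegral.norm_integral_le_of_norm_le hx.1
      (Eventually.of_forall fun t _ => abs_norm_sub_norm_le _ _)
      (i3.intervalIntegrable_of_unit zero_mem_unit hx)).trans ?_
    rw [intervalIntegral.integral_of_le hx.1]
    exact setIntegral_mono_set i3 (Eventually.of_forall fun t => norm_nonneg _)
      ((Ioc_subset_Icc_self.trans (Icc_subset_Icc_right hx.2)).eventuallyLE)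
  have x6 := ((x5.comp hns.tendsto_atTop).comp hms.tendsto_atTop).const_mul K
  exact le_of_tendsto_of_tendsto' (x2.sub x1').norm x6 fun n => x4 _

variable [InnerProductSpace ℂ E]

/-- A unitary operator which differs, as well as its inverse, from the identity by a causal
perturbation of Volterra type is the identity. -/
theorem eq_self_of_causal_unitary {W W' : Lp E 2 unitMeasure →ₗ[ℂ] Lp E 2 unitMeasure}
    (hadj : ∀ f g, ⟪W f, g⟫_ℂ = ⟪f, W' g⟫_ℂ) {K K' : ℝ}
    (hW : ∀ f : Lp E 2 unitMeasure,
      ∀ᵐ x ∂unitMeasure, ‖W f x - f x‖ ≤ K * ∫ t in (0 : ℝ)..x, ‖f t‖)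
    (hW' : ∀ f : Lp E 2 unitMeasure,
      ∀ᵐ x ∂unitMeasure, ‖W' f x - f x‖ ≤ K' * ∫ t in (0 : ℝ)..x, ‖f t‖)
    (f : Lp E 2 unitMeasure) : W f = f := by
  let cut (S : Set ℝ) (hS : MeasurableSet S) (f : Lp E 2 unitMeasure) : Lp E 2 unitMeasure :=
    ((Lp.memLp f).indicator hS).toLp _
  have hcut (S hS f) : cut S hS f =ᵐ[unitMeasure] S.indicator f := MemLp.coeFn_toLp _
  -- functions supported in `[0, q]` are mapped to functions supported in `[0, q]`
  have hsupp : ∀ (q : ℝ) (f : Lp E 2 unitMeasure), (∀ᵐ t ∂unitMeasure, q < t → f t = 0) →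
      ∀ᵐ t ∂unitMeasure, q < t → W f t = 0 := by
    intro q f hf
    -- Duality turns causality of `W'` into anticausality of `W`: with `g` the part of `W f` beyond
    -- `q`, the function `W' g` lives beyond `q` while `f` lives before it, so `‖g‖² = ⟪W f, g⟫ =
    -- ⟪f, W' g⟫ = 0`.
    set g := cut (Ioi q) measurableSet_Ioi (W f) with hg
    have hg0 := hcut (Ioi q) measurableSet_Ioi (W f)
    have h1 : ∀ᵐ t ∂unitMeasure, t ≤ q → W' g t = 0 := by
      filter_upwards [hW' g, hg0, ae_restrict_mem measurableSet_Icc] with x hx hgx hxI hxq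
      rw [integral_norm_eq_zero_of_ae hxI, mul_zero, norm_le_zero_iff] at hx
      · rw [sub_eq_zero.1 hx, hgx, indicator_of_notMem (by simpa using hxq)]
      · filter_upwards [hg0] with t ht htx
        rw [ht, indicator_of_notMem (by simpa using htx.trans hxq)]
    have h2 : ⟪W f, g⟫_ℂ = 0 := by
      rw [hadj, L2.inner_def]
      refine integral_eq_zero_of_ae ?_
      filter_upwards [h1, hf] with t ht1 ht2
      rcases le_or_gt t q with h | h
      · simp [ht1 h]
      · simp [ht2 h]
    have h3 : ⟪g, g⟫_ℂ = 0 := by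
      rw [← h2, L2.inner_def, L2.inner_def]
      refine integral_congr_ae ?_
      filter_upwards [hg0] with t ht
      rw [ht]
      by_cases h : t ∈ Ioi q
      · simp [h]
      · simp [h]
    have h4 : g = 0 := inner_self_eq_zero.1 h3
    have h5 : ∀ᵐ t ∂unitMeasure, g t = 0 := by
      rw [h4]
      exact Lp.coeFn_zero _ _ _
    filter_upwards [hg0, h5] with t ht ht0 htq
    rw [ht0, indicator_of_mem (mem_Ioi.2 htq)] at ht
    exact ht.symm
  -- Beyond `q` the part of `f` before `q` contributes nothing to `W f`, so the causal estimate may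
  -- start at `q`. Rational `q` keep the exceptional sets countable in number; letting `q` increase
  -- to `x` shrinks the integral to zero.
  have hloc : ∀ q : ℚ, ∀ᵐ x ∂unitMeasure, (0 : ℝ) ≤ q → (q : ℝ) < x →
      ‖W f x - f x‖ ≤ K * ∫ t in (q : ℝ)..x, ‖f t‖ := by
    intro q
    set f₁ := cut (Iic q) measurableSet_Iic f
    set f₂ := cut (Ioi q) measurableSet_Ioi f
    have h1 := hcut (Iic q) measurableSet_Iic f
    have h2 := hcut (Ioi q) measurableSet_Ioi f
    have hf12 : f = f₁ + f₂ := by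
      refine Lp.ext ?_
      filter_upwards [h1, h2, Lp.coeFn_add f₁ f₂] with t t1 t2 t3
      rw [t3, Pi.add_apply, t1, t2]
      by_cases h : t ≤ q
      · simp [h]
      · simp [h, not_le.1 h]
    have hWf : W f = W f₁ + W f₂ := by rw [← map_add, ← hf12]
    have h4 := hsupp q f₁ (by
      filter_upwards [h1] with t ht htq
      rw [ht, indicator_of_notMem (by simpa using htq)])
    filter_upwards [h4, h1, h2, hW f₂, Lp.coeFn_add (W f₁) (W f₂), ae_restrict_mem
      measurableSet_Icc] with x x4 x1 x2 x5 x6 hxI hq0 hqx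
    have hqI : (q : ℝ) ∈ Icc (0 : ℝ) 1 := ⟨hq0, hqx.le.trans hxI.2⟩
    rw [hWf, x6, Pi.add_apply, x4 hqx, zero_add]
    have e1 : f x = f₂ x := by rw [x2, indicator_of_mem (mem_Ioi.2 hqx)]
    have e2 : ∫ t in (0 : ℝ)..x, ‖f₂ t‖ = ∫ t in (q : ℝ)..x, ‖f t‖ := by
      have i2 := (Lp.integrable_unit f₂).norm
      rw [← intervalIntegral.integral_add_adjacent_intervals
        (i2.intervalIntegrable_of_unit zero_mem_unit hqI)
        (i2.intervalIntegrable_of_unit hqI hxI), integral_norm_eq_zero_of_ae hqI, zero_add]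
      · rw [intervalIntegral.integral_of_le hqx.le, intervalIntegral.integral_of_le hqx.le]
        refine integral_congr_ae ?_
        have hs : Ioc (q : ℝ) x ⊆ Icc (0 : ℝ) 1 :=
          Ioc_subset_Icc_self.trans (Icc_subset_Icc hq0 hxI.2)
        filter_upwards [ae_restrict_of_ae_restrict_of_subset hs h2,
          ae_restrict_mem measurableSet_Ioc] with t ht ht'
        rw [ht, indicator_of_mem (mem_Ioi.2 ht'.1)]
      · filter_upwards [h2] with t ht htx
        rw [ht, indicator_of_notMem (by simpa using htx)]
    rw [e1, ← e2]
    exact x5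
  refine Lp.ext ?_
  filter_upwards [ae_all_iff.2 hloc, ae_restrict_mem measurableSet_Icc,
    ae_restrict_of_ae (Measure.ae_ne volume (0 : ℝ))] with x hx hxI hx0
  have hx0' : 0 < x := lt_of_le_of_ne hxI.1 hx0.symm
  have hc : ContinuousOn (fun y => ∫ t in y..x, ‖f t‖) (Icc 0 1) := by
    have h1 := continuousOn_primitive_unit (Lp.integrable_unit f).norm
    have h2 : ContinuousOn (fun y : ℝ => (∫ t in (0 : ℝ)..x, ‖f t‖) -
        ∫ t in (0 : ℝ)..y, ‖f t‖) (Icc 0 1) := continuousOn_const.sub h1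
    refine h2.congr fun y hy => ?_
    exact (intervalIntegral.integral_interval_sub_left
      ((Lp.integrable_unit f).norm.intervalIntegrable_of_unit zero_mem_unit hxI)
      ((Lp.integrable_unit f).norm.intervalIntegrable_of_unit zero_mem_unit hy)).symm
  have hlim : Tendsto (fun y => K * ∫ t in y..x, ‖f t‖) (𝓝[Icc 0 1] x) (𝓝 0) := by
    have := (hc x hxI).tendsto.const_mul K
    simpa using this
  have hle : ‖W f x - f x‖ ≤ 0 := by
    refine le_of_forall_pos_lt_add fun ε hε => ?_
    have h1 := hlim.eventually (gt_mem_nhds hε)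
    have h2 : ∀ᶠ y in 𝓝[<] x, K * ∫ t in y..x, ‖f t‖ < ε := by
      refine Filter.Eventually.filter_mono ?_ h1
      refine le_inf inf_le_left (le_principal_iff.2 ?_)
      filter_upwards [Ioo_mem_nhdsLT hx0'] with y hy using ⟨hy.1.le, hy.2.le.trans hxI.2⟩
    obtain ⟨l, hl, hl'⟩ := (mem_nhdsLT_iff_exists_Ioo_subset' hx0').1
      (h2.and (Ioo_mem_nhdsLT hx0'))
    obtain ⟨q, hq1, hq2⟩ := exists_rat_btwn (mem_Iio.1 hl)
    obtain ⟨h3, h4⟩ := hl' ⟨hq1, hq2⟩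
    have := hx q h4.1.le hq2
    linarith
  exact sub_eq_zero.1 (norm_le_zero_iff.1 hle)

end CausalUnitary

/-! ### Boundary conditions and Green's formula -/

section BoundaryConditions

open scoped InnerProductSpace

variable {E : Type*} [NormedAddCommGroup E] [InnerProductSpace ℂ E]

theorem compress_mul_eq_zero {T a : E →L[ℂ] E} (hT : T * T = T)
    (ha : (1 - T) * a * (1 - T) = a) : a * T = 0 := by
  have h : (1 - T) * T = 0 := by rw [sub_mul, one_mul, hT, sub_self]
  rw [← ha, mul_assoc, h, mul_zero]

theorem mul_compress_eq_zero {T a : E →L[ℂ] E} (hT : T * T = T)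
    (ha : (1 - T) * a * (1 - T) = a) : T * a = 0 := by
  have h : T * (1 - T) = 0 := by rw [mul_sub, mul_one, hT, sub_self]
  rw [← ha, ← mul_assoc, ← mul_assoc, h, zero_mul, zero_mul]

/-- The two terms of `Γ₋` lie in complementary ranges, so they vanish separately; `T a = 0` removes
the projector in front of `a`. -/
theorem bdryMinus_eq_zero_iff {T a : E →L[ℂ] E} (hT : T * T = T)
    (ha : (1 - T) * a * (1 - T) = a) (p q : E) :
    bdryMinus T a p q = 0 ↔ T p = 0 ∧ q - T q = a p := by
  have hTT (v : E) : T (T v) = T v := DFunLike.congr_fun hT v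
  have hTa (v : E) : T (a v) = 0 := DFunLike.congr_fun (mul_compress_eq_zero hT ha) v
  have e : bdryMinus T a p q = (q - a p - T (q - a p)) - T p := rfl
  rw [e]
  simp only [map_sub, hTa, sub_zero]
  constructor
  · intro h
    have h1 := congrArg T h
    simp only [map_sub, hTa, hTT, map_zero, sub_self, sub_zero, zero_sub, neg_eq_zero] at h1
    refine ⟨h1, ?_⟩
    rw [h1, sub_zero] at h
    rw [← sub_eq_zero, ← h]
    abel
  · rintro ⟨h1, h2⟩
    rw [h1, ← h2]
    abel

/-- The inhomogeneity `e` serves the recovery of `b`, where a solution with `Γ₊u = (b - b') w` is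
needed; such vectors are killed by `T₊`. -/
theorem bdryPlus_eq_iff {T b : E →L[ℂ] E} (hT : T * T = T)
    (hb : (1 - T) * b * (1 - T) = b) (p q : E) {e : E} (he : T e = 0) :
    bdryPlus T b p q = e ↔ T p = 0 ∧ q - T q = -(b p) + e := by
  have hTT (v : E) : T (T v) = T v := DFunLike.congr_fun hT v
  have hTb (v : E) : T (b v) = 0 := DFunLike.congr_fun (mul_compress_eq_zero hT hb) v
  have e1 : bdryPlus T b p q = (q + b p - T (q + b p)) - T p := rfl
  rw [e1]
  simp only [map_add, hTb, add_zero]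
  constructor
  · intro h
    have h1 := congrArg T h
    simp only [map_add, map_sub, hTb, hTT, add_zero, sub_self, zero_sub, he, neg_eq_zero] at h1
    refine ⟨h1, ?_⟩
    rw [← h, h1]
    abel
  · rintro ⟨h1, h2⟩
    have : q + b p - T q - T p = (q - T q) + b p - T p := by abel
    rw [this, h1, h2]
    abel

variable [CompleteSpace E]

/-- The boundary form of two vectors satisfying (in)homogeneous boundary conditions. -/
theorem inner_sub_inner_of_bdry {T α : E →L[ℂ] E} (hT : IsSelfAdjoint T) (hα : IsSelfAdjoint α)
    {u u' v v' e : E} (hu : T u = 0) (hu' : u' - T u' = α u + e) (hv : T v = 0)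
    (hv' : v' - T v' = α v) : ⟪u, v'⟫_ℂ - ⟪u', v⟫_ℂ = -⟪e, v⟫_ℂ := by
  have sT : ∀ x y, ⟪T x, y⟫_ℂ = ⟪x, T y⟫_ℂ :=
    ContinuousLinearMap.isSelfAdjoint_iff_isSymmetric.1 hT
  have sα : ∀ x y, ⟪α x, y⟫_ℂ = ⟪x, α y⟫_ℂ :=
    ContinuousLinearMap.isSelfAdjoint_iff_isSymmetric.1 hα
  have e1 : v' = T v' + α v := by rw [← hv']; abel
  have e2 : u' = T u' + (α u + e) := by rw [← hu']; abel
  have h1 : ⟪u, T v'⟫_ℂ = 0 := by rw [← sT u v']; simp [hu]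
  have h2 : ⟪T u', v⟫_ℂ = 0 := by rw [sT u' v]; simp [hv]
  have h3 : ⟪α u, v⟫_ℂ = ⟪u, α v⟫_ℂ := sα u v
  rw [e1, e2, inner_add_right, inner_add_left, inner_add_left, h1, h2, h3]
  ring

theorem integral_unit_eq_intervalIntegral {M : Type*} [NormedAddCommGroup M] [NormedSpace ℝ M]
    (f : ℝ → M) : ∫ x, f x ∂unitMeasure = ∫ x in (0 : ℝ)..1, f x := by
  rw [intervalIntegral.integral_of_le zero_le_one, integral_Icc_eq_integral_Ioc]

/-- Green's formula. -/
theorem HasACDerivs.green {u u₁ u₂ v v₁ v₂ : ℝ → E} (hu : HasACDerivs u u₁ u₂)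
    (hv : HasACDerivs v v₁ v₂) :
    ∫ x, (⟪u x, v₂ x⟫_ℂ - ⟪u₂ x, v x⟫_ℂ) ∂unitMeasure =
      (⟪u 1, v₁ 1⟫_ℂ - ⟪u₁ 1, v 1⟫_ℂ) - (⟪u 0, v₁ 0⟫_ℂ - ⟪u₁ 0, v 0⟫_ℂ) := by
  have hB : IsBoundedBilinearMap ℝ fun p : E × E => ⟪p.1, p.2⟫_ℂ := isBoundedBilinearMap_inner
  have h1 := hB.integral_by_parts (P := u) (Q := v₁) hu.continuousOn_deriv.integrable_unit
    hv.integrable (fun x hx => hu.eq_integral_deriv hx) hv.eq_integral 1 one_mem_unit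
  have h2 := hB.integral_by_parts (P := u₁) (Q := v) hu.integrable
    hv.continuousOn_deriv.integrable_unit hu.eq_integral (fun x hx => hv.eq_integral_deriv hx) 1
    one_mem_unit
  have i1 : IntervalIntegrable (fun x => ⟪u x, v₂ x⟫_ℂ + ⟪u₁ x, v₁ x⟫_ℂ) volume 0 1 := ((hB.integrable_right hu.continuousOn hv.integrable).add
    (hB.integrable_left hu.continuousOn_deriv.integrable_unit
      hv.continuousOn_deriv)).intervalIntegrable_of_unit zero_mem_unit one_mem_unit
  have i2 : IntervalIntegrable (fun x => ⟪u₁ x, v₁ x⟫_ℂ + ⟪u₂ x, v x⟫_ℂ) volume 0 1 := ((hB.integrable_right hu.continuousOn_deriv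
    hv.continuousOn_deriv.integrable_unit).add
    (hB.integrable_left hu.integrable hv.continuousOn)).intervalIntegrable_of_unit
      zero_mem_unit one_mem_unit
  have h3 := congrArg₂ (· - ·) h1 h2
  simp only at h3
  rw [← intervalIntegral.integral_sub i1 i2] at h3
  rw [integral_unit_eq_intervalIntegral]
  refine (intervalIntegral.integral_congr fun x _ => ?_).trans (h3.trans ?_)
  · ring
  · ring

variable {Tm Tp : E →L[ℂ] E} {V : ℝ → E →L[ℂ] E} {a b : E →L[ℂ] E}

/-- Green's formula for the Sturm-Liouville expression, with an inhomogeneous boundary condition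
at the right end point. -/
theorem IsSLParam.green (h : IsSLParam Tm Tp V a b) (hTm : IsStarProjection Tm)
    (hTp : IsStarProjection Tp) {u u₁ u₂ v v₁ v₂ f g : ℝ → E} {e : E}
    (hu : HasACDerivs u u₁ u₂) (hv : HasACDerivs v v₁ v₂)
    (huf : ∀ᵐ x ∂unitMeasure, -u₂ x + V x (u x) = f x)
    (hvg : ∀ᵐ x ∂unitMeasure, -v₂ x + V x (v x) = g x)
    (hu0 : bdryMinus Tm a (u 0) (u₁ 0) = 0) (hv0 : bdryMinus Tm a (v 0) (v₁ 0) = 0)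
    (he : Tp e = 0)
    (hu1 : bdryPlus Tp b (u 1) (u₁ 1) = e) (hv1 : bdryPlus Tp b (v 1) (v₁ 1) = 0) :
    ∫ x, (⟪f x, v x⟫_ℂ - ⟪u x, g x⟫_ℂ) ∂unitMeasure = -⟪e, v 1⟫_ℂ := by
  rw [bdryMinus_eq_zero_iff hTm.isIdempotentElem h.a_compress] at hu0 hv0
  rw [bdryPlus_eq_iff hTp.isIdempotentElem h.b_compress _ _ he] at hu1
  rw [bdryPlus_eq_iff hTp.isIdempotentElem h.b_compress _ _ (map_zero _), add_zero] at hv1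
  have b0 := inner_sub_inner_of_bdry hTm.isSelfAdjoint h.a_selfAdjoint hu0.1
    (hu0.2.trans (add_zero _).symm) hv0.1 hv0.2
  have b1 := inner_sub_inner_of_bdry hTp.isSelfAdjoint h.b_selfAdjoint.neg hu1.1 hu1.2
    hv1.1 hv1.2
  have hg := hu.green hv
  rw [b0, b1, inner_zero_left, neg_zero, sub_zero] at hg
  rw [← hg]
  refine integral_congr_ae ?_
  filter_upwards [huf, hvg, h.selfAdjoint] with x h1 h2 h3
  have s : ⟪V x (u x), v x⟫_ℂ = ⟪u x, V x (v x)⟫_ℂ :=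
    (ContinuousLinearMap.isSelfAdjoint_iff_isSymmetric.1 h3) (u x) (v x)
  rw [← h1, ← h2]
  simp only [inner_add_left, inner_add_right, inner_neg_left, inner_neg_right, s]
  ring

end BoundaryConditions

/-! ### Fundamental solutions and eigenvalues -/

section FundamentalSolution

variable {E : Type*} [NormedAddCommGroup E] [InnerProductSpace ℂ E]
  {Tm Tp : E →L[ℂ] E} {V : ℝ → E →L[ℂ] E} {a b : E →L[ℂ] E}

theorem MeasureTheory.Integrable.sub_const_restrictScalars (hV : Integrable V unitMeasure)
    (z : ℂ) : Integrable (fun x => (V x - z • (1 : E →L[ℂ] E)).restrictScalars ℝ) unitMeasure :=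
  (ContinuousLinearMap.restrictScalarsL ℂ E E ℝ ℝ).integrable_comp
    (hV.sub (integrable_const (z • (1 : E →L[ℂ] E))))

theorem IsSLSolution.sub {z : ℂ} {u u₁ v v₁ : ℝ → E} (hu : IsSLSolution V z u u₁)
    (hv : IsSLSolution V z v v₁) :
    IsSLSolution V z (fun x => u x - v x) (fun x => u₁ x - v₁ x) := by
  obtain ⟨u₂, h1, h2⟩ := hu
  obtain ⟨v₂, h3, h4⟩ := hv
  refine ⟨_, h1.sub h3, ?_⟩
  filter_upwards [h2, h4] with x h5 h6
  rw [smul_sub, ← h5, ← h6, map_sub]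
  abel

theorem HasACDerivs.deriv_eq_zero {u u₁ u₂ : ℝ → E} (hu : HasACDerivs u u₁ u₂)
    (h : ∀ x ∈ Icc (0 : ℝ) 1, u x = 0) : ∀ x ∈ Icc (0 : ℝ) 1, u₁ x = 0 := by
  intro x hx
  have h1 := hu.hasDeriv x hx
  have h2 : HasDerivWithinAt u 0 (Icc 0 1) x :=
    (hasDerivWithinAt_const x _ (0 : E)).congr h (h x hx)
  exact (uniqueDiffOn_Icc zero_lt_one x hx).eq_deriv _ h1 h2

theorem IsFundMinus.bdryMinus_apply {z : ℂ} {F F₁ : ℝ → E →L[ℂ] E}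
    (hF : IsFundMinus Tm V a z F F₁) (c : E) : bdryMinus Tm a (F 0 c) (F₁ 0 c) = 0 := by
  obtain ⟨F₂, -, -, h, -⟩ := hF
  exact DFunLike.congr_fun h c

theorem IsFundMinus.bdryMinusPerp_apply {z : ℂ} {F F₁ : ℝ → E →L[ℂ] E}
    (hF : IsFundMinus Tm V a z F F₁) (c : E) : bdryMinusPerp Tm (F 0 c) (F₁ 0 c) = c := by
  obtain ⟨F₂, -, -, -, h⟩ := hF
  exact DFunLike.congr_fun h c

theorem bdryPlus_apply (F F₁ : E →L[ℂ] E) (c : E) :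
    bdryPlus Tp b (F c) (F₁ c) = bdryPlus Tp b F F₁ c := rfl

theorem HasACDerivs.eq_zero_of_ae {u u₁ u₂ : ℝ → E} (hu : HasACDerivs u u₁ u₂)
    (h : u =ᵐ[unitMeasure] 0) : ∀ x ∈ Icc (0 : ℝ) 1, u x = 0 ∧ u₁ x = 0 := by
  have h1 : EqOn u 0 (Icc 0 1) := Measure.eqOn_Icc_of_ae_eq volume zero_ne_one h hu.continuousOn
    continuousOn_const
  exact fun x hx => ⟨h1 hx, hu.deriv_eq_zero h1 x hx⟩

variable [CompleteSpace E]

theorem IsSLSolution.eq_zero (hV : Integrable V unitMeasure) {z : ℂ} {u u₁ : ℝ → E}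
    (hu : IsSLSolution V z u u₁) (h0 : u 0 = 0) (h1 : u₁ 0 = 0) :
    ∀ x ∈ Icc (0 : ℝ) 1, u x = 0 ∧ u₁ x = 0 := by
  obtain ⟨u₂, h2, h3⟩ := hu
  refine h2.eq_zero_of_initial (hV.sub_const_restrictScalars z) ?_ h0 h1
  filter_upwards [h3] with x hx
  have : u₂ x = V x (u x) - z • u x := by rw [← hx]; abel
  rw [this]
  rfl

theorem IsSLSolution.eq_of_initial (hV : Integrable V unitMeasure) {z : ℂ} {u u₁ v v₁ : ℝ → E}
    (hu : IsSLSolution V z u u₁) (hv : IsSLSolution V z v v₁) (h0 : u 0 = v 0)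
    (h1 : u₁ 0 = v₁ 0) : ∀ x ∈ Icc (0 : ℝ) 1, u x = v x ∧ u₁ x = v₁ x := by
  intro x hx
  have := (hu.sub hv).eq_zero hV (sub_eq_zero.2 h0) (sub_eq_zero.2 h1) x hx
  exact ⟨sub_eq_zero.1 this.1, sub_eq_zero.1 this.2⟩

theorem exists_isFundMinus (hV : Integrable V unitMeasure) (hTm : Tm * Tm = Tm)
    (ha : (1 - Tm) * a * (1 - Tm) = a) (z : ℂ) : ∃ F F₁, IsFundMinus Tm V a z F F₁ := by
  let Q (x : ℝ) : (E →L[ℂ] E) →L[ℝ] (E →L[ℂ] E) :=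
    (ContinuousLinearMap.mul ℂ (E →L[ℂ] E) (V x - z • (1 : E →L[ℂ] E))).restrictScalars ℝ
  have hQ : Integrable Q unitMeasure :=
    (ContinuousLinearMap.restrictScalarsL ℂ (E →L[ℂ] E) (E →L[ℂ] E) ℝ ℝ).integrable_comp
      ((ContinuousLinearMap.mul ℂ (E →L[ℂ] E)).integrable_comp
        (hV.sub (integrable_const (z • (1 : E →L[ℂ] E)))))
  -- The Cauchy data `F(0) = 1 - T₋` and `F'(0) = T₋ + a` are what `Γ₋F = 0` and `Γ₋^⊥F = 1` amount
  -- to, as `T₋ a = a T₋ = 0`.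
  obtain ⟨F, F₁, hF, h0, h1⟩ := exists_hasACDerivs hQ (integrable_zero ℝ (E →L[ℂ] E) unitMeasure)
    (1 - Tm) (Tm + a)
  have hTa := mul_compress_eq_zero hTm ha
  have haT := compress_mul_eq_zero hTm ha
  refine ⟨F, F₁, _, hF, Eventually.of_forall fun x => ?_, ?_, ?_⟩
  · have : Q x (F x) = V x * F x - z • F x := by
      change (V x - z • (1 : E →L[ℂ] E)) * F x = _
      rw [sub_mul, smul_mul_assoc, one_mul]
    simp [this]
  · rw [h0, h1]
    simp only [bdryMinus, smul_eq_mul]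
    simp only [mul_sub, sub_mul, mul_add, one_mul, mul_one, hTm, haT, hTa, sub_zero]
    abel
  · rw [h0, h1]
    simp only [bdryMinusPerp, smul_eq_mul]
    simp only [mul_sub, sub_mul, mul_add, one_mul, mul_one, hTm, hTa]
    abel

theorem IsFundMinus.hasACDerivs_apply {z : ℂ} {F F₁ : ℝ → E →L[ℂ] E}
    (hF : IsFundMinus Tm V a z F F₁) (c : E) :
    IsSLSolution V z (fun x => F x c) (fun x => F₁ x c) := by
  obtain ⟨F₂, h1, h2, -⟩ := hF
  refine ⟨fun x => F₂ x c,
    h1.clm_comp ((ContinuousLinearMap.apply ℂ E c).restrictScalars ℝ), ?_⟩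
  filter_upwards [h2] with x hx
  exact DFunLike.congr_fun hx c

/-- Cauchy data at `0` in terms of the boundary values. -/
theorem initial_of_bdryMinus (hTm : Tm * Tm = Tm) (ha : (1 - Tm) * a * (1 - Tm) = a) {p q : E}
    (h : bdryMinus Tm a p q = 0) :
    p = bdryMinusPerp Tm p q - Tm (bdryMinusPerp Tm p q) ∧
      q = Tm (bdryMinusPerp Tm p q) + a (bdryMinusPerp Tm p q) := by
  have hTT (v : E) : Tm (Tm v) = Tm v := DFunLike.congr_fun hTm v
  have haT (v : E) : a (Tm v) = 0 := DFunLike.congr_fun (compress_mul_eq_zero hTm ha) v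
  rw [bdryMinus_eq_zero_iff hTm ha] at h
  have e : bdryMinusPerp Tm p q = p - Tm p + Tm q := rfl
  rw [h.1, sub_zero] at e
  rw [e]
  simp only [map_add, h.1, hTT, haT, zero_add, add_zero, ← h.2]
  constructor <;> abel

theorem IsFundMinus.initial {z : ℂ} {F F₁ : ℝ → E →L[ℂ] E} (hTm : Tm * Tm = Tm)
    (ha : (1 - Tm) * a * (1 - Tm) = a) (hF : IsFundMinus Tm V a z F F₁) (c : E) :
    F 0 c = c - Tm c ∧ F₁ 0 c = Tm c + a c := by
  have := initial_of_bdryMinus hTm ha (hF.bdryMinus_apply c)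
  rwa [hF.bdryMinusPerp_apply] at this

/-- Every solution satisfying the left boundary condition is a column of `F₋`. -/
theorem IsFundMinus.eq_apply {z : ℂ} {F F₁ : ℝ → E →L[ℂ] E} (hV : Integrable V unitMeasure)
    (hTm : Tm * Tm = Tm) (ha : (1 - Tm) * a * (1 - Tm) = a) (hF : IsFundMinus Tm V a z F F₁)
    {u u₁ : ℝ → E} (hu : IsSLSolution V z u u₁) (hu0 : bdryMinus Tm a (u 0) (u₁ 0) = 0) :
    ∀ x ∈ Icc (0 : ℝ) 1, u x = F x (bdryMinusPerp Tm (u 0) (u₁ 0)) ∧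
      u₁ x = F₁ x (bdryMinusPerp Tm (u 0) (u₁ 0)) := by
  have h1 := initial_of_bdryMinus hTm ha hu0
  have h2 := hF.initial hTm ha (bdryMinusPerp Tm (u 0) (u₁ 0))
  exact hu.eq_of_initial hV (hF.hasACDerivs_apply _) (h1.1.trans h2.1.symm)
    (h1.2.trans h2.2.symm)

theorem IsFundMinus.eq_zero_of_ae {z : ℂ} {F F₁ : ℝ → E →L[ℂ] E}
    (hF : IsFundMinus Tm V a z F F₁) {c : E}
    (h : (fun x => F x c) =ᵐ[unitMeasure] 0) : c = 0 := by
  obtain ⟨_, h1, -⟩ := hF.hasACDerivs_apply c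
  obtain ⟨h2, h3⟩ := h1.eq_zero_of_ae h 0 zero_mem_unit
  rw [← hF.bdryMinusPerp_apply c]
  rw [h2, h3]
  simp [bdryMinusPerp]

/-- The eigenvalues are the points where `Γ₊F₋` is singular. -/
theorem IsFundMinus.isSLEigenvalue_iff {lam : ℝ} {F F₁ : ℝ → E →L[ℂ] E}
    (hV : Integrable V unitMeasure) (hTm : Tm * Tm = Tm) (ha : (1 - Tm) * a * (1 - Tm) = a)
    (hF : IsFundMinus Tm V a (lam : ℂ) F F₁) :
    IsSLEigenvalue Tm Tp V a b lam ↔ ∃ c : E, c ≠ 0 ∧ bdryPlus Tp b (F 1) (F₁ 1) c = 0 := by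
  constructor
  · rintro ⟨ψ, hψ, ψ₁, ψ₂, h1, h2, h3, -, h4⟩
    have hs : IsSLSolution V lam ψ ψ₁ := ⟨ψ₂, h1, h4.mono fun x hx => hx.symm⟩
    have h5 := hF.eq_apply hV hTm ha hs h2
    refine ⟨bdryMinusPerp Tm (ψ 0) (ψ₁ 0), fun h0 => hψ ?_, ?_⟩
    · filter_upwards [ae_restrict_mem measurableSet_Icc] with x hx
      rw [(h5 x hx).1, h0, map_zero, Pi.zero_apply]
    · rw [← bdryPlus_apply, ← (h5 1 one_mem_unit).1, ← (h5 1 one_mem_unit).2, h3]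
  · rintro ⟨c, hc, h⟩
    obtain ⟨u₂, h1, h2⟩ := hF.hasACDerivs_apply c
    refine ⟨fun x => F x c, fun h0 => hc (hF.eq_zero_of_ae h0), fun x => F₁ x c, u₂, h1,
      hF.bdryMinus_apply c, h, ?_, h2.mono fun x hx => hx.symm⟩
    have hc : ContinuousOn (fun x => (lam : ℂ) • F x c) (Icc 0 1) := h1.continuousOn.const_smul _
    obtain ⟨B, hB⟩ := isCompact_Icc.exists_bound_of_continuousOn hc
    exact MemLp.of_bound hc.integrable_unit.aestronglyMeasurable B
      ((ae_restrict_mem measurableSet_Icc).mono hB)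

end FundamentalSolution

/-! ### A real regular point and the resolvent equation -/

section Resolvent

open scoped InnerProductSpace BoundedContinuousFunction

theorem ContinuousOn.memLp_unit {M : Type*} [NormedAddCommGroup M] {f : ℝ → M}
    (hf : ContinuousOn f (Icc 0 1)) : MemLp f 2 unitMeasure := by
  obtain ⟨B, hB⟩ := isCompact_Icc.exists_bound_of_continuousOn hf
  exact MemLp.of_bound hf.integrable_unit.aestronglyMeasurable B
    ((ae_restrict_mem measurableSet_Icc).mono hB)

theorem Lp.norm_le_of_unit_bound {M : Type*} [NormedAddCommGroup M] {f : Lp M 2 unitMeasure}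
    {C : ℝ} (hC : 0 ≤ C) (h : ∀ᵐ x ∂unitMeasure, ‖f x‖ ≤ C) : ‖f‖ ≤ C := by
  refine (Lp.norm_le_of_ae_bound hC h).trans ?_
  simp [measureUnivNNReal]

/-- A family of non-zero pairwise orthogonal vectors in a separable space is countable. -/
theorem countable_of_pairwise_inner_eq_zero {H ι : Type*} [NormedAddCommGroup H]
    [InnerProductSpace ℂ H] [TopologicalSpace.SeparableSpace H] {φ : ι → H} (h0 : ∀ i, φ i ≠ 0)
    (h : Pairwise fun i j => ⟪φ i, φ j⟫_ℂ = 0) : Countable ι := by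
  refine Pairwise.countable_of_isOpen_disjoint (s := fun i => Metric.ball (φ i) (‖φ i‖ / 2)) ?_
    (fun i => Metric.isOpen_ball)
    (fun i => ⟨φ i, Metric.mem_ball_self (half_pos (norm_pos_iff.2 (h0 i)))⟩)
  intro i j hij
  -- Half the sum of the two norms does not exceed the distance, by Pythagoras.
  refine Metric.ball_disjoint_ball ?_
  have h1 : ‖φ i - φ j‖ * ‖φ i - φ j‖ = ‖φ i‖ * ‖φ i‖ + ‖φ j‖ * ‖φ j‖ := by
      have := norm_add_sq_eq_norm_sq_add_norm_sq_of_inner_eq_zero (𝕜 := ℂ) (φ i) (-φ j)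
        (by rw [inner_neg_right, h hij, neg_zero])
      rwa [← sub_eq_add_neg, norm_neg] at this
  rw [dist_eq_norm]
  nlinarith [norm_nonneg (φ i), norm_nonneg (φ j), norm_nonneg (φ i - φ j),
    sq_nonneg (‖φ i‖ - ‖φ j‖)]

variable {E : Type*} [NormedAddCommGroup E] [InnerProductSpace ℂ E]
  {Tm Tp : E →L[ℂ] E} {V : ℝ → E →L[ℂ] E} {a b : E →L[ℂ] E}

/-- `ψ` solves `(L - mu) ψ = f`, with derivative `ψ₁`. -/
def IsResolventSolution (Tm Tp : E →L[ℂ] E) (V : ℝ → E →L[ℂ] E) (a b : E →L[ℂ] E) (mu : ℝ)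
    (f ψ ψ₁ : ℝ → E) : Prop :=
  ∃ ψ₂ : ℝ → E, HasACDerivs ψ ψ₁ ψ₂ ∧
    (∀ᵐ x ∂unitMeasure, -ψ₂ x + V x (ψ x) = (mu : ℂ) • ψ x + f x) ∧
    bdryMinus Tm a (ψ 0) (ψ₁ 0) = 0 ∧ bdryPlus Tp b (ψ 1) (ψ₁ 1) = 0

theorem IsResolventSolution.congr {mu : ℝ} {f g ψ ψ₁ : ℝ → E}
    (h : IsResolventSolution Tm Tp V a b mu f ψ ψ₁) (hfg : f =ᵐ[unitMeasure] g) :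
    IsResolventSolution Tm Tp V a b mu g ψ ψ₁ := by
  obtain ⟨ψ₂, h1, h2, h3⟩ := h
  refine ⟨ψ₂, h1, ?_, h3⟩
  filter_upwards [h2, hfg] with x hx hfx
  rw [hx, hfx]

theorem bdryMinus_sub_smul (z w : ℂ) (p q p' q' : E) :
    bdryMinus Tm a (z • p + w • p') (z • q + w • q') =
      z • bdryMinus Tm a p q + w • bdryMinus Tm a p' q' := by
  have e (p q : E) : bdryMinus Tm a p q = (1 - Tm) (q - a p) - Tm p := rfl
  simp only [e, map_sub, map_add, map_smul]
  module

theorem bdryPlus_sub_smul (z w : ℂ) (p q p' q' : E) :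
    bdryPlus Tp b (z • p + w • p') (z • q + w • q') =
      z • bdryPlus Tp b p q + w • bdryPlus Tp b p' q' := by
  have e (p q : E) : bdryPlus Tp b p q = (1 - Tp) (q + b p) - Tp p := rfl
  simp only [e, map_add, map_smul]
  module

theorem IsResolventSolution.lincomb {mu : ℝ} {f g ψ ψ₁ φ φ₁ : ℝ → E} (z w : ℂ)
    (h : IsResolventSolution Tm Tp V a b mu f ψ ψ₁)
    (h' : IsResolventSolution Tm Tp V a b mu g φ φ₁) :
    IsResolventSolution Tm Tp V a b mu (fun x => z • f x + w • g x) (fun x => z • ψ x + w • φ x)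
      (fun x => z • ψ₁ x + w • φ₁ x) := by
  obtain ⟨ψ₂, h1, h2, h3, h4⟩ := h
  obtain ⟨φ₂, h1', h2', h3', h4'⟩ := h'
  refine ⟨_, (h1.const_smul z).add (h1'.const_smul w), ?_, ?_, ?_⟩
  · filter_upwards [h2, h2'] with x hx hx'
    have e1 : V x (ψ x) = (mu : ℂ) • ψ x + f x + ψ₂ x := by rw [← hx]; abel
    have e2 : V x (φ x) = (mu : ℂ) • φ x + g x + φ₂ x := by rw [← hx']; abel
    rw [map_add, map_smul, map_smul, e1, e2]
    module
  · rw [bdryMinus_sub_smul, h3, h3', smul_zero, smul_zero, add_zero]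
  · rw [bdryPlus_sub_smul, h4, h4', smul_zero, smul_zero, add_zero]

theorem IsSLSolution.isResolvent_sub {mu : ℝ} {y y₁ y₂ f u u₁ : ℝ → E}
    (hy : HasACDerivs y y₁ y₂)
    (he : ∀ᵐ x ∂unitMeasure, -y₂ x + V x (y x) = (mu : ℂ) • y x + f x)
    (hu : IsSLSolution V mu u u₁) : ∃ w₂, HasACDerivs (fun x => y x - u x) (fun x => y₁ x - u₁ x)
      w₂ ∧ ∀ᵐ x ∂unitMeasure, -w₂ x + V x (y x - u x) = (mu : ℂ) • (y x - u x) + f x := by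
  obtain ⟨u₂, h1, h2⟩ := hu
  refine ⟨_, hy.sub h1, ?_⟩
  filter_upwards [he, h2] with x hx hx'
  have e1 : V x (y x) = (mu : ℂ) • y x + f x + y₂ x := by rw [← hx]; abel
  have e2 : V x (u x) = (mu : ℂ) • u x + u₂ x := by rw [← hx']; abel
  rw [map_sub, e1, e2]
  module

variable [CompleteSpace E]

/-- Eigenfunctions with different eigenvalues are orthogonal; more generally this is Green's
formula for two solutions. -/
theorem IsSLParam.green_solutions (h : IsSLParam Tm Tp V a b) (hTm : IsStarProjection Tm)
    (hTp : IsStarProjection Tp) {u u₁ v v₁ : ℝ → E} {e : E} {lam mu : ℝ}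
    (hu : IsSLSolution V lam u u₁) (hv : IsSLSolution V mu v v₁)
    (hu0 : bdryMinus Tm a (u 0) (u₁ 0) = 0) (hv0 : bdryMinus Tm a (v 0) (v₁ 0) = 0)
    (he : Tp e = 0)
    (hu1 : bdryPlus Tp b (u 1) (u₁ 1) = e) (hv1 : bdryPlus Tp b (v 1) (v₁ 1) = 0) :
    ((lam : ℂ) - mu) * ∫ x, ⟪u x, v x⟫_ℂ ∂unitMeasure = -⟪e, v 1⟫_ℂ := by
  obtain ⟨u₂, hu2, hu3⟩ := hu
  obtain ⟨v₂, hv2, hv3⟩ := hv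
  rw [← h.green hTm hTp hu2 hv2 hu3 hv3 hu0 hv0 he hu1 hv1, ← integral_const_mul]
  refine integral_congr_ae (Eventually.of_forall fun x => ?_)
  simp only [inner_smul_left, inner_smul_right, Complex.conj_ofReal]
  ring

/-- If every real number were an eigenvalue, choosing an eigenfunction for each would give an
uncountable orthogonal family in the separable space `L²`. This avoids any study of the zeros of
`Γ₊F₋` as a function of `λ`. -/
theorem IsSLParam.exists_not_isSLEigenvalue [FiniteDimensional ℂ E]
    (h : IsSLParam Tm Tp V a b) (hTm : IsStarProjection Tm)
    (hTp : IsStarProjection Tp) : ∃ mu : ℝ, ¬ IsSLEigenvalue Tm Tp V a b mu := by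
  by_contra! hall
  have hT := hTm.isIdempotentElem
  choose F F₁ hF using fun lam : ℝ =>
    exists_isFundMinus h.integrable hT h.a_compress (lam : ℂ)
  choose c hc0 hc using fun lam : ℝ =>
    ((hF lam).isSLEigenvalue_iff h.integrable hT h.a_compress).1 (hall lam)
  have hcont : ∀ lam, ContinuousOn (fun x => F lam x (c lam)) (Icc 0 1) := fun lam => by
    obtain ⟨_, h1, -⟩ := (hF lam).hasACDerivs_apply (c lam)
    exact h1.continuousOn
  let φ : ℝ → Lp E 2 unitMeasure := fun lam => (hcont lam).memLp_unit.toLp _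
  have hφ : ∀ lam, φ lam =ᵐ[unitMeasure] fun x => F lam x (c lam) :=
    fun lam => MemLp.coeFn_toLp _
  have := FiniteDimensional.proper ℂ E
  have : Fact ((2 : ENNReal) ≠ ⊤) := ⟨by simp⟩
  have : Countable ℝ := by
    refine countable_of_pairwise_inner_eq_zero (φ := φ) (fun lam h0 => ?_) ?_
    · refine hc0 lam ((hF lam).eq_zero_of_ae ?_)
      have h1 := hφ lam
      rw [h0] at h1
      exact h1.symm.trans (Lp.coeFn_zero _ _ _)
    · intro lam mu hne
      have h1 := h.green_solutions hTm hTp ((hF lam).hasACDerivs_apply (c lam))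
        ((hF mu).hasACDerivs_apply (c mu)) ((hF lam).bdryMinus_apply _)
        ((hF mu).bdryMinus_apply _) (map_zero Tp) (hc lam) (hc mu)
      rw [inner_zero_left, neg_zero] at h1
      have h2 : (lam : ℂ) - mu ≠ 0 := sub_ne_zero.2 (by exact_mod_cast hne)
      change ⟪φ lam, φ mu⟫_ℂ = 0
      rw [L2.inner_def, ← (mul_eq_zero.1 h1).resolve_left h2]
      refine integral_congr_ae ?_
      filter_upwards [hφ lam, hφ mu] with x h3 h4
      rw [h3, h4]
  exact not_countable this

/-- The inhomogeneous equation with vanishing Cauchy data. -/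
theorem exists_inhomogeneous (hV : Integrable V unitMeasure) (mu : ℝ) {f : ℝ → E}
    (hf : Integrable f unitMeasure) : ∃ y y₁ y₂ : ℝ → E, HasACDerivs y y₁ y₂ ∧
      (∀ᵐ x ∂unitMeasure, -y₂ x + V x (y x) = (mu : ℂ) • y x + f x) ∧ y 0 = 0 ∧ y₁ 0 = 0 := by
  obtain ⟨y, y₁, h1, h2, h3⟩ := exists_hasACDerivs (hV.sub_const_restrictScalars mu) hf.neg 0 0
  refine ⟨y, y₁, _, h1, Eventually.of_forall fun x => ?_, h2, h3⟩
  change -((V x (y x) - (mu : ℂ) • y x) + -f x) + V x (y x) = _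
  abel

theorem exists_inhomogeneous_bound (hV : Integrable V unitMeasure) (mu : ℝ) :
    ∃ C : ℝ, 0 ≤ C ∧ ∀ f y y₁ y₂ : ℝ → E, Integrable f unitMeasure → HasACDerivs y y₁ y₂ →
      (∀ᵐ x ∂unitMeasure, -y₂ x + V x (y x) = (mu : ℂ) • y x + f x) → y 0 = 0 → y₁ 0 = 0 →
      ∀ x ∈ Icc (0 : ℝ) 1, ‖y x‖ + ‖y₁ x‖ ≤ C * ∫ t, ‖f t‖ ∂unitMeasure := by
  obtain ⟨C, hC, h⟩ := exists_bound_hasACDerivs (hV.sub_const_restrictScalars mu)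
  refine ⟨C, hC, fun f y y₁ y₂ hf hy he h0 h1 x hx => ?_⟩
  have h2 := h y y₁ (fun t => -f t) hf.neg (hy.congr_ae ?_) x hx
  · simpa [h0, h1] using h2
  · filter_upwards [he] with t ht
    change y₂ t = (V t (y t) - (mu : ℂ) • y t) + -f t
    have : f t = -y₂ t + V t (y t) - (mu : ℂ) • y t := by rw [ht]; abel
    rw [this]
    abel

theorem IsFundMinus.bdryPlus_injective {mu : ℝ} {F F₁ : ℝ → E →L[ℂ] E}
    (h : IsSLParam Tm Tp V a b) (hTm : Tm * Tm = Tm)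
    (hF : IsFundMinus Tm V a (mu : ℂ) F F₁) (hmu : ¬ IsSLEigenvalue Tm Tp V a b mu) :
    Function.Injective (bdryPlus (M := E →L[ℂ] E) Tp b (F 1) (F₁ 1)) := by
  rw [injective_iff_map_eq_zero]
  intro c hc
  by_contra h0
  exact hmu ((hF.isSLEigenvalue_iff h.integrable hTm h.a_compress).2 ⟨c, h0, hc⟩)

variable [FiniteDimensional ℂ E]

/-- From the solution with zero Cauchy data subtract the column `F c` that repairs the right
boundary condition; `c` exists because `Γ₊F(mu)` is injective, hence surjective in finite dimension.
-/
theorem exists_isResolventSolution (h : IsSLParam Tm Tp V a b) (hTm : Tm * Tm = Tm) {mu : ℝ}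
    (hmu : ¬ IsSLEigenvalue Tm Tp V a b mu) {f : ℝ → E} (hf : Integrable f unitMeasure) :
    ∃ ψ ψ₁, IsResolventSolution Tm Tp V a b mu f ψ ψ₁ := by
  obtain ⟨F, F₁, hF⟩ := exists_isFundMinus h.integrable hTm h.a_compress (mu : ℂ)
  have hinj := hF.bdryPlus_injective h hTm hmu
  obtain ⟨y, y₁, y₂, h1, h2, h3, h4⟩ := exists_inhomogeneous h.integrable mu hf
  obtain ⟨c, hc⟩ := (LinearMap.injective_iff_surjective
    (f := (bdryPlus Tp b (F 1) (F₁ 1)).toLinearMap)).1 hinj (bdryPlus Tp b (y 1) (y₁ 1))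
  obtain ⟨w₂, h5, h6⟩ := (hF.hasACDerivs_apply c).isResolvent_sub h1 h2
  refine ⟨_, _, w₂, h5, h6, ?_, ?_⟩
  · have := bdryMinus_sub_smul (Tm := Tm) (a := a) 1 (-1) (y 0) (y₁ 0) (F 0 c) (F₁ 0 c)
    simp only [one_smul, neg_smul, ← sub_eq_add_neg] at this
    rw [this, hF.bdryMinus_apply, h3, h4]
    simp [bdryMinus]
  · have := bdryPlus_sub_smul (Tp := Tp) (b := b) 1 (-1) (y 1) (y₁ 1) (F 1 c) (F₁ 1 c)
    simp only [one_smul, neg_smul, ← sub_eq_add_neg] at this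
    rw [this, bdryPlus_apply, sub_eq_zero]
    exact hc.symm

/-- With `c = Γ₋^⊥ψ` the difference `ψ - F c` has zero Cauchy data and obeys the a priori bound.
Since `Γ₊ψ = 0`, its value under `Γ₊` is `-Γ₊F c`, and injectivity of `Γ₊F` then bounds `c`. -/
theorem exists_isResolventSolution_bound (h : IsSLParam Tm Tp V a b) (hTm : Tm * Tm = Tm)
    {mu : ℝ} (hmu : ¬ IsSLEigenvalue Tm Tp V a b mu) :
    ∃ C : ℝ, 0 ≤ C ∧ ∀ f ψ ψ₁ : ℝ → E, Integrable f unitMeasure →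
      IsResolventSolution Tm Tp V a b mu f ψ ψ₁ →
      ∀ x ∈ Icc (0 : ℝ) 1, ‖ψ x‖ + ‖ψ₁ x‖ ≤ C * ∫ t, ‖f t‖ ∂unitMeasure := by
  obtain ⟨F, F₁, hF⟩ := exists_isFundMinus h.integrable hTm h.a_compress (mu : ℂ)
  have hinj := hF.bdryPlus_injective h hTm hmu
  obtain ⟨C, hC, hb⟩ := exists_inhomogeneous_bound h.integrable mu (V := V)
  obtain ⟨κ, hκ, hanti⟩ := (bdryPlus Tp b (F 1) (F₁ 1)).toLinearMap.exists_antilipschitzWith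
    (LinearMap.ker_eq_bot.2 hinj)
  obtain ⟨F₂, hF₂, -⟩ := id hF
  obtain ⟨K, hK⟩ := isCompact_Icc.exists_bound_of_continuousOn hF₂.continuousOn
  obtain ⟨K₁, hK₁⟩ := isCompact_Icc.exists_bound_of_continuousOn hF₂.continuousOn_deriv
  have hK0 : 0 ≤ K := (norm_nonneg _).trans (hK 0 zero_mem_unit)
  have hK₁0 : 0 ≤ K₁ := (norm_nonneg _).trans (hK₁ 0 zero_mem_unit)
  set G : ℝ := ‖1 - Tp‖ * (1 + ‖b‖) + ‖Tp‖
  have hG : 0 ≤ G := by positivity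
  have hGb (p q : E) : ‖bdryPlus Tp b p q‖ ≤ G * (‖p‖ + ‖q‖) := by
    have e : bdryPlus Tp b p q = (1 - Tp) (q + b p) - Tp p := rfl
    rw [e]
    calc ‖(1 - Tp) (q + b p) - Tp p‖ ≤ ‖1 - Tp‖ * (‖q‖ + ‖b‖ * ‖p‖) + ‖Tp‖ * ‖p‖ := by
          refine (norm_sub_le _ _).trans (add_le_add ((ContinuousLinearMap.le_opNorm _ _).trans ?_)
            (ContinuousLinearMap.le_opNorm _ _))
          gcongr
          exact (norm_add_le _ _).trans (by gcongr; exact b.le_opNorm p)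
      _ ≤ ‖1 - Tp‖ * ((1 + ‖b‖) * (‖p‖ + ‖q‖)) + ‖Tp‖ * (‖p‖ + ‖q‖) := by
          have := mul_nonneg (norm_nonneg b) (norm_nonneg q)
          gcongr
          · nlinarith [norm_nonneg p]
          · linarith [norm_nonneg q]
      _ = _ := by simp only [G]; ring
  refine ⟨C + (K + K₁) * (κ * (G * C)), by positivity, fun f ψ ψ₁ hf hψ x hx => ?_⟩
  obtain ⟨ψ₂, h1, h2, h3, h4⟩ := hψ
  set c := bdryMinusPerp Tm (ψ 0) (ψ₁ 0)
  have hin := initial_of_bdryMinus hTm h.a_compress h3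
  have hinF := hF.initial hTm h.a_compress c
  obtain ⟨w₂, h5, h6⟩ := (hF.hasACDerivs_apply c).isResolvent_sub h1 h2
  have h7 := hb f _ _ w₂ hf h5 h6 (sub_eq_zero.2 (hin.1.trans hinF.1.symm))
    (sub_eq_zero.2 (hin.2.trans hinF.2.symm))
  have h8 : ‖c‖ ≤ κ * (G * (C * ∫ t, ‖f t‖ ∂unitMeasure)) := by
    have h9 : ‖c‖ ≤ κ * ‖bdryPlus Tp b (F 1) (F₁ 1) c‖ := by
      have := hanti.le_mul_dist c 0
      simpa using this
    have h10 := bdryPlus_sub_smul (Tp := Tp) (b := b) 1 (-1) (ψ 1) (ψ₁ 1) (F 1 c) (F₁ 1 c)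
    simp only [one_smul, neg_smul, ← sub_eq_add_neg] at h10
    rw [h4, zero_sub, bdryPlus_apply] at h10
    rw [← norm_neg ((bdryPlus (M := E →L[ℂ] E) Tp b (F 1) (F₁ 1)) c), ← h10] at h9
    refine h9.trans ?_
    gcongr
    refine (hGb _ _).trans ?_
    gcongr
    exact h7 1 one_mem_unit
  have h11 : ‖F x c‖ ≤ K * ‖c‖ := ((F x).le_opNorm c).trans (by gcongr; exact hK x hx)
  have h12 : ‖F₁ x c‖ ≤ K₁ * ‖c‖ := ((F₁ x).le_opNorm c).trans (by gcongr; exact hK₁ x hx)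
  have h13 : ‖ψ x‖ ≤ ‖ψ x - F x c‖ + ‖F x c‖ := by
    simpa using norm_add_le (ψ x - F x c) (F x c)
  have h14 : ‖ψ₁ x‖ ≤ ‖ψ₁ x - F₁ x c‖ + ‖F₁ x c‖ := by
    simpa using norm_add_le (ψ₁ x - F₁ x c) (F₁ x c)
  have h15 := h7 x hx
  calc ‖ψ x‖ + ‖ψ₁ x‖ ≤ C * (∫ t, ‖f t‖ ∂unitMeasure) + (K + K₁) * ‖c‖ := by
        linarith
    _ ≤ C * (∫ t, ‖f t‖ ∂unitMeasure) +
        (K + K₁) * (κ * (G * (C * ∫ t, ‖f t‖ ∂unitMeasure))) := by gcongr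
    _ = _ := by ring

end Resolvent

/-! ### Compactness of the resolvent and completeness of the eigenfunctions -/

section Completeness

open scoped InnerProductSpace BoundedContinuousFunction

variable {E : Type*} [NormedAddCommGroup E]

theorem HasACDerivs.deriv_two_ae_eq_zero [InnerProductSpace ℂ E] [CompleteSpace E] {u u₁ u₂ : ℝ → E}
    (hu : HasACDerivs u u₁ u₂) (h : ∀ x ∈ Icc (0 : ℝ) 1, u₁ x = 0) : u₂ =ᵐ[unitMeasure] 0 := by
  have h1 := ae_hasDerivAt_of_primitive hu.integrable hu.eq_integral
  filter_upwards [ae_restrict_of_ae h1, ae_restrict_mem measurableSet_Icc,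
    ae_restrict_of_ae (Measure.ae_ne volume (0 : ℝ)),
    ae_restrict_of_ae (Measure.ae_ne volume (1 : ℝ))] with x h2 hx hx0 hx1
  have hx' : x ∈ Ioo (0 : ℝ) 1 := ⟨lt_of_le_of_ne hx.1 hx0.symm, lt_of_le_of_ne hx.2 hx1⟩
  have h3 : HasDerivAt u₁ 0 x := by
    refine (hasDerivAt_const x (0 : E)).congr_of_eventuallyEq ?_
    filter_upwards [Icc_mem_nhds hx'.1 hx'.2] with y hy using h y hy
  exact (h2 hx').unique h3

/-- The inclusion of the continuous functions on `[0,1]` into `L²`. -/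
noncomputable def bcfToL2 (g : Icc (0 : ℝ) 1 →ᵇ E) : Lp E 2 unitMeasure :=
  (g.continuous.Icc_extend' (h := zero_le_one)).continuousOn.memLp_unit.toLp _

theorem bcfToL2_coe (g : Icc (0 : ℝ) 1 →ᵇ E) :
    bcfToL2 g =ᵐ[unitMeasure] IccExtend zero_le_one g := MemLp.coeFn_toLp _

theorem continuous_bcfToL2 : Continuous (bcfToL2 (E := E)) := by
  refine LipschitzWith.continuous (K := 1) (LipschitzWith.of_dist_le_mul fun g g' => ?_)
  rw [NNReal.coe_one, one_mul, dist_eq_norm (bcfToL2 g)]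
  refine Lp.norm_le_of_unit_bound dist_nonneg ?_
  filter_upwards [bcfToL2_coe g, bcfToL2_coe g', Lp.coeFn_sub (bcfToL2 g) (bcfToL2 g')] with
    x h1 h2 h3
  rw [h3, Pi.sub_apply, h1, h2, ← dist_eq_norm]
  exact BoundedContinuousFunction.dist_coe_le_dist _

variable [InnerProductSpace ℂ E]

/-- Bounded sets of uniformly Lipschitz functions are relatively compact in `L²`. -/
theorem isCompactOperator_of_lipschitz [FiniteDimensional ℂ E]
    {R : Lp E 2 unitMeasure → Lp E 2 unitMeasure}
    {C : ℝ} (hC : 0 ≤ C)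
    (h : ∀ f, ‖f‖ ≤ 1 → ∃ ψ : ℝ → E, R f =ᵐ[unitMeasure] ψ ∧ (∀ x ∈ Icc (0 : ℝ) 1, ‖ψ x‖ ≤ C) ∧
      ∀ x ∈ Icc (0 : ℝ) 1, ∀ y ∈ Icc (0 : ℝ) 1, ‖ψ x - ψ y‖ ≤ C * ‖x - y‖) :
    IsCompactOperator R := by
  have := FiniteDimensional.proper ℂ E
  let A : Set (Icc (0 : ℝ) 1 →ᵇ E) :=
    {g | (∀ x, ‖g x‖ ≤ C) ∧ ∀ x y, ‖g x - g y‖ ≤ C * dist x y}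
  have hA : IsCompact (closure A) := by
    refine BoundedContinuousFunction.arzela_ascoli (Metric.closedBall 0 C)
      (isCompact_closedBall 0 C) A ?_ ?_
    · intro g x hg
      simpa using hg.1 x
    · refine LipschitzWith.uniformEquicontinuous _ ⟨C, hC⟩ (fun g => ?_) |>.equicontinuous
      refine LipschitzWith.of_dist_le_mul fun x y => ?_
      rw [dist_eq_norm]
      exact g.2.2 x y
  rw [isCompactOperator_iff_exists_mem_nhds_image_subset_compact]
  refine ⟨Metric.closedBall 0 1, Metric.closedBall_mem_nhds _ one_pos, bcfToL2 '' closure A,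
    hA.image continuous_bcfToL2, ?_⟩
  rintro _ ⟨f, hf, rfl⟩
  obtain ⟨ψ, h1, h2, h3⟩ := h f (by simpa using hf)
  have hcont : Continuous fun x : Icc (0 : ℝ) 1 => ψ x := by
    refine LipschitzWith.continuous (K := ⟨C, hC⟩) (LipschitzWith.of_dist_le_mul fun x y => ?_)
    rw [dist_eq_norm]
    exact h3 x x.2 y y.2
  refine ⟨BoundedContinuousFunction.mkOfCompact ⟨_, hcont⟩, subset_closure ⟨fun x => h2 x x.2,
    fun x y => h3 x x.2 y y.2⟩, Lp.ext ?_⟩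
  filter_upwards [h1, bcfToL2_coe (BoundedContinuousFunction.mkOfCompact ⟨_, hcont⟩),
    ae_restrict_mem measurableSet_Icc] with x h4 h5 hx
  rw [h4, h5, IccExtend_of_mem _ _ hx]
  rfl

variable [FiniteDimensional ℂ E] [CompleteSpace E] {Tm Tp : E →L[ℂ] E} {V : ℝ → E →L[ℂ] E}
  {a b : E →L[ℂ] E}

/-- The resolvent of `L` at a real regular point. -/
theorem exists_resolvent (h : IsSLParam Tm Tp V a b) (hTm : IsStarProjection Tm)
    (hTp : IsStarProjection Tp) {mu : ℝ} (hmu : ¬ IsSLEigenvalue Tm Tp V a b mu) :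
    ∃ R : Lp E 2 unitMeasure →L[ℂ] Lp E 2 unitMeasure, IsCompactOperator R ∧
      (R : Lp E 2 unitMeasure →ₗ[ℂ] Lp E 2 unitMeasure).IsSymmetric ∧
      ∀ f, ∃ ψ ψ₁, R f =ᵐ[unitMeasure] ψ ∧ IsResolventSolution Tm Tp V a b mu f ψ ψ₁ := by
  have hT := hTm.isIdempotentElem
  obtain ⟨C, hC, hb⟩ := exists_isResolventSolution_bound h hT hmu
  choose ψ ψ₁ hψ using fun f : Lp E 2 unitMeasure =>
    exists_isResolventSolution h hT hmu (Lp.integrable_unit f)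
  have hb' : ∀ f : Lp E 2 unitMeasure, ∀ x ∈ Icc (0 : ℝ) 1, ‖ψ f x‖ + ‖ψ₁ f x‖ ≤ C * ‖f‖ :=
    fun f x hx => (hb f _ _ (Lp.integrable_unit f) (hψ f) x hx).trans
      (mul_le_mul_of_nonneg_left (Lp.integral_norm_le f) hC)
  have hac : ∀ f, ContinuousOn (ψ f) (Icc 0 1) := fun f => by
    obtain ⟨_, h1, -⟩ := hψ f
    exact h1.continuousOn
  let R₀ : Lp E 2 unitMeasure → Lp E 2 unitMeasure := fun f => (hac f).memLp_unit.toLp _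
  have hR₀ : ∀ f, R₀ f =ᵐ[unitMeasure] ψ f := fun f => MemLp.coeFn_toLp _
  -- Uniqueness is the a priori bound with right-hand side zero; it makes the arbitrarily chosen
  -- solutions depend linearly on `f`.
  have huniq : ∀ (f : Lp E 2 unitMeasure) (φ φ₁ : ℝ → E),
      IsResolventSolution Tm Tp V a b mu f φ φ₁ → ∀ x ∈ Icc (0 : ℝ) 1, ψ f x = φ x := by
    intro f φ φ₁ hφ x hx
    have h1 := ((hψ f).lincomb 1 (-1) hφ).congr (g := 0)
      (Eventually.of_forall fun x => by simp)
    have h2 := hb 0 _ _ (integrable_zero _ _ _) h1 x hx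
    simp only [Pi.zero_apply, norm_zero, integral_zero, mul_zero, one_smul, neg_smul,
      ← sub_eq_add_neg] at h2
    have h3 : ‖ψ f x - φ x‖ ≤ 0 := le_trans (le_add_of_nonneg_right (norm_nonneg _)) h2
    exact sub_eq_zero.1 (norm_le_zero_iff.1 h3)
  have hlin : ∀ (z w : ℂ) (f g : Lp E 2 unitMeasure),
      R₀ (z • f + w • g) = z • R₀ f + w • R₀ g := by
    intro z w f g
    have h1 : IsResolventSolution Tm Tp V a b mu (z • f + w • g : Lp E 2 unitMeasure) _ _ :=
      ((hψ f).lincomb z w (hψ g)).congr (by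
        filter_upwards [Lp.coeFn_add (z • f) (w • g), Lp.coeFn_smul z f, Lp.coeFn_smul w g]
          with x h1 h2 h3
        rw [h1, Pi.add_apply, h2, h3]
        rfl)
    refine Lp.ext ?_
    filter_upwards [hR₀ (z • f + w • g), hR₀ f, hR₀ g, Lp.coeFn_add (z • R₀ f) (w • R₀ g),
      Lp.coeFn_smul z (R₀ f), Lp.coeFn_smul w (R₀ g), ae_restrict_mem measurableSet_Icc] with
      x h2 h3 h4 h5 h6 h7 hx
    rw [h2, h5, Pi.add_apply, h6, h7, Pi.smul_apply, Pi.smul_apply, h3, h4,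
      huniq _ _ _ h1 x hx]
  let R : Lp E 2 unitMeasure →L[ℂ] Lp E 2 unitMeasure := LinearMap.mkContinuous
    { toFun := R₀
      map_add' := fun f g => by simpa using hlin 1 1 f g
      map_smul' := fun z f => by simpa using hlin z 0 f 0 } C (fun f => by
        refine Lp.norm_le_of_unit_bound (by positivity) ?_
        filter_upwards [hR₀ f, ae_restrict_mem measurableSet_Icc] with x h1 hx
        change ‖R₀ f x‖ ≤ _
        rw [h1]
        exact (le_add_of_nonneg_right (norm_nonneg _)).trans (hb' f x hx))
  refine ⟨R, isCompactOperator_of_lipschitz hC fun f hf => ⟨ψ f, hR₀ f, fun x hx => ?_,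
    fun x hx y hy => ?_⟩, fun f g => ?_, fun f => ⟨ψ f, ψ₁ f, hR₀ f, hψ f⟩⟩
  · refine (le_add_of_nonneg_right (norm_nonneg (ψ₁ f x))).trans ((hb' f x hx).trans ?_)
    simpa using mul_le_mul_of_nonneg_left hf hC
  · obtain ⟨_, h1, -⟩ := hψ f
    refine (convex_Icc (0 : ℝ) 1).norm_image_sub_le_of_norm_hasDerivWithin_le h1.hasDeriv
      (fun z hz => ?_) hy hx
    refine (le_add_of_nonneg_left (norm_nonneg (ψ f z))).trans ((hb' f z hz).trans ?_)
    simpa using mul_le_mul_of_nonneg_left hf hC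
  · change ⟪R₀ f, g⟫_ℂ = ⟪f, R₀ g⟫_ℂ
    obtain ⟨u₂, h1, h2, h3, h4⟩ := hψ f
    obtain ⟨v₂, h1', h2', h3', h4'⟩ := hψ g
    have h5 := h.green hTm hTp h1 h1' h2 h2' h3 h3' (map_zero Tp) h4 h4'
    rw [inner_zero_left, neg_zero] at h5
    have e : ⟪f, R₀ g⟫_ℂ - ⟪R₀ f, g⟫_ℂ = 0 := by
      rw [← h5, L2.inner_def, L2.inner_def, ← integral_sub (L2.integrable_inner _ _)
        (L2.integrable_inner _ _)]
      refine integral_congr_ae ?_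
      filter_upwards [hR₀ f, hR₀ g] with x h6 h7
      rw [h6, h7]
      simp only [inner_add_left, inner_add_right, inner_smul_left, inner_smul_right,
        Complex.conj_ofReal]
      ring
    exact (sub_eq_zero.1 e).symm

/-- The eigenfunctions of `L` are complete in `L²`. -/
theorem IsSLParam.eq_zero_of_orthogonal (h : IsSLParam Tm Tp V a b) (hTm : IsStarProjection Tm)
    (hTp : IsStarProjection Tp) (g : Lp E 2 unitMeasure)
    (hg : ∀ (lam : ℝ) (F F₁ : ℝ → E →L[ℂ] E) (c : E), IsFundMinus Tm V a (lam : ℂ) F F₁ →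
      bdryPlus (M := E →L[ℂ] E) Tp b (F 1) (F₁ 1) c = 0 →
      ∫ x, ⟪F x c, g x⟫_ℂ ∂unitMeasure = 0) : g = 0 := by
  have hT := hTm.isIdempotentElem
  obtain ⟨mu, hmu⟩ := h.exists_not_isSLEigenvalue hTm hTp
  obtain ⟨R, hcomp, hsymm, hR⟩ := exists_resolvent h hTm hTp hmu
  -- By the spectral theorem for compact symmetric operators it suffices that `g` is orthogonal to
  -- each eigenspace of `R`.
  have hbot := R.orthogonalComplement_iSup_eigenspaces_eq_bot hcomp hsymm
  rw [← Submodule.mem_bot ℂ, ← hbot, Submodule.mem_orthogonal]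
  intro f hf
  have hle : (⨆ ν, Module.End.eigenspace (R : Module.End ℂ (Lp E 2 unitMeasure)) ν) ≤
      (ℂ ∙ g)ᗮ := by
    refine iSup_le fun ν f hf => ?_
    rw [Submodule.mem_orthogonal_singleton_iff_inner_left]
    by_cases hf0 : f = 0
    · rw [hf0, inner_zero_left]
    have hfν : R f = ν • f := Module.End.mem_eigenspace_iff.1 hf
    have hν : (starRingEnd ℂ) ν = ν :=
      hsymm.conj_eigenvalue_eq_self (Module.End.hasEigenvalue_of_hasEigenvector ⟨hf, hf0⟩)
    obtain ⟨ψ, ψ₁, h1, ψ₂, h2, h3, h4, h5⟩ := hR f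
    have hψf : ∀ᵐ x ∂unitMeasure, ψ x = ν • f x := by
      filter_upwards [h1, Lp.coeFn_smul ν f] with x h6 h7
      rw [← h6, hfν, h7, Pi.smul_apply]
    -- The resolvent is injective: if `ψ` vanishes almost everywhere, so does `ψ₂`, and the equation
    -- returns `f = 0`.
    have hν0 : ν ≠ 0 := by
      rintro rfl
      apply hf0
      have h6 : ψ =ᵐ[unitMeasure] 0 := hψf.mono fun x hx => by simpa using hx
      have h7 := h2.deriv_two_ae_eq_zero fun x hx => (h2.eq_zero_of_ae h6 x hx).2
      refine Lp.ext ?_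
      filter_upwards [h3, h6, h7, Lp.coeFn_zero E 2 unitMeasure] with x h8 h9 h10 h11
      rw [h9, h10] at h8
      rw [h11]
      simpa using h8.symm
    obtain ⟨r, rfl⟩ : ∃ r : ℝ, ν = r := ⟨ν.re, (Complex.conj_eq_iff_re.1 hν).symm⟩
    -- `(L - mu) ψ = f` and `ψ = r f` combine to `L ψ = (mu + 1/r) ψ`.
    have hs : IsSLSolution V ((mu + r⁻¹ : ℝ) : ℂ) ψ ψ₁ := by
      refine ⟨ψ₂, h2, ?_⟩
      filter_upwards [h3, hψf] with x h8 h9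
      rw [h8]
      push_cast
      rw [add_smul, h9, smul_smul (r : ℂ)⁻¹, inv_mul_cancel₀ hν0, one_smul]
    obtain ⟨F, F₁, hF⟩ := exists_isFundMinus h.integrable hT h.a_compress ((mu + r⁻¹ : ℝ) : ℂ)
    have h6 := hF.eq_apply h.integrable hT h.a_compress hs h4
    set c := bdryMinusPerp Tm (ψ 0) (ψ₁ 0)
    have h7 := hg _ F F₁ c hF (by
      rw [← bdryPlus_apply, ← (h6 1 one_mem_unit).1, ← (h6 1 one_mem_unit).2, h5])
    have h8 : (r : ℂ) * ⟪f, g⟫_ℂ = 0 := by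
      rw [← h7, L2.inner_def, ← integral_const_mul]
      refine integral_congr_ae ?_
      filter_upwards [hψf, ae_restrict_mem measurableSet_Icc] with x h9 hx
      rw [← (h6 x hx).1, h9, inner_smul_left, Complex.conj_ofReal]
    exact (mul_eq_zero.1 h8).resolve_left hν0
  exact (Submodule.mem_orthogonal_singleton_iff_inner_left).1 (hle hf)

end Completeness

/-! ### From the spectral data to Gram matrices -/

section SpectralData

open scoped InnerProductSpace

variable {E : Type*} [NormedAddCommGroup E] [InnerProductSpace ℂ E] [FiniteDimensional ℂ E]
  [CompleteSpace E] {Tm Tp : E →L[ℂ] E} {V V' : ℝ → E →L[ℂ] E} {a a' b b' : E →L[ℂ] E}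

theorem IsFundMinus.continuousOn {z : ℂ} {F F₁ : ℝ → E →L[ℂ] E} (hF : IsFundMinus Tm V a z F F₁) :
    ContinuousOn F (Icc 0 1) := by
  obtain ⟨_, h1, -⟩ := hF
  exact h1.continuousOn

theorem IsFundMinus.unique {z : ℂ} {F F₁ G G₁ : ℝ → E →L[ℂ] E} (hV : Integrable V unitMeasure)
    (hTm : Tm * Tm = Tm) (ha : (1 - Tm) * a * (1 - Tm) = a) (hF : IsFundMinus Tm V a z F F₁)
    (hG : IsFundMinus Tm V a z G G₁) : ∀ x ∈ Icc (0 : ℝ) 1, F x = G x ∧ F₁ x = G₁ x := by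
  intro x hx
  have h1 := fun c => hF.eq_apply hV hTm ha (hG.hasACDerivs_apply c) (hG.bdryMinus_apply c) x hx
  simp only [hG.bdryMinusPerp_apply] at h1
  exact ⟨ContinuousLinearMap.ext fun c => (h1 c).1.symm,
    ContinuousLinearMap.ext fun c => (h1 c).2.symm⟩

theorem spectralTriple_congr {lam : ℝ} {F F₁ G G₁ : ℝ → E →L[ℂ] E}
    (h : ∀ x ∈ Icc (0 : ℝ) 1, F x = G x ∧ F₁ x = G₁ x) :
    spectralTriple Tp b lam F F₁ = spectralTriple Tp b lam G G₁ := by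
  have h1 : ∫ x in (0 : ℝ)..1, star (F x) * F x = ∫ x in (0 : ℝ)..1, star (G x) * G x := by
    refine intervalIntegral.integral_congr fun x hx => ?_
    rw [uIcc_of_le zero_le_one] at hx
    simp only [(h x hx).1]
  unfold spectralTriple
  rw [h1, (h 1 one_mem_unit).1, (h 1 one_mem_unit).2]

/-- Equality of the sets becomes equality of individual triples because the first component `λ`
singles out the triple: `F₋(·, λ)` is unique on `[0,1]`, so the triple does not depend on its
choice. -/
theorem spectralTriple_eq_of_spectralData_eq (h' : IsSLParam Tm Tp V' a' b')
    (hTm : Tm * Tm = Tm) (hdata : spectralData Tm Tp V a b = spectralData Tm Tp V' a' b')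
    {lam : ℝ} (hlam : IsSLEigenvalue Tm Tp V a b lam) {F F₁ F' F₁' : ℝ → E →L[ℂ] E}
    (hF : IsFundMinus Tm V a (lam : ℂ) F F₁) (hF' : IsFundMinus Tm V' a' (lam : ℂ) F' F₁') :
    spectralTriple Tp b lam F F₁ = spectralTriple Tp b' lam F' F₁' := by
  have h1 : spectralTriple Tp b lam F F₁ ∈ spectralData Tm Tp V' a' b' := by
    rw [← hdata]
    exact ⟨lam, hlam, F, F₁, hF, rfl⟩
  obtain ⟨lam', -, G, G₁, hG, e⟩ := h1
  have e1 : lam = lam' := congrArg SpectralTriple.eigenvalue e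
  subst e1
  rw [e]
  exact spectralTriple_congr (hG.unique h'.integrable hTm h'.a_compress hF')

/-- The operator `g` of a spectral triple, extended by `g P` to the whole space. -/
noncomputable def SpectralTriple.extended (t : SpectralTriple E) : E →ₗ[ℂ] E :=
  (LinearMap.range t.P.toLinearMap).subtype ∘ₗ t.g ∘ₗ t.P.toLinearMap.rangeRestrict

/-- The type of `g` depends on `P`; its extension to `E` has a fixed type, so equality of triples
can be used by plain rewriting. -/
theorem spectralTriple_extended_apply (lam : ℝ) (F F₁ : ℝ → E →L[ℂ] E) (c : E) :
    (spectralTriple Tp b lam F F₁).extended c =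
      (spectralTriple Tp b lam F F₁).P ((∫ x in (0 : ℝ)..1, star (F x) * F x)
        ((spectralTriple Tp b lam F F₁).P ((spectralTriple Tp b lam F F₁).P c))) := rfl

theorem mem_ker_iff_spectralTriple_P (lam : ℝ) (F F₁ : ℝ → E →L[ℂ] E) (c : E) :
    bdryPlus (M := E →L[ℂ] E) Tp b (F 1) (F₁ 1) c = 0 ↔
      (spectralTriple Tp b lam F F₁).P c = c := by
  change _ ↔ (LinearMap.ker _).starProjection c = c
  rw [Submodule.starProjection_eq_self_iff]
  rfl

theorem inner_extended_spectralTriple {lam : ℝ} {F F₁ : ℝ → E →L[ℂ] E}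
    (hF : ContinuousOn F (Icc 0 1)) {c d : E}
    (hc : bdryPlus (M := E →L[ℂ] E) Tp b (F 1) (F₁ 1) c = 0)
    (hd : bdryPlus (M := E →L[ℂ] E) Tp b (F 1) (F₁ 1) d = 0) :
    ⟪c, (spectralTriple Tp b lam F F₁).extended d⟫_ℂ =
      ∫ x, ⟪F x c, F x d⟫_ℂ ∂unitMeasure := by
  rw [mem_ker_iff_spectralTriple_P lam] at hc hd
  rw [spectralTriple_extended_apply, hd, hd]
  have hP : ∀ x y, ⟪(spectralTriple Tp b lam F F₁).P x, y⟫_ℂ =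
      ⟪x, (spectralTriple Tp b lam F F₁).P y⟫_ℂ := fun x y =>
    Submodule.inner_starProjection_left_eq_right _ x y
  rw [← hP, hc, integral_unit_eq_intervalIntegral]
  have hi : IntervalIntegrable (fun x => star (F x) * F x) volume 0 1 :=
    ((hF.star).mul hF).integrable_unit.intervalIntegrable_of_unit zero_mem_unit one_mem_unit
  have e1 := ContinuousLinearMap.intervalIntegral_apply hi d
  rw [e1]
  have hi' : IntervalIntegrable (fun x => (star (F x) * F x) d) volume 0 1 :=
    (((hF.star).mul hF).clm_apply continuousOn_const).integrable_unit.intervalIntegrable_of_unit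
      zero_mem_unit one_mem_unit
  have e2 := (innerSL ℂ c).intervalIntegral_comp_comm hi'
  rw [← innerSL_apply_apply, ← e2]
  refine intervalIntegral.integral_congr fun x _ => ?_
  change ⟪c, (ContinuousLinearMap.adjoint (F x)) (F x d)⟫_ℂ = _
  rw [ContinuousLinearMap.adjoint_inner_right]

/-- A nonzero `c` makes `lam` an eigenvalue, so the data contain a triple for it, and its projector
determines the kernel. -/
theorem bdryPlus_eq_zero_of_spectralData_eq (h : IsSLParam Tm Tp V a b)
    (h' : IsSLParam Tm Tp V' a' b') (hTm : Tm * Tm = Tm)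
    (hdata : spectralData Tm Tp V a b = spectralData Tm Tp V' a' b') {lam : ℝ}
    {F F₁ F' F₁' : ℝ → E →L[ℂ] E} (hF : IsFundMinus Tm V a (lam : ℂ) F F₁)
    (hF' : IsFundMinus Tm V' a' (lam : ℂ) F' F₁') {c : E}
    (hc : bdryPlus (M := E →L[ℂ] E) Tp b (F 1) (F₁ 1) c = 0) :
    bdryPlus (M := E →L[ℂ] E) Tp b' (F' 1) (F₁' 1) c = 0 := by
  by_cases h0 : c = 0
  · rw [h0, map_zero]
  have hlam : IsSLEigenvalue Tm Tp V a b lam :=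
    (hF.isSLEigenvalue_iff h.integrable hTm h.a_compress).2 ⟨c, h0, hc⟩
  rw [mem_ker_iff_spectralTriple_P lam] at hc ⊢
  rwa [← spectralTriple_eq_of_spectralData_eq h' hTm hdata hlam hF hF']

/-- The spectral data determine the Gram matrices of the eigenfunctions. -/
theorem gram_eq_of_spectralData_eq (h : IsSLParam Tm Tp V a b)
    (h' : IsSLParam Tm Tp V' a' b') (hTm : Tm * Tm = Tm)
    (hdata : spectralData Tm Tp V a b = spectralData Tm Tp V' a' b') {lam : ℝ}
    {F F₁ F' F₁' : ℝ → E →L[ℂ] E} (hF : IsFundMinus Tm V a (lam : ℂ) F F₁)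
    (hF' : IsFundMinus Tm V' a' (lam : ℂ) F' F₁') {c d : E}
    (hc : bdryPlus (M := E →L[ℂ] E) Tp b (F 1) (F₁ 1) c = 0)
    (hd : bdryPlus (M := E →L[ℂ] E) Tp b (F 1) (F₁ 1) d = 0) :
    ∫ x, ⟪F x c, F x d⟫_ℂ ∂unitMeasure = ∫ x, ⟪F' x c, F' x d⟫_ℂ ∂unitMeasure := by
  by_cases h0 : c = 0
  · simp [h0]
  have hlam : IsSLEigenvalue Tm Tp V a b lam :=
    (hF.isSLEigenvalue_iff h.integrable hTm h.a_compress).2 ⟨c, h0, hc⟩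
  have hc' := bdryPlus_eq_zero_of_spectralData_eq h h' hTm hdata hF hF' hc
  have hd' := bdryPlus_eq_zero_of_spectralData_eq h h' hTm hdata hF hF' hd
  rw [← inner_extended_spectralTriple hF.continuousOn hc hd (lam := lam),
    ← inner_extended_spectralTriple hF'.continuousOn hc' hd' (lam := lam),
    spectralTriple_eq_of_spectralData_eq h' hTm hdata hlam hF hF']

end SpectralData

/-! ### The unitary operator between the two families of eigenfunctions -/

section Uniqueness

open scoped InnerProductSpace

/-- Two complete families with the same Gram matrix are related by a unitary operator. -/
theorem exists_unitary_of_gram_eq {H ι : Type*} [NormedAddCommGroup H] [InnerProductSpace ℂ H]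
    [CompleteSpace H] {φ φ' : ι → H} (hg : ∀ i j, ⟪φ i, φ j⟫_ℂ = ⟪φ' i, φ' j⟫_ℂ)
    (hd : DenseRange (Finsupp.linearCombination ℂ φ))
    (hd' : DenseRange (Finsupp.linearCombination ℂ φ')) :
    ∃ W W' : H →L[ℂ] H,
      (∀ u, W (Finsupp.linearCombination ℂ φ u) = Finsupp.linearCombination ℂ φ' u) ∧
      (∀ u, W' (Finsupp.linearCombination ℂ φ' u) = Finsupp.linearCombination ℂ φ u) ∧
      ∀ f g, ⟪W f, g⟫_ℂ = ⟪f, W' g⟫_ℂ := by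
  have h1 : ∀ u v, ⟪Finsupp.linearCombination ℂ φ u, Finsupp.linearCombination ℂ φ v⟫_ℂ =
      ⟪Finsupp.linearCombination ℂ φ' u, Finsupp.linearCombination ℂ φ' v⟫_ℂ := fun u v => by
    simp only [Finsupp.linearCombination_apply, Finsupp.sum, sum_inner, inner_sum,
      inner_smul_left, inner_smul_right, hg]
  -- The families may be linearly dependent; equality of norms also makes the correspondence of
  -- combinations well defined.
  have h2 : ∀ u, ‖Finsupp.linearCombination ℂ φ u‖ = ‖Finsupp.linearCombination ℂ φ' u‖ :=
    fun u => by rw [@norm_eq_sqrt_re_inner ℂ, @norm_eq_sqrt_re_inner ℂ, h1]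
  have hW := LinearMap.extendOfNorm_eq (f := Finsupp.linearCombination ℂ φ') hd
    ⟨1, fun u => by rw [one_mul, h2]⟩
  have hW' := LinearMap.extendOfNorm_eq (f := Finsupp.linearCombination ℂ φ) hd'
    ⟨1, fun u => by rw [one_mul, h2]⟩
  set W := (Finsupp.linearCombination ℂ φ').extendOfNorm (Finsupp.linearCombination ℂ φ)
  set W' := (Finsupp.linearCombination ℂ φ).extendOfNorm (Finsupp.linearCombination ℂ φ')
  refine ⟨W, W', hW, hW', fun f g => ?_⟩
  refine hd.induction_on (p := fun f => ⟪W f, g⟫_ℂ = ⟪f, W' g⟫_ℂ) f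
    (isClosed_eq (by fun_prop) (by fun_prop)) fun u => ?_
  refine hd'.induction_on (p := fun g => ⟪W _, g⟫_ℂ = ⟪_, W' g⟫_ℂ) g
    (isClosed_eq (by fun_prop) (by fun_prop)) fun v => ?_
  rw [hW, hW', h1]

variable {E : Type*} [NormedAddCommGroup E] [InnerProductSpace ℂ E]
  [CompleteSpace E] {Tm Tp : E →L[ℂ] E} {V V' : ℝ → E →L[ℂ] E} {a a' b b' : E →L[ℂ] E}

/-- The column `F c`, as an element of `L²`. -/
noncomputable def columnL2 {F : ℝ → E →L[ℂ] E} (hF : ContinuousOn F (Icc 0 1)) (c : E) :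
    Lp E 2 unitMeasure :=
  (hF.clm_apply (continuousOn_const (c := c))).memLp_unit.toLp (fun x => F x c)

theorem columnL2_coe {F : ℝ → E →L[ℂ] E} (hF : ContinuousOn F (Icc 0 1)) (c : E) :
    columnL2 hF c =ᵐ[unitMeasure] fun x => F x c := MemLp.coeFn_toLp _

theorem inner_columnL2 {F : ℝ → E →L[ℂ] E} (hF : ContinuousOn F (Icc 0 1)) (c : E)
    (g : Lp E 2 unitMeasure) : ⟪columnL2 hF c, g⟫_ℂ = ∫ x, ⟪F x c, g x⟫_ℂ ∂unitMeasure := by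
  rw [L2.inner_def]
  refine integral_congr_ae ?_
  filter_upwards [columnL2_coe hF c] with x hx
  rw [hx]

theorem inner_columnL2_columnL2 {F G : ℝ → E →L[ℂ] E} (hF : ContinuousOn F (Icc 0 1))
    (hG : ContinuousOn G (Icc 0 1)) (c d : E) :
    ⟪columnL2 hF c, columnL2 hG d⟫_ℂ = ∫ x, ⟪F x c, G x d⟫_ℂ ∂unitMeasure := by
  rw [inner_columnL2]
  refine integral_congr_ae ?_
  filter_upwards [columnL2_coe hG d] with x hx
  rw [hx]

theorem linearCombination_columnL2_coe {ι : Type*} {F : ℝ → ℝ → E →L[ℂ] E}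
    (hF : ∀ lam, ContinuousOn (F lam) (Icc 0 1)) (p : ι → ℝ × E) (u : ι →₀ ℂ) :
    Finsupp.linearCombination ℂ (fun i => columnL2 (hF (p i).1) (p i).2) u =ᵐ[unitMeasure]
      fun x => ∑ i ∈ u.support, F (p i).1 x (u i • (p i).2) := by
  rw [Finsupp.linearCombination_apply, Finsupp.sum]
  have h1 : ∀ᵐ x ∂unitMeasure, ∀ i ∈ u.support,
      (u i • columnL2 (hF (p i).1) (p i).2 : Lp E 2 unitMeasure) x = F (p i).1 x (u i • (p i).2) := by
    refine (ae_ball_iff u.support.countable_toSet).2 ?_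
    intro i _
    filter_upwards [columnL2_coe (hF (p i).1) (p i).2,
      Lp.coeFn_smul (u i) (columnL2 (hF (p i).1) (p i).2)] with x h2 h3
    rw [h3, Pi.smul_apply, h2, map_smul]
  filter_upwards [h1, Lp.coeFn_finsetSum u.support
    (fun i => (u i • columnL2 (hF (p i).1) (p i).2 : Lp E 2 unitMeasure))] with x h2 h3
  rw [h3, Finset.sum_apply]
  exact Finset.sum_congr rfl h2

theorem exists_fundMinus_comparison (ι : Type*) (hV : Integrable V unitMeasure)
    (hV' : Integrable V' unitMeasure) (hTm : Tm * Tm = Tm)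
    (ha : (1 - Tm) * a * (1 - Tm) = a) (ha' : (1 - Tm) * a' * (1 - Tm) = a')
    {F F₁ F' F₁' : ℝ → ℝ → E →L[ℂ] E}
    (hF : ∀ lam : ℝ, IsFundMinus Tm V a (lam : ℂ) (F lam) (F₁ lam))
    (hF' : ∀ lam : ℝ, IsFundMinus Tm V' a' (lam : ℂ) (F' lam) (F₁' lam)) :
    ∃ K : ℝ, 0 ≤ K ∧ ∀ (s : Finset ι) (l : ι → ℝ) (c : ι → E), ∀ x ∈ Icc (0 : ℝ) 1,
      ‖∑ i ∈ s, F' (l i) x (c i) - ∑ i ∈ s, F (l i) x (c i)‖ ≤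
        K * ∫ t in (0 : ℝ)..x, ‖∑ i ∈ s, F (l i) t (c i)‖ := by
  obtain ⟨K, hK, h⟩ := exists_comparison_bound ι hV hV' hTm (compress_mul_eq_zero hTm ha)
    (compress_mul_eq_zero hTm ha')
  exact ⟨K, hK, fun s l c => h s (fun i => l i) c _ (fun i x => F₁ (l i) x (c i)) _
    (fun i x => F₁' (l i) x (c i)) (fun i _ => (hF (l i)).hasACDerivs_apply (c i))
    (fun i _ => ((hF (l i)).initial hTm ha (c i)).1)
    (fun i _ => ((hF (l i)).initial hTm ha (c i)).2)
    (fun i _ => (hF' (l i)).hasACDerivs_apply (c i))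
    (fun i _ => ((hF' (l i)).initial hTm ha' (c i)).1)
    (fun i _ => ((hF' (l i)).initial hTm ha' (c i)).2)⟩

theorem ae_comparison_columnL2 {ι : Type*} {F F' : ℝ → ℝ → E →L[ℂ] E} {K : ℝ}
    (hF : ∀ lam, ContinuousOn (F lam) (Icc 0 1)) (hF' : ∀ lam, ContinuousOn (F' lam) (Icc 0 1))
    (hK : ∀ (s : Finset ι) (l : ι → ℝ) (c : ι → E), ∀ x ∈ Icc (0 : ℝ) 1,
      ‖∑ i ∈ s, F' (l i) x (c i) - ∑ i ∈ s, F (l i) x (c i)‖ ≤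
        K * ∫ t in (0 : ℝ)..x, ‖∑ i ∈ s, F (l i) t (c i)‖) (p : ι → ℝ × E) (u : ι →₀ ℂ) :
    ∀ᵐ x ∂unitMeasure,
      ‖Finsupp.linearCombination ℂ (fun i => columnL2 (hF' (p i).1) (p i).2) u x -
        Finsupp.linearCombination ℂ (fun i => columnL2 (hF (p i).1) (p i).2) u x‖ ≤
      K * ∫ t in (0 : ℝ)..x,
        ‖Finsupp.linearCombination ℂ (fun i => columnL2 (hF (p i).1) (p i).2) u t‖ := by
  have h1 := linearCombination_columnL2_coe hF p u
  filter_upwards [h1, linearCombination_columnL2_coe hF' p u,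
    ae_restrict_mem measurableSet_Icc] with x h2 h3 hx
  rw [h2, h3]
  refine (hK u.support (fun i => (p i).1) (fun i => u i • (p i).2) x hx).trans_eq ?_
  congr 1
  refine intervalIntegral.integral_congr_ae_restrict ?_
  rw [uIoc_of_le hx.1]
  have hsub : Ioc 0 x ⊆ Icc (0 : ℝ) 1 := Ioc_subset_Icc_self.trans (Icc_subset_Icc_right hx.2)
  filter_upwards [ae_restrict_of_ae_restrict_of_subset hsub h1] with t ht
  rw [ht]

variable [FiniteDimensional ℂ E]

/-- Completeness of the eigenfunctions. -/
theorem IsSLParam.denseRange_linearCombination (h : IsSLParam Tm Tp V a b)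
    (hTm : IsStarProjection Tm) (hTp : IsStarProjection Tp) {ι : Type*} (p : ι → ℝ × E)
    {F F₁ : ℝ → ℝ → E →L[ℂ] E}
    (hF : ∀ lam : ℝ, IsFundMinus Tm V a (lam : ℂ) (F lam) (F₁ lam))
    (hp : ∀ lam c, bdryPlus (M := E →L[ℂ] E) Tp b (F lam 1) (F₁ lam 1) c = 0 →
      ∃ i, p i = (lam, c)) :
    DenseRange (Finsupp.linearCombination ℂ
      (fun i => columnL2 (hF (p i).1).continuousOn (p i).2)) := by
  set A := Finsupp.linearCombination ℂ (fun i => columnL2 (hF (p i).1).continuousOn (p i).2)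
  have h1 : (LinearMap.range A).topologicalClosure = ⊤ := by
    rw [Submodule.topologicalClosure_eq_top_iff, Submodule.eq_bot_iff]
    intro g hg
    refine h.eq_zero_of_orthogonal hTm hTp g fun lam G G₁ c hG hc => ?_
    have hu := hG.unique h.integrable hTm.isIdempotentElem h.a_compress (hF lam)
    rw [(hu 1 one_mem_unit).1, (hu 1 one_mem_unit).2] at hc
    obtain ⟨i, hi⟩ := hp lam c hc
    have h2 := (Submodule.mem_orthogonal _ g).1 hg (A (Finsupp.single i 1)) ⟨_, rfl⟩
    rw [Finsupp.linearCombination_single, one_smul, inner_columnL2, hi] at h2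
    rw [← h2]
    refine integral_congr_ae ?_
    filter_upwards [ae_restrict_mem measurableSet_Icc] with x hx
    rw [(hu x hx).1]
  have h3 : closure (range A) = univ := by
    rw [← LinearMap.coe_range, ← Submodule.topologicalClosure_coe, h1, Submodule.top_coe]
  exact dense_iff_closure_eq.2 h3

end Uniqueness

/-! ### Coincidence of the fundamental solutions and recovery of `V`, `a`, `b` -/

section Uniqueness

open scoped InnerProductSpace

variable {E : Type*} [NormedAddCommGroup E] [InnerProductSpace ℂ E] [FiniteDimensional ℂ E]
  [CompleteSpace E] {Tm Tp : E →L[ℂ] E} {V V' : ℝ → E →L[ℂ] E} {a a' b b' : E →L[ℂ] E}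
  {F F₁ F' F₁' : ℝ → ℝ → E →L[ℂ] E}

/-- The Gram matrices of all eigenfunctions coincide. -/
theorem inner_columnL2_eq_of_spectralData_eq (h : IsSLParam Tm Tp V a b)
    (h' : IsSLParam Tm Tp V' a' b') (hTm : IsStarProjection Tm) (hTp : IsStarProjection Tp)
    (hdata : spectralData Tm Tp V a b = spectralData Tm Tp V' a' b')
    (hF : ∀ lam : ℝ, IsFundMinus Tm V a (lam : ℂ) (F lam) (F₁ lam))
    (hF' : ∀ lam : ℝ, IsFundMinus Tm V' a' (lam : ℂ) (F' lam) (F₁' lam)) {lam mu : ℝ} {c d : E}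
    (hc : bdryPlus (M := E →L[ℂ] E) Tp b (F lam 1) (F₁ lam 1) c = 0)
    (hd : bdryPlus (M := E →L[ℂ] E) Tp b (F mu 1) (F₁ mu 1) d = 0) :
    ⟪columnL2 (hF lam).continuousOn c, columnL2 (hF mu).continuousOn d⟫_ℂ =
      ⟪columnL2 (hF' lam).continuousOn c, columnL2 (hF' mu).continuousOn d⟫_ℂ := by
  have hT := hTm.isIdempotentElem
  rw [inner_columnL2_columnL2, inner_columnL2_columnL2]
  rcases eq_or_ne lam mu with rfl | hne
  · exact gram_eq_of_spectralData_eq h h' hT hdata (hF lam) (hF' lam) hc hd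
  have hne' : (lam : ℂ) - mu ≠ 0 := sub_ne_zero.2 (Complex.ofReal_injective.ne hne)
  have hc' := bdryPlus_eq_zero_of_spectralData_eq h h' hT hdata (hF lam) (hF' lam) hc
  have hd' := bdryPlus_eq_zero_of_spectralData_eq h h' hT hdata (hF mu) (hF' mu) hd
  have h1 := h.green_solutions hTm hTp ((hF lam).hasACDerivs_apply c)
    ((hF mu).hasACDerivs_apply d) ((hF lam).bdryMinus_apply c) ((hF mu).bdryMinus_apply d)
    (map_zero Tp) hc hd
  have h2 := h'.green_solutions hTm hTp ((hF' lam).hasACDerivs_apply c)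
    ((hF' mu).hasACDerivs_apply d) ((hF' lam).bdryMinus_apply c) ((hF' mu).bdryMinus_apply d)
    (map_zero Tp) hc' hd'
  rw [inner_zero_left, neg_zero, mul_eq_zero, or_iff_right hne'] at h1 h2
  rw [h1, h2]

/-- The spectral data determine the fundamental solutions. -/
theorem fundMinus_eq_of_spectralData_eq (h : IsSLParam Tm Tp V a b)
    (h' : IsSLParam Tm Tp V' a' b') (hTm : IsStarProjection Tm) (hTp : IsStarProjection Tp)
    (hdata : spectralData Tm Tp V a b = spectralData Tm Tp V' a' b')
    (hF : ∀ lam : ℝ, IsFundMinus Tm V a (lam : ℂ) (F lam) (F₁ lam))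
    (hF' : ∀ lam : ℝ, IsFundMinus Tm V' a' (lam : ℂ) (F' lam) (F₁' lam)) (lam : ℝ) (c : E) :
    ∀ x ∈ Icc (0 : ℝ) 1, F' lam x c = F lam x c := by
  have hT := hTm.isIdempotentElem
  -- The index set consists of all pairs `(λ, c)` with `c` in the kernel, without choosing bases;
  -- pairs with `c = 0` are harmless.
  let p : {q : ℝ × E // bdryPlus (M := E →L[ℂ] E) Tp b (F q.1 1) (F₁ q.1 1) q.2 = 0} → ℝ × E :=
    Subtype.val
  have cF := fun lam => (hF lam).continuousOn
  have cF' := fun lam => (hF' lam).continuousOn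
  have hd := h.denseRange_linearCombination hTm hTp p hF fun l c hc => ⟨⟨(l, c), hc⟩, rfl⟩
  have hd' := h'.denseRange_linearCombination hTm hTp p hF' fun l c hc => ⟨⟨(l, c),
    bdryPlus_eq_zero_of_spectralData_eq h' h hT hdata.symm (hF' l) (hF l) hc⟩, rfl⟩
  obtain ⟨W, W', hW, hW', hadj⟩ := exists_unitary_of_gram_eq (fun i j =>
    inner_columnL2_eq_of_spectralData_eq h h' hTm hTp hdata hF hF' i.2 j.2) hd hd'
  obtain ⟨K, hK, hb⟩ := exists_fundMinus_comparison _ h.integrable h'.integrable hT h.a_compress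
    h'.a_compress hF hF'
  obtain ⟨K', hK', hb'⟩ := exists_fundMinus_comparison _ h'.integrable h.integrable hT
    h'.a_compress h.a_compress hF' hF
  have hid : ∀ f, W f = f := eq_self_of_causal_unitary (W := W.toLinearMap)
    (W' := W'.toLinearMap) hadj
    (ae_norm_sub_le_of_dense hd W.continuous hW (ae_comparison_columnL2 cF cF' hb p))
    (ae_norm_sub_le_of_dense hd' W'.continuous hW' (ae_comparison_columnL2 cF' cF hb' p))
  have heig : ∀ i, ∀ x ∈ Icc (0 : ℝ) 1, F' (p i).1 x (p i).2 = F (p i).1 x (p i).2 := by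
    intro i
    have h1 := hW (Finsupp.single i 1)
    rw [hid, Finsupp.linearCombination_single, Finsupp.linearCombination_single, one_smul,
      one_smul] at h1
    refine Measure.eqOn_Icc_of_ae_eq volume zero_ne_one ?_
      ((cF' _).clm_apply continuousOn_const) ((cF _).clm_apply continuousOn_const)
    filter_upwards [columnL2_coe (cF (p i).1) (p i).2, columnL2_coe (cF' (p i).1) (p i).2] with
      x h2 h3
    rw [← h2, ← h3]
    exact congrArg (fun f : Lp E 2 unitMeasure => f x) h1.symm
  -- The extra index `none` carries the arbitrary column `(lam, c)`, the others an approximating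
  -- combination of eigenfunctions with opposite sign.
  obtain ⟨C, hC, hc⟩ := exists_fundMinus_comparison (Option _) h.integrable h'.integrable hT
    h.a_compress h'.a_compress hF hF'
  intro x hx
  set A := Finsupp.linearCombination ℂ fun i => columnL2 (cF (p i).1) (p i).2
  -- The eigenfunction terms are the same for both problems and cancel on the left, while on the
  -- right they make the integrand small; density of the combinations then forces the left side to
  -- vanish.
  have hbd : ∀ u, ‖F' lam x c - F lam x c‖ ≤ C * ‖columnL2 (cF lam) c - A u‖ := by
    intro u
    have h1 := hc (Finset.insertNone u.support) (fun o => o.elim lam fun i => (p i).1)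
      (fun o => o.elim c fun i => -(u i • (p i).2)) x hx
    simp only [Finset.sum_insertNone, Option.elim_none, Option.elim_some, map_neg,
      Finset.sum_neg_distrib, map_smul, heig _ x hx, add_sub_add_right_eq_sub] at h1
    refine h1.trans (mul_le_mul_of_nonneg_left ?_ hC)
    refine le_trans ?_ (Lp.integral_norm_le _)
    have h2 : ∫ t, ‖(columnL2 (cF lam) c - A u : Lp E 2 unitMeasure) t‖ ∂unitMeasure =
        ∫ t in (0 : ℝ)..1, ‖F lam t c + -∑ i ∈ u.support, u i • F (p i).1 t (p i).2‖ := by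
      rw [← integral_unit_eq_intervalIntegral]
      refine integral_congr_ae ?_
      filter_upwards [Lp.coeFn_sub (columnL2 (cF lam) c) (A u), columnL2_coe (cF lam) c,
        linearCombination_columnL2_coe cF p u] with t h3 h4 h5
      rw [h3, Pi.sub_apply, h4, h5]
      simp only [map_smul, sub_eq_add_neg]
    rw [h2]
    have hcont : ContinuousOn
        (fun t => F lam t c + -∑ i ∈ u.support, u i • F (p i).1 t (p i).2) (Icc 0 1) :=
      ((cF lam).clm_apply continuousOn_const).add (continuousOn_finsetSum _ fun i _ =>
        ((cF _).clm_apply continuousOn_const).const_smul _).neg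
    exact intervalIntegral.integral_mono_interval le_rfl hx.1 hx.2
      (Eventually.of_forall fun _ => norm_nonneg _)
      (hcont.norm.integrable_unit.intervalIntegrable_of_unit zero_mem_unit one_mem_unit)
  have h1 : ∀ f : Lp E 2 unitMeasure,
      ‖F' lam x c - F lam x c‖ ≤ C * ‖columnL2 (cF lam) c - f‖ := fun f =>
    hd.induction_on (p := fun f => _ ≤ C * ‖columnL2 (cF lam) c - f‖) f
      (isClosed_le (by fun_prop) (by fun_prop)) hbd
  have h2 := h1 (columnL2 (cF lam) c)
  rw [sub_self, norm_zero, mul_zero] at h2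
  exact sub_eq_zero.1 (norm_le_zero_iff.1 h2)

theorem fundMinus_deriv_eq {z : ℂ} {F F₁ F' F₁' : ℝ → E →L[ℂ] E} (hF : IsFundMinus Tm V a z F F₁)
    (hF' : IsFundMinus Tm V' a' z F' F₁') {c : E} (he : ∀ x ∈ Icc (0 : ℝ) 1, F' x c = F x c) :
    (∀ x ∈ Icc (0 : ℝ) 1, F₁' x c = F₁ x c) ∧
      ∀ᵐ x ∂unitMeasure, V x (F x c) = V' x (F x c) := by
  obtain ⟨u₂, h1, h2⟩ := hF.hasACDerivs_apply c
  obtain ⟨v₂, h3, h4⟩ := hF'.hasACDerivs_apply c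
  have h5 := (h3.sub h1).deriv_eq_zero fun x hx => sub_eq_zero.2 (he x hx)
  refine ⟨fun x hx => sub_eq_zero.1 (h5 x hx), ?_⟩
  filter_upwards [h2, h4, (h3.sub h1).deriv_two_ae_eq_zero h5,
    ae_restrict_mem measurableSet_Icc] with x h6 h7 h8 hx
  rw [he x hx, ← h6] at h7
  have h9 : v₂ x = u₂ x := sub_eq_zero.1 h8
  rw [h9] at h7
  exact (add_left_cancel h7).symm

/-- Equal columns have equal derivatives at `0`, where `F₁(0) c = T₋ c + a c`. -/
theorem eq_bdry_left_of_spectralData_eq (h : IsSLParam Tm Tp V a b)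
    (h' : IsSLParam Tm Tp V' a' b') (hTm : IsStarProjection Tm) (hTp : IsStarProjection Tp)
    (hdata : spectralData Tm Tp V a b = spectralData Tm Tp V' a' b')
    (hF : ∀ lam : ℝ, IsFundMinus Tm V a (lam : ℂ) (F lam) (F₁ lam))
    (hF' : ∀ lam : ℝ, IsFundMinus Tm V' a' (lam : ℂ) (F' lam) (F₁' lam)) : a = a' := by
  have hT := hTm.isIdempotentElem
  ext1 c
  have h1 := (fundMinus_deriv_eq (hF 0) (hF' 0)
    (fundMinus_eq_of_spectralData_eq h h' hTm hTp hdata hF hF' 0 c)).1 0 zero_mem_unit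
  rw [((hF 0).initial hT h.a_compress c).2, ((hF' 0).initial hT h'.a_compress c).2] at h1
  exact (add_left_cancel h1).symm

/-- `V` and `V'` agree on every column, but a single `F₋(x, λ)` need not be invertible at every `x`.
Instead constant functions are approximated in `L²` by combinations of columns; along an almost
everywhere convergent subsequence the identity passes to the limit, since each `V x` is continuous.
-/
theorem ae_eq_potential_of_spectralData_eq (h : IsSLParam Tm Tp V a b)
    (h' : IsSLParam Tm Tp V' a' b') (hTm : IsStarProjection Tm) (hTp : IsStarProjection Tp)
    (hdata : spectralData Tm Tp V a b = spectralData Tm Tp V' a' b')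
    (hF : ∀ lam : ℝ, IsFundMinus Tm V a (lam : ℂ) (F lam) (F₁ lam))
    (hF' : ∀ lam : ℝ, IsFundMinus Tm V' a' (lam : ℂ) (F' lam) (F₁' lam)) :
    V =ᵐ[unitMeasure] V' := by
  have cF := fun lam => (hF lam).continuousOn
  have hd := h.denseRange_linearCombination hTm hTp id hF fun l c _ => ⟨(l, c), rfl⟩
  have h1 : ∀ e : E, ∀ᵐ x ∂unitMeasure, V x e = V' x e := by
    intro e
    obtain ⟨g, hg, hgf⟩ := mem_closure_iff_seq_limit.1
      (hd (columnL2 (F := fun _ => 1) continuousOn_const e))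
    choose u hu using hg
    rw [← funext hu] at hgf
    obtain ⟨ns, -, h2⟩ := (tendstoInMeasure_of_tendsto_Lp hgf).exists_seq_tendsto_ae
    have h3 : ∀ n, ∀ᵐ x ∂unitMeasure, ∀ i ∈ (u (ns n)).support,
        V x (F i.1 x (u (ns n) i • i.2)) = V' x (F i.1 x (u (ns n) i • i.2)) := fun n =>
      (ae_ball_iff (u (ns n)).support.countable_toSet).2 fun i _ =>
        (fundMinus_deriv_eq (hF i.1) (hF' i.1)
          (fundMinus_eq_of_spectralData_eq h h' hTm hTp hdata hF hF' i.1 _)).2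
    filter_upwards [h2, ae_all_iff.2 h3,
      ae_all_iff.2 fun n => linearCombination_columnL2_coe cF id (u (ns n)),
      columnL2_coe (F := fun _ => 1) continuousOn_const e] with x h4 h5 h6 h7
    rw [h7] at h4
    have h8 := ((V x).continuous.tendsto _).comp h4
    have h9 := ((V' x).continuous.tendsto _).comp h4
    refine tendsto_nhds_unique h8 (h9.congr fun n => ?_)
    simp only [Function.comp_apply]
    rw [h6 n, map_sum, map_sum]
    exact Finset.sum_congr rfl fun i hi => (h5 n i hi).symm
  have h2 : ∀ᵐ x ∂unitMeasure, ∀ i, V x (stdOrthonormalBasis ℂ E i) =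
      V' x (stdOrthonormalBasis ℂ E i) := ae_all_iff.2 fun i => h1 _
  filter_upwards [h2] with x hx
  exact ContinuousLinearMap.coe_injective ((stdOrthonormalBasis ℂ E).toBasis.ext fun i => by
    simpa using hx i)

/-- Every eigenfunction `u` satisfies both right boundary conditions, so `(b - b') u(1) = 0`.
Boundary values are not controlled by `L²` density, so this is tested through Green's formula: at a
regular point `mu` take the column `F d` with `Γ₊F d = (b - b') w`. It is orthogonal to all
eigenfunctions, hence zero, and so is `(b - b') w`. -/
theorem eq_bdry_right_of_spectralData_eq (h : IsSLParam Tm Tp V a b)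
    (h' : IsSLParam Tm Tp V' a' b') (hTm : IsStarProjection Tm) (hTp : IsStarProjection Tp)
    (hdata : spectralData Tm Tp V a b = spectralData Tm Tp V' a' b')
    (hF : ∀ lam : ℝ, IsFundMinus Tm V a (lam : ℂ) (F lam) (F₁ lam))
    (hF' : ∀ lam : ℝ, IsFundMinus Tm V' a' (lam : ℂ) (F' lam) (F₁' lam)) : b = b' := by
  have hT := hTm.isIdempotentElem
  have hP := hTp.isIdempotentElem
  obtain ⟨mu, hmu⟩ := h.exists_not_isSLEigenvalue hTm hTp
  ext1 w
  set e := (b - b') w with he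
  have hTe : Tp e = 0 := by
    have h1 := DFunLike.congr_fun (mul_compress_eq_zero hP h.b_compress) w
    have h2 := DFunLike.congr_fun (mul_compress_eq_zero hP h'.b_compress) w
    change Tp (b w - b' w) = 0
    rw [map_sub]
    exact sub_eq_zero.2 (h1.trans h2.symm)
  have hinj := (hF mu).bdryPlus_injective h hT hmu
  obtain ⟨d, hd⟩ := (LinearMap.injective_iff_surjective
    (f := (bdryPlus (M := E →L[ℂ] E) Tp b (F mu 1) (F₁ mu 1)).toLinearMap)).1 hinj e
  have h0 : columnL2 (hF mu).continuousOn d = 0 := by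
    refine h.eq_zero_of_orthogonal hTm hTp _ fun lam G G₁ c hG hc => ?_
    have hu := hG.unique h.integrable hT h.a_compress (hF lam)
    rw [← inner_columnL2 hG.continuousOn, inner_columnL2_columnL2]
    by_cases hc0 : c = 0
    · simp [hc0]
    -- Regularity of `mu` allows division by `mu - lam` in Green's formula.
    have hne : lam ≠ mu := by
      rintro rfl
      exact hmu ((hG.isSLEigenvalue_iff h.integrable hT h.a_compress).2 ⟨c, hc0, hc⟩)
    have hv := fundMinus_eq_of_spectralData_eq h h' hTm hTp hdata hF hF' lam c
    have hv1 := (fundMinus_deriv_eq (hF lam) (hF' lam) hv).1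
    have hc' := bdryPlus_eq_zero_of_spectralData_eq h h' hT hdata hG (hF' lam) hc
    rw [← bdryPlus_apply, hv 1 one_mem_unit, hv1 1 one_mem_unit, ← (hu 1 one_mem_unit).1,
      ← (hu 1 one_mem_unit).2, bdryPlus_eq_iff hP h'.b_compress _ _ (map_zero Tp)] at hc'
    have hc2 := hc
    rw [← bdryPlus_apply, bdryPlus_eq_iff hP h.b_compress _ _ (map_zero Tp)] at hc2
    have hbb : b (G 1 c) = b' (G 1 c) := by
      have := hc2.2.symm.trans hc'.2
      simpa using this
    have h1 := h.green_solutions hTm hTp ((hF mu).hasACDerivs_apply d) (hG.hasACDerivs_apply c)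
      ((hF mu).bdryMinus_apply d) (hG.bdryMinus_apply c) hTe hd hc
    have hs : ⟪e, G 1 c⟫_ℂ = 0 := by
      have hsym : ⟪(b - b') w, G 1 c⟫_ℂ = ⟪w, (b - b') (G 1 c)⟫_ℂ :=
        ContinuousLinearMap.isSelfAdjoint_iff_isSymmetric.1
          (h.b_selfAdjoint.sub h'.b_selfAdjoint) w (G 1 c)
      rw [he, hsym, sub_apply, hbb, sub_self, inner_zero_right]
    have hne' : (mu : ℂ) - lam ≠ 0 := sub_ne_zero.2 (Complex.ofReal_injective.ne hne.symm)
    rw [hs, neg_zero, mul_eq_zero, or_iff_right hne',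
      ← inner_columnL2_columnL2 (hF mu).continuousOn hG.continuousOn] at h1
    rw [← inner_columnL2_columnL2 hG.continuousOn (hF mu).continuousOn, ← inner_conj_symm, h1,
      map_zero]
  have hd0 : d = 0 := (hF mu).eq_zero_of_ae <| by
    filter_upwards [columnL2_coe (hF mu).continuousOn d, Lp.coeFn_zero E 2 unitMeasure] with
      x h1 h2
    rw [← h1, h0, h2]
  have he0 : e = 0 := by rw [← hd, hd0, map_zero]
  exact sub_eq_zero.1 he0

end Uniqueness

theorem mainTheorem1 {N : ℕ}
    (Tm Tp : EuclideanSpace ℂ (Fin N) →L[ℂ] EuclideanSpace ℂ (Fin N))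
    (hTm : IsStarProjection Tm) (hTp : IsStarProjection Tp)
    (V V' : ℝ → EuclideanSpace ℂ (Fin N) →L[ℂ] EuclideanSpace ℂ (Fin N))
    (a a' b b' : EuclideanSpace ℂ (Fin N) →L[ℂ] EuclideanSpace ℂ (Fin N))
    (h : IsSLParam Tm Tp V a b) (h' : IsSLParam Tm Tp V' a' b')
    (hdata : spectralData Tm Tp V a b = spectralData Tm Tp V' a' b') :
    V =ᵐ[unitMeasure] V' ∧ a = a' ∧ b = b' := by
  have hT := hTm.isIdempotentElem
  choose F F₁ hF using fun lam : ℝ =>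
    exists_isFundMinus h.integrable hT h.a_compress (lam : ℂ)
  choose F' F₁' hF' using fun lam : ℝ =>
    exists_isFundMinus h'.integrable hT h'.a_compress (lam : ℂ)
  exact ⟨ae_eq_potential_of_spectralData_eq h h' hTm hTp hdata hF hF',
    eq_bdry_left_of_spectralData_eq h h' hTm hTp hdata hF hF',
    eq_bdry_right_of_spectralData_eq h h' hTm hTp hdata hF hF'⟩
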